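/- **Setting.** Worldsheet fields are smooth functions on $\mathbb R^2$ (light-cone coordinates $\sigma^\pm$) with values in a Grassmann algebra with $N$ generators, $N$ arbitrary. Let $\mathfrak g=\mathfrak{psu}(2,2|4)=\mathfrak g_0\oplus\mathfrak g_1\oplus\mathfrak g_2\oplus\mathfrak g_3$ with its $\mathbb Z_4$-grading, projectors $P_i$ and invariant form $\mathrm{Str}$; let $g$ be a field in the corresponding supergroup, $A_\pm=-\partial_\pm g\,g^{-1}$, and let $R$ be a constant antisymmetric operator on $\mathfrak g$ with $[RX,RY]=R([RX,Y]+[X,RY])$. Put $R_g=\mathrm{Ad}_gR\,\mathrm{Ad}_g^{-1}$, $d_{PS}=P_1+2P_2+3P_3$, $\hat d_{PS}=3P_1+2P_2+P_3$, $d_{GS}=P_1+2P_2-P_3$, $\hat d_{GS}=-P_1+2P_2+P_3$, and $\mathcal O_{PS-}=1-\eta R_gd_{PS}$, $\mathcal O_{PS+}=1+\eta R_g\hat d_{PS}$, $\mathcal O_{GS-}=1-\eta R_gd_{GS}$, $\mathcal O_{GS+}=1+\eta R_g\hat d_{GS}$, all assumed invertible; $\vartheta_\pm=\mathcal O_{PS\pm}^{-1}\mathcal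 O_{GS\pm}$. The ghosts $\lambda_1,\omega_{1+}$ (grade 1), $\lambda_3,\omega_{3-}$ (grade 3) have commuting complex coefficients, $\{\lambda_1,\lambda_1\}=\{\lambda_3,\lambda_3\}=0$ in $\mathfrak{psl}(4|4)$, and $N_-=-\{\omega_{3-},\lambda_1\}$, $N_+=-\{\omega_{1+},\lambda_3\}$. The deformed pure spinor Lagrangian is, with $J_-=\mathcal O_{PS-}^{-1}A_-$ and $\bar J_+=\mathcal O_{PS+}^{-1}A_+$, $$L_{PS}=\tfrac14\mathrm{Str}(A_+d_{PS}J_-)+\mathrm{Str}(N_+J_-+N_-\bar J_+)-\mathrm{Str}\big(N_+(1-4\eta\mathcal O_{PS-}^{-1}R_g)N_-\big)+\mathrm{Str}(\omega_{1+}\partial_-\lambda_3+\omega_{3-}\partial_+\lambda_1),$$ with BRST currents $\mathrm{Str}(\lambda_1\mathcal J_-)$, $\mathrm{Str}(\lambda_3\mathcal J_+)$, where $\mathcal J_\pm=\mathcal O_{PS\pm}^{-1}(A_\pm\mp4\eta R_gN_\pm)$. The deformed Green–Schwarz Lagrangian in conformal gauge is $L_{GS}=\tfrac14\mathrm{Str}(A_+d_{GS}\mathcal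 O_{GS-}^{-1}A_-)$; write $J_{GS\pm}(A)=\mathcal O_{GS\pm}^{-1}A$. Unbarred one-forms are taken along $\partial_-$, barred ones along $\partial_+$. The Berkovits–Howe Lagrangian is $$L_{BH}=\tfrac12G(A_-,A_+)+\tfrac12B(A_-,A_+)+d_\alpha\bar E^\alpha+\hat d_{\hat\alpha}E^{\hat\alpha}+d_\alpha\hat d_{\hat\alpha}P^{\alpha\hat\alpha}+\lambda\omega\,\bar\Omega+\hat\lambda\hat\omega\,\hat\Omega+\lambda\omega\,\hat d\,C+\hat\lambda\hat\omega\,d\,\tilde C+\lambda\omega\hat\lambda\hat\omega\,S+L_{gh},$$ with $G_{MN}=E_M^aE_N^b\eta_{ab}$ symmetric, $B$ antisymmetric, indices identified with elements of $\mathfrak g_1,\mathfrak g_3$ by $\mathrm{Str}$, and $(\lambda,\omega)=(\lambda_1,\omega_{3-})$, $(\hat\lambda,\hat\omega)=(\lambda_3,\omega_{1+})$. Let $h$ be any local frame rotation (an invertible isometry of $\mathrm{Str}$ that preserves the grading and is linear over even superfields, e.g. $\mathrm{Ad}_h$ for $h$ in the isotropy group). A background with fermionic supervielbeins $E_1=hP_1J_{GS+}$,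 $E_3=P_3J_{GS-}$ is *read off* from $L_{PS}$ if, for all currents $A_\pm\in\mathfrak g$ and all ghosts, the equations of motion of $d,\hat d$ are solved by the BRST currents, $d=hP_3\mathcal J_-$, $\hat d=P_1\mathcal J_+$, and $L_{BH}=L_{PS}$ at these values. **Theorem.** 1. $\mathcal O_{PS\pm}^{-1}=\vartheta_\pm\mathcal O_{GS\pm}^{-1}$, and $\vartheta_-=1-\tfrac43P_3+\tfrac43\mathcal O_{PS-}^{-1}P_3$, $\vartheta_-^{-1}=1-4P_3+4\mathcal O_{GS-}^{-1}P_3$, $\vartheta_+=1-\tfrac43P_1+\tfrac43\mathcal O_{PS+}^{-1}P_1$, $\vartheta_+^{-1}=1-4P_1+4\mathcal O_{GS+}^{-1}P_1$. 2. There is exactly one read-off background (as couplings to all currents, auxiliary fields and ghosts), namely that of the homogeneous Yang–Baxter deformed Green–Schwarz superstring: * $G$ and $B$ are the symmetric and antisymmetric parts of $L_{GS}=\tfrac12(G+B)$. Explicitly $G(u,v)=\mathrm{Str}(P_2J_{GS+}(u)\,P_2J_{GS+}(v))=\mathrm{Str}(P_2J_{GS-}(u)\,P_2J_{GS-}(v))$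 and $B(u,v)=\tfrac12\mathrm{Str}\big(J_{GS-}(v),(P_1-P_3+\eta\hat d_{GS}R_gd_{GS})J_{GS-}(u)\big)$; * the Ramond–Ramond bispinor is $P=h\,p$ with $p=P_1(3-4\mathcal O_{GS+}^{-1})P_1$, i.e. $d_\alpha\hat d_{\hat\alpha}P^{\alpha\hat\alpha}=\mathrm{Str}(d\,hp\,\hat d)$; on $\mathfrak g_1$ its inverse is $-P_1\vartheta_+P_1h^{-1}$; * the spin connections are $\Omega=P_0J_{GS+}$, $\hat\Omega=P_0J_{GS-}$, i.e. $\lambda\omega\bar\Omega=\mathrm{Str}(N_-\bar\Omega)$, $\hat\lambda\hat\omega\hat\Omega=\mathrm{Str}(N_+\hat\Omega)$; * $\lambda\omega\,\hat d\,C=-4\,\mathrm{Str}(N_-\,P_0\mathcal O_{GS+}^{-1}P_1\hat d)$ and $\hat\lambda\hat\omega\,d\,\tilde C=-4\,\mathrm{Str}(N_+\,P_0\mathcal O_{GS-}^{-1}P_3h^{-1}d)$; * $\lambda\omega\hat\lambda\hat\omega\,S=-\mathrm{Str}\big(N_+P_0(1-4\eta\mathcal O_{GS-}^{-1}R_g)P_0N_-\big)$.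 In particular $L_{PS}$ equals $L_{BH}$ with these fields for $A_\pm=-\partial_\pm g\,g^{-1}$. 3. Sector by sector, with $d,\hat d$ eliminated: $\tfrac14\mathrm{Str}(A_+d_{PS}J_-)=\tfrac12G(A_-,A_+)+\tfrac12B(A_-,A_+)+\mathrm{Str}(E_3,P_1\vartheta_+P_1h^{-1}\bar E_1)$; $\mathrm{Str}(N_+J_-)+\mathrm{Str}(N_-\bar J_+)=\mathrm{Str}(N_-\bar\Omega)+\mathrm{Str}(N_+\hat\Omega)+\tfrac43\mathrm{Str}(P_0\mathcal O_{PS-}^{-1}P_3E_3,N_+)+\tfrac43\mathrm{Str}(P_0\mathcal O_{PS+}^{-1}P_1h^{-1}\bar E_1,N_-)$; $-\mathrm{Str}(N_+(1-4\eta\mathcal O_{PS-}^{-1}R_g)N_-)=\lambda\omega\hat\lambda\hat\omega S-16\eta^2\,\mathrm{Str}(P_3\mathcal O_{GS-}^{-1}R_gN_-,\,P_1\vartheta_+P_1\mathcal O_{GS+}^{-1}R_gN_+)$. 4. These fields are torsion and curvature components of the Green–Schwarz supergeometry. Write $J_i=P_iJ$, $F_i(J)=P_i(\partial_-J_{(+)}-\partial_+J_{(-)})$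 for a current with light-cone components $J_{(\pm)}$, $[i,j]=[J_{i(-)},J_{j(+)}]+[J_{j(-)},J_{i(+)}]$ for $i\ne j$ and $[i,i]=[J_{i(-)},J_{i(+)}]$, with $A=-dg\,g^{-1}$. For $J=J_{GS+}(A)$, $$F_1+[0,1]=p\,[2,3]+2P_1(1-\mathcal O_{GS+}^{-1})[1,1]-4\eta P_1\mathcal O_{GS+}^{-1}R_g[2,2],$$ $$F_0+[0,0]=-[1,3]-4P_0\mathcal O_{GS+}^{-1}P_1[2,3]-P_0(1+4\eta\mathcal O_{GS+}^{-1}R_g)[2,2]-2P_0\mathcal O_{GS+}^{-1}[1,1],$$ and for $J=J_{GS-}(A)$ $$F_0+[0,0]=-[1,3]-4P_0\mathcal O_{GS-}^{-1}P_3[1,2]-P_0(1-4\eta\mathcal O_{GS-}^{-1}R_g)[2,2]-2P_0\mathcal O_{GS-}^{-1}[3,3].$$ -/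

import Mathlib

open scoped TensorProduct ContDiff Matrix

noncomputable section

namespace YB

/-! ## Worldsheet superfields: smooth complex functions with Grassmann coefficients -/

/-- Smooth complex functions on the worldsheet `ℝ × ℝ`, with light-cone coordinates
`(σ⁺, σ⁻)`. -/
def SmoothFn : StarSubalgebra ℂ (ℝ × ℝ → ℂ) where
  carrier := {f | ContDiff ℝ ∞ f}
  mul_mem' {f g} hf hg := ContDiff.mul (show ContDiff ℝ ∞ f from hf) (show ContDiff ℝ ∞ g from hg)
  add_mem' {f g} hf hg := ContDiff.add (show ContDiff ℝ ∞ f from hf) (show ContDiff ℝ ∞ g from hg)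
  algebraMap_mem' c := (contDiff_const : ContDiff ℝ ∞ (fun _ : ℝ × ℝ => c))
  star_mem' {f} hf := Complex.conjCLE.contDiff.comp (show ContDiff ℝ ∞ f from hf)

/-- The real Grassmann algebra on `N` generators. -/
abbrev Gr (N : ℕ) : Type := ExteriorAlgebra ℝ (Fin N → ℝ)

instance (N : ℕ) : StarModule ℝ (Gr N) where
  star_smul r x := by
    simp

instance : StarModule ℝ SmoothFn where
  star_smul r x := by
    apply Subtype.ext
    funext s
    change star ((r : ℂ) * x.1 s) = (r : ℂ) * star (x.1 s)
    simp

/-- Grassmann-valued smooth functions on the worldsheet. The star operation (complex conjugation on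
functions, order-reversing on the Grassmann algebra) is Mathlib's star on tensor products. -/
abbrev SF (N : ℕ) : Type := SmoothFn ⊗[ℝ] Gr N

/-- The parity automorphism: `+1` on Grassmann-even, `-1` on Grassmann-odd elements. -/
def parity (N : ℕ) : SF N →ₐ[ℂ] SF N :=
  Algebra.TensorProduct.map (AlgHom.id ℂ SmoothFn)
    (CliffordAlgebra.involute (Q := (0 : QuadraticForm ℝ (Fin N → ℝ))))

theorem parity_parity (N : ℕ) (x : SF N) : parity N (parity N x) = x := by
  induction x using TensorProduct.induction_on with
  | zero => simp
  | add x y hx hy => simp [hx, hy]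
  | tmul f a => simp [parity]

/-- The derivative of a smooth function along the vector `v`. -/
def pdFn (v : ℝ × ℝ) : SmoothFn →ₗ[ℂ] SmoothFn where
  toFun f := ⟨fun s => fderiv ℝ f.1 s v, by
    have hf : ContDiff ℝ ∞ f.1 := f.2
    exact (hf.fderiv_right (m := ∞) le_rfl).clm_apply contDiff_const⟩
  map_add' f g := by
    apply Subtype.ext
    funext s
    have hf : ContDiff ℝ ∞ f.1 := f.2
    have hg : ContDiff ℝ ∞ g.1 := g.2
    have h := fderiv_add (hf.differentiable (by simp) s) (hg.differentiable (by simp) s)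
    exact congrArg (fun L : ℝ × ℝ →L[ℝ] ℂ => L v) h
  map_smul' c f := by
    apply Subtype.ext
    funext s
    have hf : ContDiff ℝ ∞ f.1 := f.2
    have h := fderiv_const_smul (hf.differentiable (by simp) s) c
    exact congrArg (fun L : ℝ × ℝ →L[ℝ] ℂ => L v) h

/-- The derivative along `v` of a Grassmann-valued function, coefficient by coefficient. -/
def pd (N : ℕ) (v : ℝ × ℝ) : SF N →ₗ[ℂ] SF N :=
  TensorProduct.AlgebraTensorModule.map (pdFn v) LinearMap.id

/-- The two light-cone directions. -/
def vp : ℝ × ℝ := (1, 0)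
def vm : ℝ × ℝ := (0, 1)

/-! ## Supermatrices, the superalgebra `psu(2,2|4)` and its `ℤ/4`-grading -/

abbrev Idx : Type := Fin 4 ⊕ Fin 4

/-- `(4|4) × (4|4)` matrices with entries in the worldsheet superfields. -/
abbrev SMat (N : ℕ) : Type := Matrix Idx Idx (SF N)

/-- `+1` on the first block and `-1` on the second one. -/
def sgn : Idx → ℂ := Sum.elim (fun _ => 1) (fun _ => -1)

theorem sgn_mul_sgn (a b : Idx) : (sgn a * sgn b) * (sgn a * sgn b) = 1 := by
  rcases a with a | a <;> rcases b with b | b <;> simp [sgn]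

/-- An even supermatrix: even diagonal blocks, odd off-diagonal blocks. -/
def IsEvenSMat {N : ℕ} (X : SMat N) : Prop :=
  ∀ a b, parity N (X a b) = (sgn a * sgn b) • X a b

/-- The supertrace. -/
def str (N : ℕ) : SMat N →ₗ[ℂ] SF N :=
  ∑ a, sgn a • Matrix.entryLinearMap ℂ (SF N) a a

/-- Traces of the two diagonal blocks. -/
def trL (N : ℕ) : SMat N →ₗ[ℂ] SF N :=
  ∑ i : Fin 4, Matrix.entryLinearMap ℂ (SF N) (Sum.inl i) (Sum.inl i)
def trR (N : ℕ) : SMat N →ₗ[ℂ] SF N :=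
  ∑ i : Fin 4, Matrix.entryLinearMap ℂ (SF N) (Sum.inr i) (Sum.inr i)

/-- The complexified Grassmann envelope of `psl(4|4)`, i.e. even supermatrices of supertrace zero
modulo multiples of the identity. Every class is represented by its unique member both of whose
diagonal blocks are traceless. -/
def psl (N : ℕ) : Submodule ℂ (SMat N) where
  carrier := {X | IsEvenSMat X ∧ trL N X = 0 ∧ trR N X = 0}
  add_mem' := by
    rintro X Y ⟨hX, hX1, hX2⟩ ⟨hY, hY1, hY2⟩
    refine ⟨fun a b => ?_, by simp [hX1, hY1], by simp [hX2, hY2]⟩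
    simp [hX a b, hY a b]
  zero_mem' := ⟨fun a b => by simp, by simp, by simp⟩
  smul_mem' := by
    rintro c X ⟨hX, hX1, hX2⟩
    refine ⟨fun a b => ?_, by simp [hX1], by simp [hX2]⟩
    simp [hX a b, smul_comm c]

/-- The even part of a supermatrix. -/
def evenPart (N : ℕ) : SMat N →ₗ[ℂ] SMat N where
  toFun X := Matrix.of fun a b => (1 / 2 : ℂ) • (X a b + (sgn a * sgn b) • parity N (X a b))
  map_add' X Y := by
    ext a b
    simp only [Matrix.of_apply, Matrix.add_apply, map_add, smul_add]
    abel
  map_smul' c X := by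
    ext a b
    simp only [Matrix.of_apply, Matrix.smul_apply, map_smul, RingHom.id_apply, smul_add]
    rw [smul_comm c, smul_comm c, smul_comm c]

/-- The traceless representative. On matrices of supertrace zero the two block traces agree and a
multiple of the identity is subtracted. -/
def removeTrace (N : ℕ) : SMat N →ₗ[ℂ] SMat N where
  toFun X := X - Matrix.diagonal
    (Sum.elim (fun _ => (1 / 4 : ℂ) • trL N X) (fun _ => (1 / 4 : ℂ) • trR N X))
  map_add' X Y := by
    ext a b
    by_cases h : a = b
    · subst h
      rcases a with a | a <;> simp [smul_add] <;> abel
    · simp [Matrix.diagonal_apply_ne _ h]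
  map_smul' c X := by
    ext a b
    by_cases h : a = b
    · subst h
      rcases a with a | a <;> simp [smul_sub, smul_comm c]
    · simp [Matrix.diagonal_apply_ne _ h]

theorem removeTrace_evenPart_mem (N : ℕ) (X : SMat N) :
    removeTrace N (evenPart N X) ∈ psl N := by
  have hE : IsEvenSMat (evenPart N X) := by
    intro a b
    have h := sgn_mul_sgn a b
    change parity N ((1 / 2 : ℂ) • (X a b + (sgn a * sgn b) • parity N (X a b))) =
      (sgn a * sgn b) • ((1 / 2 : ℂ) • (X a b + (sgn a * sgn b) • parity N (X a b)))
    generalize sgn a * sgn b = c at h ⊢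
    generalize X a b = x
    rw [map_smul, map_add, map_smul, parity_parity, smul_comm c, smul_add c, smul_smul c c, h,
      one_smul, add_comm]
  have hL : parity N (trL N (evenPart N X)) = trL N (evenPart N X) := by
    simp only [trL, LinearMap.coe_sum, Finset.sum_apply, map_sum, Matrix.entryLinearMap_apply]
    refine Finset.sum_congr rfl fun i _ => ?_
    rw [hE]
    simp [sgn]
  have hR : parity N (trR N (evenPart N X)) = trR N (evenPart N X) := by
    simp only [trR, LinearMap.coe_sum, Finset.sum_apply, map_sum, Matrix.entryLinearMap_apply]
    refine Finset.sum_congr rfl fun i _ => ?_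
    rw [hE]
    simp [sgn]
  refine ⟨fun a b => ?_, ?_, ?_⟩
  · by_cases h : a = b
    · subst h
      have := hE a a
      rcases a with a | a <;> simp_all [removeTrace, sgn]
    · simp [removeTrace, Matrix.diagonal_apply_ne _ h, hE a b]
  · generalize evenPart N X = Y
    simp only [removeTrace, LinearMap.coe_mk, AddHom.coe_mk, map_sub]
    simp only [trL, LinearMap.coe_sum, Finset.sum_apply, Matrix.entryLinearMap_apply,
      Matrix.diagonal_apply_eq, Sum.elim_inl, Finset.sum_const, Finset.card_univ,
      Fintype.card_fin]
    rw [← Nat.cast_smul_eq_nsmul ℂ, smul_smul]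
    norm_num
  · generalize evenPart N X = Y
    simp only [removeTrace, LinearMap.coe_mk, AddHom.coe_mk, map_sub]
    simp only [trR, LinearMap.coe_sum, Finset.sum_apply, Matrix.entryLinearMap_apply,
      Matrix.diagonal_apply_eq, Sum.elim_inr, Finset.sum_const, Finset.card_univ,
      Fintype.card_fin]
    rw [← Nat.cast_smul_eq_nsmul ℂ, smul_smul]
    norm_num

/-- The class in `psl(4|4)` of a supermatrix; on even supermatrices of supertrace zero this is the
quotient map by the multiples of the identity. -/
def toPsl (N : ℕ) : SMat N →ₗ[ℂ] psl N :=
  LinearMap.codRestrict (psl N) (removeTrace N ∘ₗ evenPart N) (removeTrace_evenPart_mem N)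

abbrev Op (N : ℕ) : Type := Module.End ℂ (psl N)

/-- The Lie bracket of `psl(4|4)`. -/
def br {N : ℕ} (X Y : psl N) : psl N := toPsl N (X.1 * Y.1 - Y.1 * X.1)

/-- The invariant form `Str(X Y)`, on matrices and on `psl(4|4)`. -/
def strForm (N : ℕ) : SMat N →ₗ[ℂ] SMat N →ₗ[ℂ] SF N := (LinearMap.mul ℂ (SMat N)).compr₂ (str N)
def kf (N : ℕ) : psl N →ₗ[ℂ] psl N →ₗ[ℂ] SF N :=
  (strForm N).compl₁₂ (psl N).subtype (psl N).subtype

/-- The supertranspose of `[[A, B], [C, D]]` is `[[Aᵀ, -Cᵀ], [Bᵀ, Dᵀ]]`. -/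
def superT {N : ℕ} (X : SMat N) : SMat N :=
  Matrix.fromBlocks X.toBlocks₁₁ᵀ (-X.toBlocks₂₁ᵀ) X.toBlocks₁₂ᵀ X.toBlocks₂₂ᵀ

/-- The symplectic matrix `diag(K, K)`, which squares to `-1`. -/
def symplK : Matrix (Fin 4) (Fin 4) ℂ := !![0, -1, 0, 0; 1, 0, 0, 0; 0, 0, 0, -1; 0, 0, 1, 0]
def symplKK (N : ℕ) : SMat N :=
  (Matrix.fromBlocks symplK 0 0 symplK).map (algebraMap ℂ (SF N))

/-- The order-four automorphism `X ↦ -K Xˢᵗ K⁻¹ = K Xˢᵗ K`; the grade `k` part is its eigenspace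
of eigenvalue `iᵏ`. -/
def zfour (N : ℕ) : SMat N →ₗ[ℂ] SMat N where
  toFun X := symplKK N * superT X * symplKK N
  map_add' X Y := by
    rw [← Matrix.add_mul, ← Matrix.mul_add]
    congr 2
    ext a b
    rcases a with a | a <;> rcases b with b | b <;>
      simp [superT, Matrix.toBlocks₁₁, Matrix.toBlocks₁₂, Matrix.toBlocks₂₁, Matrix.toBlocks₂₂]
    abel
  map_smul' c X := by
    rw [RingHom.id_apply, ← Matrix.smul_mul, ← Matrix.mul_smul]
    congr 2
    ext a b
    rcases a with a | a <;> rcases b with b | b <;>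
      simp [superT, Matrix.toBlocks₁₁, Matrix.toBlocks₁₂, Matrix.toBlocks₂₁, Matrix.toBlocks₂₂]

/-- The projector `P_k` onto the grade `k` part. -/
def pr (N : ℕ) (k : ℕ) : Op N :=
  toPsl N ∘ₗ ((1 / 4 : ℂ) • ∑ j ∈ Finset.range 4, Complex.I ^ (3 * j * k) • (zfour N) ^ j) ∘ₗ
    (psl N).subtype

/-- The hermitian form of signature `(2,2|4)`. -/
def hermH (N : ℕ) : SMat N :=
  Matrix.diagonal fun a => algebraMap ℂ (SF N) (Sum.elim ![1, 1, -1, -1] (fun _ => 1) a)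

/-- Membership in the real form `psu(2,2|4)`. -/
def IsPsu {N : ℕ} (X : psl N) : Prop := X.1ᴴ * hermH N + hermH N * X.1 = 0

/-! ## Fields -/

/-- Derivative of a matrix field and of a `psl(4|4)`-valued field. -/
def pdMat (N : ℕ) (v : ℝ × ℝ) : SMat N →ₗ[ℂ] SMat N := (pd N v).mapMatrix
def pdPsl (N : ℕ) (v : ℝ × ℝ) : Op N := toPsl N ∘ₗ pdMat N v ∘ₗ (psl N).subtype

/-- A worldsheet field with values in the supergroup of `psu(2,2|4)`: an even supermatrix that
preserves the hermitian form and has constant superdeterminant. (It enters only through `Ad_g` and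
through the class of `dg g⁻¹`.) -/
structure IsGroupField {N : ℕ} (g : (SMat N)ˣ) : Prop where
  even : IsEvenSMat (g : SMat N)
  unitary : (g : SMat N)ᴴ * hermH N * (g : SMat N) = hermH N
  sdet : ∀ v, str N (pdMat N v (g : SMat N) * ((g⁻¹ : (SMat N)ˣ) : SMat N)) = 0

/-- The Maurer-Cartan current `A = -dg g⁻¹` along `v`. -/
def mc {N : ℕ} (g : (SMat N)ˣ) (v : ℝ × ℝ) : psl N :=
  toPsl N (-(pdMat N v (g : SMat N) * ((g⁻¹ : (SMat N)ˣ) : SMat N)))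

/-- `Ad_g X = g X g⁻¹`. -/
def Ad {N : ℕ} (g : (SMat N)ˣ) : Op N :=
  toPsl N ∘ₗ LinearMap.mulLeft ℂ (g : SMat N) ∘ₗ
    LinearMap.mulRight ℂ ((g⁻¹ : (SMat N)ˣ) : SMat N) ∘ₗ (psl N).subtype

/-- Linearity over the even superfields. -/
def IsEvenLinear {N : ℕ} (T : Op N) : Prop :=
  ∀ (c : SF N) (X Y : psl N), parity N c = c → Y.1 = c • X.1 → (T Y).1 = c • (T X).1

/-- A constant antisymmetric `R`-matrix on `psu(2,2|4)` that solves the homogeneous classical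
Yang-Baxter equation, extended to superfields. -/
structure IsRMatrix {N : ℕ} (R : Op N) : Prop where
  linear : IsEvenLinear R
  const : ∀ v X, R (pdPsl N v X) = pdPsl N v (R X)
  real : ∀ X, IsPsu X → IsPsu (R X)
  antisymm : ∀ X Y, kf N (R X) Y = -kf N X (R Y)
  cybe : ∀ X Y, br (R X) (R Y) = R (br (R X) Y + br X (R Y))

/-- Ghost fields `λ₁, λ₃, ω₁₊, ω₃₋`: commuting coefficients times fermionic generators. -/
structure Ghosts (N : ℕ) where
  l1 : SMat N
  l3 : SMat N
  w1 : SMat N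
  w3 : SMat N

/-- A matrix with even entries and of grade `k`, for odd `k`; it is then off-diagonal. -/
def IsGhost {N : ℕ} (k : ℕ) (X : SMat N) : Prop :=
  (∀ a b, parity N (X a b) = X a b) ∧ zfour N X = Complex.I ^ k • X

/-- The pure spinor constraint `{λ, λ} = 0` in `psl(4|4)`, i.e. `λ γᵃ λ = 0`. -/
def IsPure {N : ℕ} (X : SMat N) : Prop := toPsl N (X * X) = 0

structure Ghosts.Valid {N : ℕ} (G : Ghosts N) : Prop where
  l1 : IsGhost 1 G.l1
  l3 : IsGhost 3 G.l3
  w1 : IsGhost 1 G.w1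
  w3 : IsGhost 3 G.w3
  pure1 : IsPure G.l1
  pure3 : IsPure G.l3

/-- The Lorentz current `-{ω, λ}` of a ghost bilinear `λ ⊗ ω`. -/
def lorentz (N : ℕ) : SMat N ⊗[ℂ] SMat N →ₗ[ℂ] psl N :=
  -(toPsl N ∘ₗ TensorProduct.lift (LinearMap.mul ℂ (SMat N) + (LinearMap.mul ℂ (SMat N)).flip))

/-- The ghost bilinears `λ^α ω_β` and `λ̂^α̂ ω̂_β̂`, and the Lorentz currents
`N₀₋ = -{ω₃₋, λ₁}`, `N₀₊ = -{ω₁₊, λ₃}`. -/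
def Ghosts.lw {N : ℕ} (G : Ghosts N) : SMat N ⊗[ℂ] SMat N := G.l1 ⊗ₜ G.w3
def Ghosts.lwHat {N : ℕ} (G : Ghosts N) : SMat N ⊗[ℂ] SMat N := G.l3 ⊗ₜ G.w1
def Ghosts.Nm {N : ℕ} (G : Ghosts N) : psl N := lorentz N G.lw
def Ghosts.Np {N : ℕ} (G : Ghosts N) : psl N := lorentz N G.lwHat

/-- The ghost kinetic term `Str(ω₁₊ ∂₋λ₃ + ω₃₋ ∂₊λ₁)`. -/
def Ghosts.kinetic {N : ℕ} (G : Ghosts N) : SF N :=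
  strForm N G.w1 (pdMat N vm G.l3) + strForm N G.w3 (pdMat N vp G.l1)

/-! ## Deformation operators -/

def dPS (N : ℕ) : Op N := pr N 1 + (2 : ℂ) • pr N 2 + (3 : ℂ) • pr N 3
def dPSt (N : ℕ) : Op N := (3 : ℂ) • pr N 1 + (2 : ℂ) • pr N 2 + pr N 3
def dGS (N : ℕ) : Op N := pr N 1 + (2 : ℂ) • pr N 2 - pr N 3
def dGSt (N : ℕ) : Op N := -pr N 1 + (2 : ℂ) • pr N 2 + pr N 3

/-- The data of a deformation: parameter, `R`-matrix, group field. -/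
structure Model (N : ℕ) where
  eta : ℝ
  R : Op N
  g : (SMat N)ˣ

namespace Model

variable {N : ℕ} (M : Model N)

/-- `η R_g` with `R_g = Ad_g ∘ R ∘ Ad_g⁻¹`. -/
def etaRg : Op N := (M.eta : ℂ) • (Ad M.g * M.R * Ad M.g⁻¹)

/-- The operators `O_{PS∓}`, `O_{GS∓}`. -/
def OPSm : Op N := 1 - M.etaRg * dPS N
def OPSp : Op N := 1 + M.etaRg * dPSt N
def OGSm : Op N := 1 - M.etaRg * dGS N
def OGSp : Op N := 1 + M.etaRg * dGSt N

/-- Their inverses. -/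
def iPSm : Op N := Ring.inverse M.OPSm
def iPSp : Op N := Ring.inverse M.OPSp
def iGSm : Op N := Ring.inverse M.OGSm
def iGSp : Op N := Ring.inverse M.OGSp

/-- `ϑ_± = O_{PS±}⁻¹ O_{GS±}`. -/
def thetaM : Op N := M.iPSm * M.OGSm
def thetaP : Op N := M.iPSp * M.OGSp

/-- The homogeneous Yang-Baxter setting, in which every inverse above exists. -/
structure Valid : Prop where
  rmatrix : IsRMatrix M.R
  group : IsGroupField M.g
  unitPSm : IsUnit M.OPSm
  unitPSp : IsUnit M.OPSp
  unitGSm : IsUnit M.OGSm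
  unitGSp : IsUnit M.OGSp

/-! ## The deformed pure spinor superstring -/

/-- The Lagrangian density of the deformed pure spinor superstring, as a function of the currents
`A₊, A₋` and of the ghosts:
`¼ Str(A₊ d_PS J₋) + Str(N₀₊ J₋ + N₀₋ J̄₊) - Str(N₀₊ (1 - 4η O_{PS-}⁻¹ R_g) N₀₋) + kinetic`,
with `J₋ = O_{PS-}⁻¹ A₋` and `J̄₊ = O_{PS+}⁻¹ A₊`. -/
def psLagrangian (Ap Am : psl N) (G : Ghosts N) : SF N :=
  (1 / 4 : ℂ) • kf N Ap (dPS N (M.iPSm Am)) + kf N G.Np (M.iPSm Am) + kf N G.Nm (M.iPSp Ap)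
    - kf N G.Np (G.Nm - (4 : ℂ) • M.iPSm (M.etaRg G.Nm)) + G.kinetic

/-- The full currents `𝒥_± = O_{PS±}⁻¹ (A_± ∓ 4η R_g N₀±)`. The BRST charges of the deformed model
are the integrals of `Str(λ₁ 𝒥₃₋)` and `Str(λ₃ 𝒥₁₊)`. -/
def brstM (Am : psl N) (G : Ghosts N) : psl N := M.iPSm (Am + (4 : ℂ) • M.etaRg G.Nm)
def brstP (Ap : psl N) (G : Ghosts N) : psl N := M.iPSp (Ap - (4 : ℂ) • M.etaRg G.Np)

/-! ## The deformed Green-Schwarz superstring -/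

/-- The Lagrangian density `¼ Str(A₊ d_GS O_{GS-}⁻¹ A₋)` of the deformed Green-Schwarz superstring
in conformal gauge, as a bilinear form in `(A₋, A₊)`. -/
def gsLagrangian : psl N →ₗ[ℂ] psl N →ₗ[ℂ] SF N :=
  (1 / 4 : ℂ) • ((kf N).compl₁₂ LinearMap.id (dGS N * M.iGSm)).flip

/-- Operator form of the Ramond-Ramond bispinor of the deformed Green-Schwarz superstring, before
the local frame rotation: `3 - 4 O_{GS+}⁻¹` on the grade one part. -/
def gsRR : Op N := pr N 1 * ((3 : ℂ) • 1 - (4 : ℂ) • M.iGSp) * pr N 1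

/-- Mixed curvature components of the two Green-Schwarz spin connections, as operators from grade
one, respectively grade three, to grade zero. -/
def gsC : Op N := -((4 : ℂ) • (pr N 0 * M.iGSp * pr N 1))
def gsCHat : Op N := -((4 : ℂ) • (pr N 0 * M.iGSm * pr N 3))

/-- The purely bosonic curvature component of the Green-Schwarz spin connection. -/
def gsS : Op N := -(pr N 0 * (1 - (4 : ℂ) • (M.iGSm * M.etaRg)) * pr N 0)

end Model

/-- A local frame rotation `Ad_h` of the fermionic frames: an invertible, grading preserving
isometry which is linear over the even superfields. This covers `Ad_h` for `h` in the isotropy group,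
and also lifts of ten-dimensional local Lorentz transformations. -/
structure IsFrameRotation {N : ℕ} (h : (Op N)ˣ) : Prop where
  linear : IsEvenLinear (h : Op N)
  grading : ∀ k, Commute (h : Op N) (pr N k)
  isometry : ∀ X Y, kf N ((h : Op N) X) ((h : Op N) Y) = kf N X Y

/-! ## Berkovits-Howe actions -/

/-- The background superfields of the Berkovits-Howe action, evaluated on the worldsheet. Spinor
indices are contracted: grade one (three) elements stand for the frame index `α` (`α̂`), the dual
indices being identified by `Str`; ghost bilinears `λ^α ω_β` are `λ ⊗ ω`. -/
structure BHBackground (N : ℕ) where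
  /-- fermionic supervielbeins `E^α`, `E^α̂` -/
  E1 : psl N →ₗ[ℂ] psl N
  E3 : psl N →ₗ[ℂ] psl N
  /-- the metric `G_MN = E_M^a E_N^b η_ab` and the two-form `B_MN` -/
  G : psl N →ₗ[ℂ] psl N →ₗ[ℂ] SF N
  B : psl N →ₗ[ℂ] psl N →ₗ[ℂ] SF N
  /-- `d_α d̂_α̂ P^{αα̂}` -/
  P : psl N →ₗ[ℂ] psl N →ₗ[ℂ] SF N
  /-- spin connections `λ^α ω_β Ω_α^β` and `λ̂^α̂ ω̂_β̂ Ω̂_α̂^β̂` -/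
  Om : psl N →ₗ[ℂ] SMat N ⊗[ℂ] SMat N →ₗ[ℂ] SF N
  OmHat : psl N →ₗ[ℂ] SMat N ⊗[ℂ] SMat N →ₗ[ℂ] SF N
  /-- `λ^α ω_β d̂_γ̂ C_α^{βγ̂}` and `λ̂^α̂ ω̂_β̂ d_γ C̃_α̂^{β̂γ}` -/
  C : SMat N ⊗[ℂ] SMat N →ₗ[ℂ] psl N →ₗ[ℂ] SF N
  CHat : SMat N ⊗[ℂ] SMat N →ₗ[ℂ] psl N →ₗ[ℂ] SF N
  /-- `λ^α ω_β λ̂^α̂ ω̂_β̂ S_{αα̂}^{ββ̂}` -/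
  S : SMat N ⊗[ℂ] SMat N →ₗ[ℂ] SMat N ⊗[ℂ] SMat N →ₗ[ℂ] SF N

namespace BHBackground

variable {N : ℕ} (X : BHBackground N)

/-- The Berkovits-Howe Lagrangian density, with auxiliary fields `d` (of grade three, for `d_α`) and
`dh` (of grade one, for `d̂_α̂`), in units with `2πα' = 1`:
`½ E^a Ē^b η_ab + ½ E^A Ē^B B_AB + d_α Ē^α + d̂_α̂ E^α̂ + d_α d̂_α̂ P^{αα̂} + λωΩ̄ + λ̂ω̂Ω̂
  + λω d̂ C + λ̂ω̂ d C̃ + λω λ̂ω̂ S + kinetic`; barred one-forms are taken along `∂₊`. -/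
def lagrangian (Ap Am d dh : psl N) (G : Ghosts N) : SF N :=
  (1 / 2 : ℂ) • X.G Am Ap + (1 / 2 : ℂ) • X.B Am Ap + kf N d (X.E1 Ap) + kf N dh (X.E3 Am)
    + X.P d dh + X.Om Ap G.lw + X.OmHat Am G.lwHat + X.C G.lw dh + X.CHat G.lwHat d
    + X.S G.lw G.lwHat + G.kinetic

/-- The equations of motion of the auxiliary fields `d` and `dh`. -/
def AuxEquations (Ap Am d dh : psl N) (G : Ghosts N) : Prop :=
  (∀ e : psl N, pr N 3 e = e → kf N e (X.E1 Ap) + X.P e dh + X.CHat G.lwHat e = 0) ∧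
  (∀ e : psl N, pr N 1 e = e → kf N e (X.E3 Am) + X.P d e + X.C G.lw e = 0)

end BHBackground

/-- `X` is read off from the deformed pure spinor action in the frame rotated by `h`: its metric is
symmetric and its `B`-field antisymmetric, and for all real currents and all ghosts the
auxiliary fields of the Berkovits-Howe action are, on their equations of motion, the BRST currents
`𝒥₃₋` (rotated to the frame of `E^α`) and `𝒥₁₊`, and after their elimination the Berkovits-Howe
Lagrangian is the deformed pure spinor Lagrangian. -/
structure IsReadOff {N : ℕ} (M : Model N) (h : (Op N)ˣ) (X : BHBackground N) : Prop where
  symm : ∀ u v, IsPsu u → IsPsu v → X.G u v = X.G v u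
  antisymm : ∀ u v, IsPsu u → IsPsu v → X.B u v = -X.B v u
  aux : ∀ Ap Am, IsPsu Ap → IsPsu Am → ∀ G : Ghosts N, G.Valid →
    X.AuxEquations Ap Am ((h : Op N) (pr N 3 (M.brstM Am G))) (pr N 1 (M.brstP Ap G)) G
  action : ∀ Ap Am, IsPsu Ap → IsPsu Am → ∀ G : Ghosts N, G.Valid →
    M.psLagrangian Ap Am G =
      X.lagrangian Ap Am ((h : Op N) (pr N 3 (M.brstM Am G))) (pr N 1 (M.brstP Ap G)) G

/-- Equality of the background superfields other than the fermionic frames, on all the arguments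
that occur in the action. -/
structure SameFields {N : ℕ} (X Y : BHBackground N) : Prop where
  G : ∀ u v, IsPsu u → IsPsu v → X.G u v = Y.G u v
  B : ∀ u v, IsPsu u → IsPsu v → X.B u v = Y.B u v
  P : ∀ d e, pr N 3 d = d → pr N 1 e = e → X.P d e = Y.P d e
  Om : ∀ u, IsPsu u → ∀ G : Ghosts N, G.Valid → X.Om u G.lw = Y.Om u G.lw
  OmHat : ∀ u, IsPsu u → ∀ G : Ghosts N, G.Valid → X.OmHat u G.lwHat = Y.OmHat u G.lwHat
  C : ∀ G : Ghosts N, G.Valid → ∀ e, pr N 1 e = e → X.C G.lw e = Y.C G.lw e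
  CHat : ∀ G : Ghosts N, G.Valid → ∀ d, pr N 3 d = d → X.CHat G.lwHat d = Y.CHat G.lwHat d
  S : ∀ G : Ghosts N, G.Valid → X.S G.lw G.lwHat = Y.S G.lw G.lwHat

/-- The background of the homogeneous Yang-Baxter deformed Green-Schwarz superstring in the frame
rotated by `h`. The metric and the `B`-field are the symmetric and antisymmetric parts of the
Green-Schwarz Lagrangian `½ (G + B)`; the supervielbeins are `E^α = Ad_h J_{GS1+}`,
`E^α̂ = J_{GS3-}`; the Ramond-Ramond bispinor is `Ad_h (3 - 4 O_{GS+}⁻¹)`; the spin connections are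
the grade zero parts of the Green-Schwarz currents; `C`, `C̃`, `S` are components of their
curvatures. -/
def gsBackground {N : ℕ} (M : Model N) (h : (Op N)ˣ) : BHBackground N where
  E1 := (h : Op N) * pr N 1 * M.iGSp
  E3 := pr N 3 * M.iGSm
  G := M.gsLagrangian + M.gsLagrangian.flip
  B := M.gsLagrangian - M.gsLagrangian.flip
  P := (kf N).compl₁₂ LinearMap.id ((h : Op N) * M.gsRR)
  Om := (kf N).compl₁₂ (pr N 0 * M.iGSp) (lorentz N)
  OmHat := (kf N).compl₁₂ (pr N 0 * M.iGSm) (lorentz N)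
  C := (kf N).compl₁₂ (lorentz N) M.gsC
  CHat := (kf N).compl₁₂ (lorentz N) (M.gsCHat * ((h⁻¹ : (Op N)ˣ) : Op N))
  S := ((kf N).compl₁₂ (lorentz N) (M.gsS ∘ₗ lorentz N)).flip

/-- The antisymmetrised bracket `[a₋, b₊] + [b₋, a₊]` of grade `i` and grade `j` parts. -/
def wedge {N : ℕ} (i j : ℕ) (Jm Jp : psl N) : psl N :=
  br (pr N i Jm) (pr N j Jp) + br (pr N j Jm) (pr N i Jp)

/-- The exterior derivative of a current with light-cone components `Jm`, `Jp`. -/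
def extD {N : ℕ} (Jm Jp : psl N) : psl N := pdPsl N vm Jp - pdPsl N vp Jm

end YB

end

open YB

noncomputable section

namespace YB

/-! ## Superfields: graded commutativity, derivatives and complex conjugation -/

/-! Everything except the torsion and curvature formulas is linear algebra on a `ℤ/4`-graded space
with an invariant form, isolated in `DeformedForm`. The input there is that `P₀` and `P₂` are
self-adjoint, `P₁` and `P₃` adjoint to each other, `r = η R_g` antisymmetric, and that the four
deformation operators have inverses `mS`, `pS` (pure spinor) and `m`, `p` (Green-Schwarz).

Three observations carry the algebra. Since `d_PS - d_GS = 4 P₃` and `d̂_PS - d̂_GS = 4 P₁`, the two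
kinds of inverses differ by resolvent identities (`mS_sub_m`, `pS_sub_p` and their variants). Each
`d` is a scalar on each grade, so a product such as `mS r P₃` reduces to `mS P₃` and `P₃` (`mS_r_P₃`
and its analogues). Finally `d̂` is the transpose of `d`, so the transposes of the plus inverses are
expressed through the minus ones (`pS_transpose`, `p_transpose`).

It follows that the operator `P₁ (3 - 4 p) P₁` sends the grade one pure spinor current to minus the
Green-Schwarz current (`P₁_p_P₁_pS`), while `P₁ ϑ_+ P₁` leads back (`P₁_thetaP_P₁_p`). Hence the
BRST currents solve the equations of the auxiliary fields, and each sector of the pure spinor action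
is its Green-Schwarz counterpart plus a remainder (`kinetic_sector`, `current_sector`,
`curvature_sector`). On their equations of motion, all terms of the Berkovits-Howe action containing
an auxiliary field sum to minus the bispinor term, and `aux_product` shows that this equals the sum
of the remainders.

For uniqueness, fix the fermionic frames. Without ghosts, the equations of `d` determine the
bispinor, because `O_PS+` is invertible and the real currents span the complexified algebra
(`ext_isPsu`). With ghosts they then determine `C` and `C̃`. Equality of actions leaves a sum of the
other fields, whose members are isolated by switching off currents or ghosts and by the symmetry of
`G` and `B`.

The geometric formulas follow from flatness of `A`. Writing `A = (1 + r D) J`, covariant constancy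
of `R_g` and the Yang-Baxter equation give `(1 + r D)(F + [J, J]) = r (defect)`, where the defect
measures the failure of `D` to be a derivation (`deformed_maurer_cartan`). For the Green-Schwarz
values most graded components of the defect vanish (`GradedBracket.defect`).

What remains is to establish the hypotheses for Grassmann-valued supermatrices: graded commutativity
gives cyclicity of the supertrace, and the automorphism `zfour` gives the grading, its compatibility
with bracket and form, and the grade of the ghost currents. -/

theorem two_smul_mul_gr (N : ℕ) (a b : Gr N) :
    (2 : ℝ) • (a * b) = b * a + b * CliffordAlgebra.involute a + CliffordAlgebra.involute b * a
      - CliffordAlgebra.involute b * CliffordAlgebra.involute a := by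
  have key : ∀ {i j : ZMod 2} {x y : Gr N},
      x ∈ CliffordAlgebra.evenOdd (0 : QuadraticForm ℝ (Fin N → ℝ)) i →
      y ∈ CliffordAlgebra.evenOdd (0 : QuadraticForm ℝ (Fin N → ℝ)) j →
      x * y = (-1 : ℤˣ) ^ (j * i) • (y * x) := by
    intro i j x y hx hy
    have h := CliffordAlgebra.map_mul_map_of_isOrtho_of_mem_evenOdd
      (QuadraticMap.Isometry.id (0 : QuadraticForm ℝ (Fin N → ℝ)))
      (QuadraticMap.Isometry.id (0 : QuadraticForm ℝ (Fin N → ℝ)))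
      (fun u v => by simp [QuadraticMap.IsOrtho]) x y hx hy
    simpa using h
  have dec : ∀ x : Gr N, ∃ x₀ ∈ CliffordAlgebra.evenOdd (0 : QuadraticForm ℝ (Fin N → ℝ)) 0,
      ∃ x₁ ∈ CliffordAlgebra.evenOdd (0 : QuadraticForm ℝ (Fin N → ℝ)) 1, x₀ + x₁ = x := by
    intro x
    exact Submodule.mem_sup.1
      ((CliffordAlgebra.evenOdd_isCompl (0 : QuadraticForm ℝ (Fin N → ℝ))).sup_eq_top ▸
        Submodule.mem_top)
  -- Both sides are bilinear, so homogeneous parts suffice. If the involution acts by signs `s` on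
  -- `a` and `t` on `b`, the right-hand side is `(1 + s + t - s t) b a`, which is twice the Koszul
  -- sign times `b a`.
  obtain ⟨a₀, ha₀, a₁, ha₁, rfl⟩ := dec a
  obtain ⟨b₀, hb₀, b₁, hb₁, rfl⟩ := dec b
  have h00 := key ha₀ hb₀
  have h01 := key ha₀ hb₁
  have h10 := key ha₁ hb₀
  have h11 := key ha₁ hb₁
  simp only [mul_zero, uzpow_zero, one_smul, mul_one, uzpow_one, Units.neg_smul] at h00 h01 h10 h11
  simp only [map_add, CliffordAlgebra.involute_eq_of_mem_even ha₀,
    CliffordAlgebra.involute_eq_of_mem_even hb₀, CliffordAlgebra.involute_eq_of_mem_odd ha₁,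
    CliffordAlgebra.involute_eq_of_mem_odd hb₁, add_mul, mul_add, h00, h01, h10, h11, neg_mul,
    mul_neg]
  module

theorem parity_tmul (N : ℕ) (f : SmoothFn) (a : Gr N) :
    parity N (f ⊗ₜ a) = f ⊗ₜ CliffordAlgebra.involute a := rfl

/-- Stating supercommutativity without homogeneity makes it bilinear, so it passes to the tensor
product with commuting functions by checking pure tensors. -/
theorem two_smul_mul_sf (N : ℕ) (x y : SF N) :
    (2 : ℝ) • (x * y) = y * x + y * parity N x + parity N y * x - parity N y * parity N x := by
  induction x using TensorProduct.induction_on with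
  | zero => simp
  | add x₁ x₂ h₁ h₂ =>
    simp only [add_mul, mul_add, map_add, smul_add, h₁, h₂]
    abel
  | tmul f a =>
    induction y using TensorProduct.induction_on with
    | zero => simp
    | add y₁ y₂ h₁ h₂ =>
      simp only [add_mul, mul_add, map_add, smul_add, h₁, h₂]
      abel
    | tmul g b =>
      simp only [parity_tmul, Algebra.TensorProduct.tmul_mul_tmul]
      rw [← TensorProduct.tmul_smul, two_smul_mul_gr, mul_comm f g]
      simp only [TensorProduct.tmul_add, TensorProduct.tmul_sub]

/-- Homogeneous superfields supercommute. -/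
theorem mul_comm_of_parity {N : ℕ} {x y : SF N} {s t : ℂ} (hx : parity N x = s • x)
    (hy : parity N y = t • y) : x * y = ((1 + s + t - s * t) / 2) • (y * x) := by
  have h := two_smul_mul_sf N x y
  have h2 : (2 : ℝ) • (x * y) = (2 : ℂ) • (x * y) := by
    rw [two_smul, two_smul]
  rw [h2, hx, hy] at h
  simp only [smul_mul_assoc, mul_smul_comm, smul_smul] at h
  calc x * y = (1 / 2 : ℂ) • ((2 : ℂ) • (x * y)) := by rw [smul_smul]; norm_num
    _ = _ := by rw [h]; module

theorem commute_of_even {N : ℕ} {c : SF N} (hc : parity N c = c) (x : SF N) : c * x = x * c := by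
  have h := two_smul_mul_sf N c x
  rw [hc] at h
  have h2 : (2 : ℝ) • (c * x) = (2 : ℝ) • (x * c) := by rw [h, two_smul ℝ (x * c)]; abel
  exact smul_right_injective _ (two_ne_zero (α := ℝ)) h2

theorem pd_tmul (N : ℕ) (v : ℝ × ℝ) (f : SmoothFn) (a : Gr N) :
    pd N v (f ⊗ₜ a) = pdFn v f ⊗ₜ a := rfl

theorem pdFn_mul (v : ℝ × ℝ) (f g : SmoothFn) :
    pdFn v (f * g) = pdFn v f * g + f * pdFn v g := by
  apply Subtype.ext
  funext s
  have hf : ContDiff ℝ ∞ f.1 := f.2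
  have hg : ContDiff ℝ ∞ g.1 := g.2
  have h := fderiv_mul (hf.differentiable (by simp) s) (hg.differentiable (by simp) s)
  refine (congrArg (fun L : ℝ × ℝ →L[ℝ] ℂ => L v) h).trans ?_
  change f.1 s * fderiv ℝ g.1 s v + g.1 s * fderiv ℝ f.1 s v =
    fderiv ℝ f.1 s v * g.1 s + f.1 s * fderiv ℝ g.1 s v
  ring

theorem pdFn_comm (v w : ℝ × ℝ) (f : SmoothFn) : pdFn v (pdFn w f) = pdFn w (pdFn v f) := by
  apply Subtype.ext
  funext s
  have hf : ContDiff ℝ ∞ f.1 := f.2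
  have hd : DifferentiableAt ℝ (fderiv ℝ f.1) s :=
    ((hf.fderiv_right (m := ∞) le_rfl).differentiable (by simp)) s
  have hsym : IsSymmSndFDerivAt ℝ f.1 s :=
    hf.contDiffAt.isSymmSndFDerivAt (by simp; exact WithTop.coe_le_coe.2 (le_top : (2 : ℕ∞) ≤ ⊤))
  change fderiv ℝ (fun t => fderiv ℝ f.1 t w) s v = fderiv ℝ (fun t => fderiv ℝ f.1 t v) s w
  have e : ∀ u, fderiv ℝ (fun t => fderiv ℝ f.1 t u) s =
      (fderiv ℝ (fderiv ℝ f.1) s).flip u := by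
    intro u
    rw [fderiv_clm_apply hd (differentiableAt_const u)]
    ext <;> simp
  rw [e, e]
  exact hsym v w

theorem pd_mul (N : ℕ) (v : ℝ × ℝ) (x y : SF N) :
    pd N v (x * y) = pd N v x * y + x * pd N v y := by
  induction x using TensorProduct.induction_on with
  | zero => simp
  | add x₁ x₂ h₁ h₂ => simp only [add_mul, map_add, h₁, h₂]; abel
  | tmul f a =>
    induction y using TensorProduct.induction_on with
    | zero => simp
    | add y₁ y₂ h₁ h₂ => simp only [mul_add, map_add, h₁, h₂]; abel
    | tmul g b =>
      simp only [pd_tmul, Algebra.TensorProduct.tmul_mul_tmul, pdFn_mul, TensorProduct.add_tmul]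

theorem pd_comm (N : ℕ) (v w : ℝ × ℝ) (x : SF N) : pd N v (pd N w x) = pd N w (pd N v x) := by
  induction x using TensorProduct.induction_on with
  | zero => simp
  | add x₁ x₂ h₁ h₂ => simp only [map_add, h₁, h₂]
  | tmul f a => simp only [pd_tmul, pdFn_comm v w]

theorem parity_pd (N : ℕ) (v : ℝ × ℝ) (x : SF N) :
    parity N (pd N v x) = pd N v (parity N x) := by
  induction x using TensorProduct.induction_on with
  | zero => simp
  | add x₁ x₂ h₁ h₂ => simp only [map_add, h₁, h₂]
  | tmul f a => simp only [pd_tmul, parity_tmul]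

theorem pd_one (N : ℕ) (v : ℝ × ℝ) : pd N v 1 = 0 := by
  have h := pd_mul N v 1 1
  simpa using h

theorem parity_star (N : ℕ) (x : SF N) : parity N (star x) = star (parity N x) := by
  induction x using TensorProduct.induction_on with
  | zero => simp
  | add x₁ x₂ h₁ h₂ => simp only [map_add, star_add, h₁, h₂]
  | tmul f a =>
    rw [parity_tmul, TensorProduct.star_tmul, TensorProduct.star_tmul, parity_tmul,
      CliffordAlgebra.star_def', CliffordAlgebra.star_def]
    simp

instance (N : ℕ) : StarModule ℂ (SF N) where
  star_smul c x := by
    induction x using TensorProduct.induction_on with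
    | zero => simp
    | add x₁ x₂ h₁ h₂ => simp only [smul_add, star_add, h₁, h₂]
    | tmul f a =>
      rw [TensorProduct.smul_tmul', TensorProduct.star_tmul, TensorProduct.star_tmul,
        TensorProduct.smul_tmul', star_smul]

/-! ## Even supermatrices -/

theorem IsEvenSMat.mul {N : ℕ} {X Y : SMat N} (hX : IsEvenSMat X) (hY : IsEvenSMat Y) :
    IsEvenSMat (X * Y) := by
  intro a b
  rw [Matrix.mul_apply, map_sum, Finset.smul_sum]
  refine Finset.sum_congr rfl fun c _ => ?_
  rw [map_mul, hX, hY, smul_mul_smul_comm]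
  congr 1
  rcases a with a | a <;> rcases b with b | b <;> rcases c with c | c <;> simp [sgn]

theorem IsEvenSMat.add {N : ℕ} {X Y : SMat N} (hX : IsEvenSMat X) (hY : IsEvenSMat Y) :
    IsEvenSMat (X + Y) := fun a b => by simp [hX a b, hY a b]

theorem IsEvenSMat.sub {N : ℕ} {X Y : SMat N} (hX : IsEvenSMat X) (hY : IsEvenSMat Y) :
    IsEvenSMat (X - Y) := fun a b => by simp [hX a b, hY a b, smul_sub]

theorem IsEvenSMat.neg {N : ℕ} {X : SMat N} (hX : IsEvenSMat X) : IsEvenSMat (-X) :=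
  fun a b => by simp [hX a b]

theorem IsEvenSMat.diagonal {N : ℕ} {c : Idx → SF N} (hc : ∀ a, parity N (c a) = c a) :
    IsEvenSMat (Matrix.diagonal c) := by
  intro a b
  by_cases h : a = b
  · subst h
    rcases a with a | a <;> simp [hc, sgn]
  · simp [Matrix.diagonal_apply_ne _ h]

/-- The automorphism of supermatrices whose fixed points are the even ones. -/
def parityMat (N : ℕ) : SMat N →* SMat N where
  toFun X := Matrix.of fun a b => (sgn a * sgn b) • parity N (X a b)
  map_one' := by
    ext a b
    by_cases h : a = b
    · subst h
      rcases a with a | a <;> simp [sgn]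
    · simp [Matrix.one_apply_ne h]
  map_mul' X Y := by
    ext a b
    rw [Matrix.of_apply, Matrix.mul_apply, Matrix.mul_apply, map_sum, Finset.smul_sum]
    refine Finset.sum_congr rfl fun c _ => ?_
    rw [map_mul, Matrix.of_apply, Matrix.of_apply, smul_mul_smul_comm]
    congr 1
    rcases a with a | a <;> rcases b with b | b <;> rcases c with c | c <;> simp [sgn]

theorem isEvenSMat_iff {N : ℕ} (X : SMat N) : IsEvenSMat X ↔ parityMat N X = X := by
  constructor
  · intro h
    ext a b
    change (sgn a * sgn b) • parity N (X a b) = X a b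
    rw [h, smul_smul, sgn_mul_sgn, one_smul]
  · intro h a b
    conv_rhs => rw [← h]
    change _ = (sgn a * sgn b) • ((sgn a * sgn b) • parity N (X a b))
    rw [smul_smul, sgn_mul_sgn, one_smul]

/-- A multiplicative map that fixes a unit fixes its inverse; here the map is `parityMat`. -/
theorem IsEvenSMat.inv {N : ℕ} {g : (SMat N)ˣ} (hg : IsEvenSMat (g : SMat N)) :
    IsEvenSMat ((g⁻¹ : (SMat N)ˣ) : SMat N) := by
  rw [isEvenSMat_iff] at hg ⊢
  have h : Units.map (parityMat N) g = g := Units.ext hg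
  have h2 := congrArg (fun u : (SMat N)ˣ => ((u⁻¹ : (SMat N)ˣ) : SMat N)) h
  exact h2

theorem evenPart_eq {N : ℕ} {X : SMat N} (hX : IsEvenSMat X) : evenPart N X = X := by
  ext a b
  change (1 / 2 : ℂ) • (X a b + (sgn a * sgn b) • parity N (X a b)) = X a b
  rw [hX, smul_smul, sgn_mul_sgn, one_smul]
  module

theorem smat_sub_mul {N : ℕ} (X Y Z : SMat N) : (X - Y) * Z = X * Z - Y * Z := sub_mul X Y Z

theorem smat_mul_sub {N : ℕ} (X Y Z : SMat N) : X * (Y - Z) = X * Y - X * Z := mul_sub X Y Z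

theorem str_apply {N : ℕ} (X : SMat N) : str N X = ∑ a, sgn a • X a a := by
  simp [str]

theorem str_eq_sub {N : ℕ} (X : SMat N) : str N X = trL N X - trR N X := by
  simp [str, trL, trR, sgn, sub_eq_add_neg]

theorem kf_apply {N : ℕ} (X Y : psl N) : kf N X Y = str N (X.1 * Y.1) := rfl

theorem IsEvenSMat.entry_comm {N : ℕ} {X Y : SMat N} (hX : IsEvenSMat X) (hY : IsEvenSMat Y)
    (a b c d : Idx) : X a b * Y c d =
      ((1 + sgn a * sgn b + sgn c * sgn d - sgn a * sgn b * (sgn c * sgn d)) / 2) •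
        (Y c d * X a b) :=
  mul_comm_of_parity (hX a b) (hY c d)

/-- The entries `X a b` and `Y b a` anticommute exactly when `a` and `b` lie in different blocks,
which is when the supertrace weights `sgn a` and `sgn b` are opposite. -/
theorem str_mul_comm {N : ℕ} {X Y : SMat N} (hX : IsEvenSMat X) (hY : IsEvenSMat Y) :
    str N (X * Y) = str N (Y * X) := by
  simp only [str_apply, Matrix.mul_apply, Finset.smul_sum]
  rw [Finset.sum_comm]
  refine Finset.sum_congr rfl fun b _ => Finset.sum_congr rfl fun a _ => ?_
  rw [hX.entry_comm hY, smul_smul]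
  congr 1
  rcases a with a | a <;> rcases b with b | b <;> norm_num [sgn]

theorem str_diagonal_mul {N : ℕ} (c d : SF N) (X : SMat N) :
    str N (Matrix.diagonal (Sum.elim (fun _ => c) (fun _ => d)) * X) =
      c * trL N X - d * trR N X := by
  rw [str_eq_sub]
  simp [trL, trR, Matrix.diagonal_mul, Finset.mul_sum]

/-- Even supermatrices of supertrace zero. -/
def IsSl {N : ℕ} (X : SMat N) : Prop :=
  IsEvenSMat X ∧ str N X = 0

theorem IsSl.even {N : ℕ} {X : SMat N} (hX : IsSl X) : IsEvenSMat X := hX.1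

theorem IsSl.str_eq {N : ℕ} {X : SMat N} (hX : IsSl X) : str N X = 0 := hX.2

theorem IsSl.neg {N : ℕ} {X : SMat N} (hX : IsSl X) : IsSl (-X) :=
  ⟨hX.even.neg, by rw [map_neg, hX.str_eq, neg_zero]⟩

theorem isSl_coe {N : ℕ} (X : psl N) : IsSl X.1 :=
  ⟨X.2.1, by rw [str_eq_sub, X.2.2.1, X.2.2.2, sub_zero]⟩

theorem isSl_commutator {N : ℕ} {X Y : SMat N} (hX : IsEvenSMat X) (hY : IsEvenSMat Y) :
    IsSl (X * Y - Y * X) :=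
  ⟨(hX.mul hY).sub (hY.mul hX), by rw [map_sub, str_mul_comm hX hY, sub_self]⟩

theorem IsSl.conj {N : ℕ} {g : (SMat N)ˣ} (hg : IsEvenSMat (g : SMat N)) {X : SMat N}
    (hX : IsSl X) : IsSl ((g : SMat N) * (X * ((g⁻¹ : (SMat N)ˣ) : SMat N))) := by
  refine ⟨hg.mul (hX.even.mul hg.inv), ?_⟩
  rw [str_mul_comm hg (hX.even.mul hg.inv), Matrix.mul_assoc, Units.inv_mul, Matrix.mul_one,
    hX.str_eq]

theorem toPsl_coe {N : ℕ} (X : psl N) : toPsl N X.1 = X := by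
  apply Subtype.ext
  change removeTrace N (evenPart N X.1) = X.1
  rw [evenPart_eq X.2.1]
  change X.1 - Matrix.diagonal
    (Sum.elim (fun _ => (1 / 4 : ℂ) • trL N X.1) (fun _ => (1 / 4 : ℂ) • trR N X.1)) = X.1
  rw [X.2.2.1, X.2.2.2]
  ext a b
  by_cases h : a = b
  · subst h
    rcases a with a | a <;> simp
  · simp

theorem coe_toPsl {N : ℕ} {X : SMat N} (hX : IsEvenSMat X) :
    (toPsl N X).1 = X - Matrix.diagonal
      (Sum.elim (fun _ => (1 / 4 : ℂ) • trL N X) (fun _ => (1 / 4 : ℂ) • trR N X)) := by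
  change removeTrace N (evenPart N X) = _
  rw [evenPart_eq hX]
  rfl

theorem parity_trL {N : ℕ} {X : SMat N} (hX : IsEvenSMat X) :
    parity N (trL N X) = trL N X := by
  simp only [trL, LinearMap.coe_sum, Finset.sum_apply, map_sum, Matrix.entryLinearMap_apply]
  refine Finset.sum_congr rfl fun i _ => ?_
  rw [hX]
  simp [sgn]

/-- The representative of the class of `X` differs from `X` by an even multiple of the identity. -/
theorem IsSl.exists_eq {N : ℕ} {X : SMat N} (hX : IsSl X) : ∃ c : SF N, parity N c = c ∧
    X = (toPsl N X).1 + Matrix.diagonal fun _ => c := by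
  refine ⟨(1 / 4 : ℂ) • trL N X, by rw [map_smul, parity_trL hX.even], ?_⟩
  have h : trR N X = trL N X := by
    have := hX.str_eq
    rw [str_eq_sub, sub_eq_zero] at this
    exact this.symm
  rw [coe_toPsl hX.even, h]
  have e : (Sum.elim (fun _ => (1 / 4 : ℂ) • trL N X) (fun _ => (1 / 4 : ℂ) • trL N X) :
      Idx → SF N) = fun _ => (1 / 4 : ℂ) • trL N X := by
    funext a
    rcases a with a | a <;> rfl
  rw [e, sub_add_cancel]

theorem diagonal_const_comm {N : ℕ} {c : SF N} (hc : parity N c = c) (X : SMat N) :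
    (Matrix.diagonal fun _ => c) * X = X * (Matrix.diagonal fun _ => c) := by
  ext a b
  rw [Matrix.diagonal_mul, Matrix.mul_diagonal, commute_of_even hc]

theorem toPsl_diagonal_const {N : ℕ} {c : SF N} (hc : parity N c = c) :
    toPsl N (Matrix.diagonal fun _ => c) = 0 := by
  apply Subtype.ext
  rw [coe_toPsl (IsEvenSMat.diagonal fun _ => hc)]
  have h : (1 / 4 : ℂ) • (c + c + c + c) = c := by module
  have hL : (1 / 4 : ℂ) • trL N (Matrix.diagonal fun _ => c) = c := by
    refine Eq.trans ?_ h
    simp [trL, Fin.sum_univ_four]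
  have hR : (1 / 4 : ℂ) • trR N (Matrix.diagonal fun _ => c) = c := by
    refine Eq.trans ?_ h
    simp [trR, Fin.sum_univ_four]
  rw [hL, hR]
  ext a b
  by_cases h : a = b
  · subst h
    rcases a with a | a <;> simp
  · simp [Matrix.diagonal_apply_ne _ h]

/-- The trace part subtracted by `toPsl` is scalar on each block, and pairs to zero with `Y` because
both block traces of `Y` vanish. -/
theorem kf_toPsl {N : ℕ} {X : SMat N} (hX : IsEvenSMat X) (Y : psl N) :
    kf N (toPsl N X) Y = str N (X * Y.1) := by
  rw [kf_apply, coe_toPsl hX, smat_sub_mul, map_sub, str_diagonal_mul, Y.2.2.1, Y.2.2.2]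
  simp

theorem kf_symm {N : ℕ} (X Y : psl N) : kf N X Y = kf N Y X :=
  str_mul_comm X.2.1 Y.2.1

theorem kf_toPsl_right {N : ℕ} {X : SMat N} (hX : IsEvenSMat X) (Y : psl N) :
    kf N Y (toPsl N X) = str N (Y.1 * X) := by
  rw [kf_symm, kf_toPsl hX, str_mul_comm hX Y.2.1]

/-! ## The Lie bracket -/

theorem add_central_commutator {A : Type*} [Ring A] {x y c d : A} (hc : ∀ z, c * z = z * c)
    (hd : ∀ z, d * z = z * d) : (x + c) * (y + d) - (y + d) * (x + c) = x * y - y * x := by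
  rw [add_mul, mul_add, mul_add, add_mul, mul_add, mul_add, hc, hc, hd, hd]
  abel

/-- At vanishing supertrace a matrix differs from its representative by an even multiple of the
identity, which is central and drops out of commutators. -/
theorem br_toPsl {N : ℕ} {X Y : SMat N} (hX : IsSl X) (hY : IsSl Y) :
    br (toPsl N X) (toPsl N Y) = toPsl N (X * Y - Y * X) := by
  obtain ⟨c, hc, hXc⟩ := hX.exists_eq
  obtain ⟨d, hd, hYd⟩ := hY.exists_eq
  rw [br]
  congr 1
  generalize (toPsl N X).1 = X' at hXc ⊢
  generalize (toPsl N Y).1 = Y' at hYd ⊢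
  rw [hXc, hYd]
  exact (add_central_commutator (A := SMat N) (diagonal_const_comm hc)
    (diagonal_const_comm hd)).symm

theorem br_add_left {N : ℕ} (X Y Z : psl N) : br (X + Y) Z = br X Z + br Y Z := by
  simp only [br, ← map_add]
  congr 1
  simp only [Submodule.coe_add, add_mul, mul_add]
  abel

theorem br_swap {N : ℕ} (X Y : psl N) : br X Y = -br Y X := by
  simp only [br, ← map_neg]
  congr 1
  abel

theorem br_add_right {N : ℕ} (X Y Z : psl N) : br X (Y + Z) = br X Y + br X Z := by
  rw [br_swap, br_add_left, br_swap Y, br_swap Z]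
  abel

theorem br_smul_left {N : ℕ} (c : ℂ) (X Y : psl N) : br (c • X) Y = c • br X Y := by
  simp only [br, ← map_smul]
  congr 1
  simp [smul_sub]

theorem br_smul_right {N : ℕ} (c : ℂ) (X Y : psl N) : br X (c • Y) = c • br X Y := by
  rw [br_swap, br_smul_left, br_swap Y, smul_neg, neg_neg]

theorem br_neg_left {N : ℕ} (X Y : psl N) : br (-X) Y = -br X Y := by
  have h := br_smul_left (-1) X Y
  rwa [show (-1 : ℂ) • X = -X by module, show (-1 : ℂ) • br X Y = -br X Y by module] at h

theorem br_neg_right {N : ℕ} (X Y : psl N) : br X (-Y) = -br X Y := by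
  rw [br_swap, br_neg_left, ← br_swap]

/-! ## The adjoint action -/

theorem Ad_apply {N : ℕ} (g : (SMat N)ˣ) (X : psl N) :
    Ad g X = toPsl N ((g : SMat N) * (X.1 * ((g⁻¹ : (SMat N)ˣ) : SMat N))) := rfl

theorem Ad_toPsl {N : ℕ} (g : (SMat N)ˣ) {X : SMat N}
    (hX : IsSl X) :
    Ad g (toPsl N X) = toPsl N ((g : SMat N) * (X * ((g⁻¹ : (SMat N)ˣ) : SMat N))) := by
  obtain ⟨c, hc, hXc⟩ := hX.exists_eq
  conv_rhs => rw [hXc]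
  rw [Ad_apply, add_mul, mul_add, diagonal_const_comm hc, ← mul_assoc (g : SMat N) _
    (Matrix.diagonal fun _ => c), Units.mul_inv, one_mul, map_add, toPsl_diagonal_const hc,
    add_zero]

theorem Ad_mul_Ad_inv {N : ℕ} {g : (SMat N)ˣ} (hg : IsEvenSMat (g : SMat N)) :
    Ad g * Ad g⁻¹ = 1 := by
  ext1 X
  rw [Module.End.mul_apply, Ad_apply g⁻¹, Ad_toPsl _ ((isSl_coe X).conj hg.inv)]
  simp only [inv_inv, mul_assoc, Units.mul_inv, Units.mul_inv_cancel_left, mul_one, toPsl_coe,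
    Module.End.one_apply]

theorem Ad_inv_mul_Ad {N : ℕ} {g : (SMat N)ˣ} (hg : IsEvenSMat (g : SMat N)) :
    Ad g⁻¹ * Ad g = 1 := by
  simpa using Ad_mul_Ad_inv (g := g⁻¹) hg.inv

theorem kf_Ad_left {N : ℕ} {g : (SMat N)ˣ} (hg : IsEvenSMat (g : SMat N)) (X Y : psl N) :
    kf N (Ad g X) Y = kf N X (Ad g⁻¹ Y) := by
  have hX := X.2.1
  have hY := Y.2.1
  rw [Ad_apply, Ad_apply, kf_toPsl (hg.mul (hX.mul hg.inv)), inv_inv,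
    kf_toPsl_right (hg.inv.mul (hY.mul hg)), mul_assoc, str_mul_comm hg ((hX.mul hg.inv).mul hY)]
  simp only [mul_assoc]

theorem br_Ad {N : ℕ} {g : (SMat N)ˣ} (hg : IsEvenSMat (g : SMat N)) (X Y : psl N) :
    br (Ad g X) (Ad g Y) = Ad g (br X Y) := by
  rw [Ad_apply, Ad_apply, br_toPsl ((isSl_coe X).conj hg) ((isSl_coe Y).conj hg), br,
    Ad_toPsl _ (isSl_commutator X.2.1 Y.2.1)]
  congr 1
  simp only [mul_assoc, Units.inv_mul_cancel_left, smat_mul_sub, smat_sub_mul]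

/-! ## Deformation operators on a graded space with an invariant form -/

/-- A `ℤ/4`-graded space with an invariant form, an antisymmetric operator `r`, and the inverses
`mS`, `pS`, `m`, `p` of `1 - r d_PS`, `1 + r d̂_PS`, `1 - r d_GS`, `1 + r d̂_GS`. -/
structure DeformedForm {V W : Type*} [AddCommGroup V] [Module ℂ V] [AddCommGroup W] [Module ℂ W]
    (k : V →ₗ[ℂ] V →ₗ[ℂ] W) (P₀ P₁ P₂ P₃ r mS pS m p : V →ₗ[ℂ] V) : Prop where
  symm : ∀ x y, k x y = k y x
  adj₀ : ∀ x y, k (P₀ x) y = k x (P₀ y)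
  adj₁ : ∀ x y, k (P₁ x) y = k x (P₃ y)
  adj₂ : ∀ x y, k (P₂ x) y = k x (P₂ y)
  sum : ∀ x, P₀ x + P₁ x + P₂ x + P₃ x = x
  p₀₁ : ∀ x, P₀ (P₁ x) = 0
  p₀₂ : ∀ x, P₀ (P₂ x) = 0
  p₀₃ : ∀ x, P₀ (P₃ x) = 0
  p₁₀ : ∀ x, P₁ (P₀ x) = 0
  p₁₁ : ∀ x, P₁ (P₁ x) = P₁ x
  p₁₂ : ∀ x, P₁ (P₂ x) = 0
  p₁₃ : ∀ x, P₁ (P₃ x) = 0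
  p₂₁ : ∀ x, P₂ (P₁ x) = 0
  p₂₂ : ∀ x, P₂ (P₂ x) = P₂ x
  p₂₃ : ∀ x, P₂ (P₃ x) = 0
  p₃₀ : ∀ x, P₃ (P₀ x) = 0
  p₃₁ : ∀ x, P₃ (P₁ x) = 0
  p₃₂ : ∀ x, P₃ (P₂ x) = 0
  p₃₃ : ∀ x, P₃ (P₃ x) = P₃ x
  anti : ∀ x y, k (r x) y = -k x (r y)
  mS_left : ∀ x, mS x - mS (r (P₁ x + (2 : ℂ) • P₂ x + (3 : ℂ) • P₃ x)) = x
  mS_right : ∀ x, mS x - r (P₁ (mS x) + (2 : ℂ) • P₂ (mS x) + (3 : ℂ) • P₃ (mS x)) = x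
  pS_left : ∀ x, pS x + pS (r ((3 : ℂ) • P₁ x + (2 : ℂ) • P₂ x + P₃ x)) = x
  pS_right : ∀ x, pS x + r ((3 : ℂ) • P₁ (pS x) + (2 : ℂ) • P₂ (pS x) + P₃ (pS x)) = x
  m_left : ∀ x, m x - m (r (P₁ x + (2 : ℂ) • P₂ x - P₃ x)) = x
  m_right : ∀ x, m x - r (P₁ (m x) + (2 : ℂ) • P₂ (m x) - P₃ (m x)) = x
  p_left : ∀ x, p x + p (r (-P₁ x + (2 : ℂ) • P₂ x + P₃ x)) = x
  p_right : ∀ x, p x + r (-P₁ (p x) + (2 : ℂ) • P₂ (p x) + P₃ (p x)) = x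

namespace DeformedForm

variable {V W : Type*} [AddCommGroup V] [Module ℂ V] [AddCommGroup W] [Module ℂ W]
  {k : V →ₗ[ℂ] V →ₗ[ℂ] W} {P₀ P₁ P₂ P₃ r mS pS m p : V →ₗ[ℂ] V}

theorem adj₃ (D : DeformedForm k P₀ P₁ P₂ P₃ r mS pS m p) (x y : V) :
    k (P₃ x) y = k x (P₁ y) := by
  rw [D.symm, ← D.adj₁, D.symm]

theorem mS_r_P₃ (D : DeformedForm k P₀ P₁ P₂ P₃ r mS pS m p) (x : V) :
    mS (r (P₃ x)) = (1 / 3 : ℂ) • (mS (P₃ x) - P₃ x) := by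
  have h := D.mS_left (P₃ x)
  simp only [D.p₁₃, D.p₂₃, D.p₃₃, smul_zero, zero_add, map_smul] at h
  linear_combination (norm := module) (-1 / 3 : ℂ) • h

theorem m_r_P₃ (D : DeformedForm k P₀ P₁ P₂ P₃ r mS pS m p) (x : V) :
    m (r (P₃ x)) = P₃ x - m (P₃ x) := by
  have h := D.m_left (P₃ x)
  simp only [D.p₁₃, D.p₂₃, D.p₃₃, smul_zero, zero_add, zero_sub, map_neg] at h
  linear_combination (norm := module) h

theorem pS_r_P₁ (D : DeformedForm k P₀ P₁ P₂ P₃ r mS pS m p) (x : V) :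
    pS (r (P₁ x)) = (1 / 3 : ℂ) • (P₁ x - pS (P₁ x)) := by
  have h := D.pS_left (P₁ x)
  simp only [D.p₁₁, D.p₂₁, D.p₃₁, smul_zero, add_zero, map_smul] at h
  linear_combination (norm := module) (1 / 3 : ℂ) • h

theorem p_r_P₁ (D : DeformedForm k P₀ P₁ P₂ P₃ r mS pS m p) (x : V) :
    p (r (P₁ x)) = p (P₁ x) - P₁ x := by
  have h := D.p_left (P₁ x)
  simp only [D.p₁₁, D.p₂₁, D.p₃₁, smul_zero, add_zero, map_neg] at h
  linear_combination (norm := module) (-1 : ℂ) • h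

/-- Resolvent identity for `O_GS- - O_PS- = 4 r P₃`. The primed version has the two inverses in the
other order; for the plus operators the difference is `-4 r P₁`. -/
theorem mS_sub_m (D : DeformedForm k P₀ P₁ P₂ P₃ r mS pS m p) (x : V) :
    mS x - m x = (4 : ℂ) • mS (r (P₃ (m x))) := by
  have h := D.mS_left (m x)
  have h' := congrArg mS (D.m_right x)
  simp only [map_add, map_sub, map_smul] at h h'
  linear_combination (norm := module) h - h'

theorem mS_sub_m' (D : DeformedForm k P₀ P₁ P₂ P₃ r mS pS m p) (x : V) :
    mS x - m x = (4 : ℂ) • m (r (P₃ (mS x))) := by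
  have h := D.m_left (mS x)
  have h' := congrArg m (D.mS_right x)
  simp only [map_add, map_sub, map_smul] at h h'
  linear_combination (norm := module) h' - h

theorem pS_sub_p (D : DeformedForm k P₀ P₁ P₂ P₃ r mS pS m p) (x : V) :
    pS x - p x = -(4 : ℂ) • pS (r (P₁ (p x))) := by
  have h := D.pS_left (p x)
  have h' := congrArg pS (D.p_right x)
  simp only [map_add, map_neg, map_smul] at h h'
  linear_combination (norm := module) h - h'

theorem pS_sub_p' (D : DeformedForm k P₀ P₁ P₂ P₃ r mS pS m p) (x : V) :
    pS x - p x = -(4 : ℂ) • p (r (P₁ (pS x))) := by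
  have h := D.p_left (pS x)
  have h' := congrArg p (D.pS_right x)
  simp only [map_add, map_neg, map_smul] at h h'
  linear_combination (norm := module) h' - h

/-! ### Transposes -/

/-- The transpose of `O_PS+ = 1 + r d̂_PS` is `1 - d_PS r`, and the inverse of the latter is `1 +
d_PS (1 - r d_PS)⁻¹ r`. -/
theorem pS_transpose (D : DeformedForm k P₀ P₁ P₂ P₃ r mS pS m p) (x y : V) :
    k (pS x) y = k x (y + (P₁ (mS (r y)) + (2 : ℂ) • P₂ (mS (r y)) + (3 : ℂ) • P₃ (mS (r y)))) := by
  have hx := D.pS_right x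
  have hz := D.mS_right (r y)
  generalize pS x = a at hx ⊢
  generalize mS (r y) = z at hz ⊢
  have e : r (y + (P₁ z + (2 : ℂ) • P₂ z + (3 : ℂ) • P₃ z)) = z := by
    rw [map_add]
    linear_combination (norm := module) -hz
  rw [← hx, LinearMap.map_add₂, D.anti, e]
  simp only [map_add, map_smul, LinearMap.add_apply, LinearMap.smul_apply, D.adj₁, D.adj₂, D.adj₃]
  module

theorem p_transpose (D : DeformedForm k P₀ P₁ P₂ P₃ r mS pS m p) (x y : V) :
    k (p x) y = k x (y + (P₁ (m (r y)) + (2 : ℂ) • P₂ (m (r y)) - P₃ (m (r y)))) := by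
  have hx := D.p_right x
  have hz := D.m_right (r y)
  generalize p x = a at hx ⊢
  generalize m (r y) = z at hz ⊢
  have e : r (y + (P₁ z + (2 : ℂ) • P₂ z - P₃ z)) = z := by
    rw [map_add]
    linear_combination (norm := module) -hz
  rw [← hx, LinearMap.map_add₂, D.anti, e]
  simp only [map_add, map_sub, map_neg, map_smul, LinearMap.add_apply, LinearMap.neg_apply,
    LinearMap.smul_apply, D.adj₁, D.adj₂, D.adj₃]
  module

theorem pS_r_transpose (D : DeformedForm k P₀ P₁ P₂ P₃ r mS pS m p) (x y : V) :
    k (pS (r x)) y = -k x (mS (r y)) := by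
  rw [D.pS_transpose, D.anti, map_add]
  congr 2
  linear_combination (norm := module) -D.mS_right (r y)

theorem p_r_transpose (D : DeformedForm k P₀ P₁ P₂ P₃ r mS pS m p) (x y : V) :
    k (p (r x)) y = -k x (m (r y)) := by
  rw [D.p_transpose, D.anti, map_add]
  congr 2
  linear_combination (norm := module) -D.m_right (r y)

/-! ### The Ramond-Ramond operator `P₁ (3 - 4 p) P₁` -/

/-- Insert `p r P₁ = p P₁ - P₁` into `pS = p - 4 p r P₁ pS` and project to grade one: the `3` arises
as `4 - 1`. This identity makes the BRST current solve the equation of motion of `d`. -/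
theorem P₁_p_P₁_pS (D : DeformedForm k P₀ P₁ P₂ P₃ r mS pS m p) (x : V) :
    P₁ ((3 : ℂ) • P₁ (pS x) - (4 : ℂ) • p (P₁ (pS x))) = -P₁ (p x) := by
  have h := congrArg P₁ (D.pS_sub_p' x)
  have h' := congrArg P₁ (D.p_r_P₁ (pS x))
  simp only [map_sub, map_smul, D.p₁₁] at h h' ⊢
  linear_combination (norm := module) -h + (4 : ℂ) • h'

theorem P₃_m_P₃_mS (D : DeformedForm k P₀ P₁ P₂ P₃ r mS pS m p) (x : V) :
    P₃ ((3 : ℂ) • P₃ (mS x) - (4 : ℂ) • m (P₃ (mS x))) = -P₃ (m x) := by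
  have h := congrArg P₃ (D.mS_sub_m' x)
  have h' := congrArg P₃ (D.m_r_P₃ (mS x))
  simp only [map_sub, map_smul, D.p₃₃] at h h' ⊢
  linear_combination (norm := module) -h - (4 : ℂ) • h'

/-- The transposed bispinor is the same expression in `m` on grade three, so a single bispinor
serves both auxiliary equations. -/
theorem P₁_p_P₁_transpose (D : DeformedForm k P₀ P₁ P₂ P₃ r mS pS m p) (x y : V) :
    k (P₁ (p (P₁ x))) y = k x (P₃ (m (P₃ y))) := by
  have h := congrArg P₃ (D.m_r_P₃ y)
  rw [D.adj₁, D.p_transpose, D.adj₁]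
  congr 1
  simp only [map_add, map_sub, map_smul, D.p₃₁, D.p₃₂, D.p₃₃] at h ⊢
  linear_combination (norm := module) -h

theorem k_P₃_P₁ (D : DeformedForm k P₀ P₁ P₂ P₃ r mS pS m p) (x y : V) :
    k (P₃ x) (P₁ y) = k y (P₃ x) := by
  rw [D.symm, D.adj₁, D.p₃₃]

/-! ### The operators `ϑ_±` -/

theorem thetaM_apply (D : DeformedForm k P₀ P₁ P₂ P₃ r mS pS m p) (x : V) :
    mS (x - r (P₁ x + (2 : ℂ) • P₂ x - P₃ x)) =
      x - (4 / 3 : ℂ) • P₃ x + (4 / 3 : ℂ) • mS (P₃ x) := by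
  have h := D.mS_left x
  have h' := D.mS_r_P₃ x
  simp only [map_add, map_sub, map_smul] at h h' ⊢
  linear_combination (norm := module) h + (4 : ℂ) • h'

theorem thetaM_inv_apply (D : DeformedForm k P₀ P₁ P₂ P₃ r mS pS m p) (x : V) :
    m (x - r (P₁ x + (2 : ℂ) • P₂ x + (3 : ℂ) • P₃ x)) =
      x - (4 : ℂ) • P₃ x + (4 : ℂ) • m (P₃ x) := by
  have h := D.m_left x
  have h' := D.m_r_P₃ x
  simp only [map_add, map_sub, map_smul] at h h' ⊢
  linear_combination (norm := module) h - (4 : ℂ) • h'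

theorem thetaP_apply (D : DeformedForm k P₀ P₁ P₂ P₃ r mS pS m p) (x : V) :
    pS (x + r (-P₁ x + (2 : ℂ) • P₂ x + P₃ x)) =
      x - (4 / 3 : ℂ) • P₁ x + (4 / 3 : ℂ) • pS (P₁ x) := by
  have h := D.pS_left x
  have h' := D.pS_r_P₁ x
  simp only [map_add, map_neg, map_smul] at h h' ⊢
  linear_combination (norm := module) h - (4 : ℂ) • h'

theorem thetaP_inv_apply (D : DeformedForm k P₀ P₁ P₂ P₃ r mS pS m p) (x : V) :
    p (x + r ((3 : ℂ) • P₁ x + (2 : ℂ) • P₂ x + P₃ x)) =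
      x - (4 : ℂ) • P₁ x + (4 : ℂ) • p (P₁ x) := by
  have h := D.p_left x
  have h' := D.p_r_P₁ x
  simp only [map_add, map_neg, map_smul] at h h' ⊢
  linear_combination (norm := module) h + (4 : ℂ) • h'

theorem P₁_pS_P₁_p (D : DeformedForm k P₀ P₁ P₂ P₃ r mS pS m p) (x : V) :
    pS (P₁ (p x)) = P₁ (p x) + (3 / 4 : ℂ) • (pS x - p x) := by
  have h := D.pS_r_P₁ (p x)
  have h' := D.pS_sub_p x
  linear_combination (norm := module) (3 : ℂ) • h - (3 / 4 : ℂ) • h'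

/-- The left-hand side is `P₁ ϑ_+ P₁ p`, with `ϑ_+` written out as in `thetaP_apply`. It undoes
`P₁_p_P₁_pS` up to sign, which is why `-P₁ ϑ_+ P₁` inverts the bispinor on grade one. -/
theorem P₁_thetaP_P₁_p (D : DeformedForm k P₀ P₁ P₂ P₃ r mS pS m p) (x : V) :
    P₁ (P₁ (p x) - (4 / 3 : ℂ) • P₁ (P₁ (p x)) + (4 / 3 : ℂ) • pS (P₁ (P₁ (p x)))) =
      P₁ (pS x) := by
  rw [D.p₁₁, D.P₁_pS_P₁_p]
  simp only [map_add, map_sub, map_smul, D.p₁₁]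
  module

theorem P₁_p_P₁_thetaP (D : DeformedForm k P₀ P₁ P₂ P₃ r mS pS m p) (x : V) :
    P₁ ((3 : ℂ) • P₁ (P₁ x - (4 / 3 : ℂ) • P₁ (P₁ x) + (4 / 3 : ℂ) • pS (P₁ (P₁ x)))
      - (4 : ℂ) • p (P₁ (P₁ x - (4 / 3 : ℂ) • P₁ (P₁ x) + (4 / 3 : ℂ) • pS (P₁ (P₁ x))))) =
      -P₁ x := by
  have h := D.P₁_p_P₁_pS (P₁ x)
  simp only [map_add, map_sub, map_smul, D.p₁₁] at h ⊢
  linear_combination (norm := module) (4 / 3 : ℂ) • h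

theorem P₁_thetaP_P₁_p_P₁ (D : DeformedForm k P₀ P₁ P₂ P₃ r mS pS m p) (x : V) :
    P₁ (P₁ ((3 : ℂ) • P₁ x - (4 : ℂ) • p (P₁ x))
      - (4 / 3 : ℂ) • P₁ (P₁ ((3 : ℂ) • P₁ x - (4 : ℂ) • p (P₁ x)))
      + (4 / 3 : ℂ) • pS (P₁ (P₁ ((3 : ℂ) • P₁ x - (4 : ℂ) • p (P₁ x))))) = -P₁ x := by
  have h := congrArg P₁ (D.P₁_pS_P₁_p (P₁ x))
  simp only [map_add, map_sub, map_smul, D.p₁₁] at h ⊢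
  linear_combination (norm := module) -(16 / 3 : ℂ) • h

/-! ### The sectors of the action -/

/-- The factor `4 / 3` is the `4` of the resolvent identity times the `1 / 3` of `mS_r_P₃`; the bare
`P₃` term is killed by `P₀`. -/
theorem P₀_mS (D : DeformedForm k P₀ P₁ P₂ P₃ r mS pS m p) (x : V) :
    P₀ (mS x) = P₀ (m x) + (4 / 3 : ℂ) • P₀ (mS (P₃ (m x))) := by
  have h := congrArg P₀ (D.mS_sub_m x)
  have h' := congrArg P₀ (D.mS_r_P₃ (m x))
  simp only [map_sub, map_smul, D.p₀₃] at h h'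
  linear_combination (norm := module) h + (4 : ℂ) • h'

theorem P₀_pS (D : DeformedForm k P₀ P₁ P₂ P₃ r mS pS m p) (x : V) :
    P₀ (pS x) = P₀ (p x) + (4 / 3 : ℂ) • P₀ (pS (P₁ (p x))) := by
  have h := congrArg P₀ (D.pS_sub_p x)
  have h' := congrArg P₀ (D.pS_r_P₁ (p x))
  simp only [map_sub, map_smul, D.p₀₁] at h h'
  linear_combination (norm := module) h - (4 : ℂ) • h'

/-- Since `mS = m + 4 mS r P₃ m` and `d_PS = d_GS + 4 P₃`, the remainder is `4 (1 + d_PS mS r) P₃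
m`, and the bracket is the transpose of `pS`. -/
theorem kinetic_sector (D : DeformedForm k P₀ P₁ P₂ P₃ r mS pS m p) (x y : V) :
    (1 / 4 : ℂ) • k x (P₁ (mS y) + (2 : ℂ) • P₂ (mS y) + (3 : ℂ) • P₃ (mS y)) =
      (1 / 4 : ℂ) • k x (P₁ (m y) + (2 : ℂ) • P₂ (m y) - P₃ (m y))
        + k (P₃ (m y)) (P₁ (pS x)) := by
  have h := D.mS_sub_m y
  rw [D.k_P₃_P₁, D.pS_transpose]
  generalize mS (r (P₃ (m y))) = w at h ⊢
  rw [sub_eq_iff_eq_add'.1 h]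
  simp only [map_add, map_sub, map_smul]
  module

theorem curvature_sector (D : DeformedForm k P₀ P₁ P₂ P₃ r mS pS m p) (n n' : V) :
    -k n' (n - (4 : ℂ) • mS (r n)) = -k n' (n - (4 : ℂ) • m (r n))
      - (16 : ℂ) • k (P₃ (m (r n))) (P₁ (pS (r n'))) := by
  have h := congrArg (k n') (D.mS_sub_m (r n))
  rw [D.k_P₃_P₁, D.pS_r_transpose]
  simp only [map_sub, map_smul] at h ⊢
  linear_combination (norm := module) (4 : ℂ) • h

theorem curvature_sector' (D : DeformedForm k P₀ P₁ P₂ P₃ r mS pS m p) (n n' : V)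
    (hn : P₀ n = n) (hn' : P₀ n' = n') :
    -k n' (n - (4 : ℂ) • mS (r n)) = k n' (-P₀ (P₀ n - (4 : ℂ) • m (r (P₀ n))))
      - (16 : ℂ) • k (P₃ (m (r n))) (P₁ (pS (r n'))) := by
  rw [D.curvature_sector, hn, map_neg, ← D.adj₀, hn']

/-- The pure spinor inverse may be moved from one factor to the other, because `mS r P₃ m = m r P₃
mS`: both are a quarter of `mS - m`. -/
theorem kinetic_product (D : DeformedForm k P₀ P₁ P₂ P₃ r mS pS m p) (x y : V) :
    k (p x) (P₃ (mS y)) = k (pS x) (P₃ (m y)) := by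
  have h := D.mS_sub_m y
  have h' := D.mS_sub_m' y
  have e : mS (r (P₃ (m y))) = m (r (P₃ (mS y))) :=
    smul_right_injective V (show (4 : ℂ) ≠ 0 by norm_num) (h.symm.trans h')
  rw [D.p_transpose, D.pS_transpose, e]
  congr 1
  generalize m (r (P₃ (mS y))) = w at h' ⊢
  rw [sub_eq_iff_eq_add'.1 h']
  simp only [map_add, map_smul]
  module

/-- The value of the auxiliary fields' quadratic term on their equations of motion. -/
theorem aux_product (D : DeformedForm k P₀ P₁ P₂ P₃ r mS pS m p) (x y n n' : V)
    (hn : P₀ n = n) (hn' : P₀ n' = n') :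
    k (P₃ (mS (y + (4 : ℂ) • r n))) (P₁ (p (x - (4 : ℂ) • r n'))) =
      k (P₃ (m y)) (P₁ (pS x)) + (4 / 3 : ℂ) • k (P₀ (mS (P₃ (m y)))) n'
        + (4 / 3 : ℂ) • k (P₀ (pS (P₁ (p x)))) n
        - (16 : ℂ) • k (P₃ (m (r n))) (P₁ (pS (r n'))) := by
  -- Expanding both arguments gives four terms. Current-current and ghost-ghost are handled by
  -- `kinetic_product`, the latter with coefficient `-4 · 4`; the two mixed terms are `e₃` and `e₄`.
  have e₁ := D.kinetic_product x y
  have e₂ := D.kinetic_product (r n') (r n)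
  have e₃ : (4 / 3 : ℂ) • k (P₀ (mS (P₃ (m y)))) n' = -((4 : ℂ) • k (p (r n')) (P₃ (mS y))) := by
    have h := congrArg (k n') (D.mS_sub_m' y)
    have h' := congrArg (k n') (D.P₀_mS y)
    simp only [map_add, map_sub, map_smul, ← D.adj₀, hn'] at h h'
    rw [D.p_r_transpose, D.adj₀, hn', D.symm]
    linear_combination (norm := module) h - h'
  have e₄ : (4 / 3 : ℂ) • k (P₀ (pS (P₁ (p x)))) n = (4 : ℂ) • k (p x) (P₃ (mS (r n))) := by
    have h := congrArg (k n) (D.pS_sub_p x)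
    have h' := congrArg (k n) (D.P₀_pS x)
    have h'' := D.pS_r_transpose (P₁ (p x)) n
    simp only [map_add, map_sub, map_smul, ← D.adj₀, hn] at h h'
    rw [← D.adj₁, D.adj₀, hn, D.symm]
    rw [D.symm] at h''
    linear_combination (norm := module) h - h' - (4 : ℂ) • h''
  rw [D.k_P₃_P₁, D.k_P₃_P₁, D.k_P₃_P₁, e₃, e₄, ← e₁, ← e₂]
  simp only [map_add, map_sub, map_smul, LinearMap.sub_apply, LinearMap.smul_apply]
  module

/-- By `P₁_p_P₁_pS` the bispinor term is `-P₁ p (x - 4 r n')`. Its current part cancels the frame,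
and its ghost part, transposed, cancels the curvature coupling. -/
theorem aux_left (D : DeformedForm k P₀ P₁ P₂ P₃ r mS pS m p) (x n' e : V)
    (hn' : P₀ n' = n') :
    k e (P₁ (p x)) + k e (P₁ ((3 : ℂ) • P₁ (pS (x - (4 : ℂ) • r n'))
      - (4 : ℂ) • p (P₁ (pS (x - (4 : ℂ) • r n'))))) - (4 : ℂ) • k n' (P₀ (m (P₃ e))) = 0 := by
  have h₀ : k n' (P₃ e) = 0 := by rw [← hn', D.adj₀, D.p₀₃, map_zero]
  have h₁ : k e (P₁ (p (r n'))) = k n' (m (P₃ e)) := by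
    rw [← D.adj₃, D.symm, D.p_r_transpose, D.m_r_P₃, map_sub, h₀]
    module
  rw [D.P₁_p_P₁_pS, ← D.adj₀, hn', ← h₁]
  simp only [map_sub, map_neg, map_smul]
  module

theorem aux_right (D : DeformedForm k P₀ P₁ P₂ P₃ r mS pS m p) (y n e : V)
    (hn : P₀ n = n) :
    k e (P₃ (m y)) + k (P₃ (mS (y + (4 : ℂ) • r n))) (P₁ ((3 : ℂ) • P₁ e - (4 : ℂ) • p (P₁ e)))
      - (4 : ℂ) • k n (P₀ (p (P₁ e))) = 0 := by
  have h₀ : k (P₁ e) n = 0 := by rw [D.symm, ← hn, D.adj₀, D.p₀₁, map_zero]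
  have h₁ : k e (P₃ (m (r n))) = -k n (p (P₁ e)) := by
    have h := D.p_r_transpose (P₁ e) n
    rw [D.p_r_P₁, LinearMap.map_sub₂, h₀] at h
    rw [← D.adj₁, D.symm n]
    linear_combination (norm := module) h
  have h₂ := congrArg (k e) (D.P₃_m_P₃_mS (y + (4 : ℂ) • r n))
  have h₃ := D.P₁_p_P₁_transpose e (mS (y + (4 : ℂ) • r n))
  -- Seen from its left argument the bispinor is its transpose `P₃ (3 - 4 m) P₃`, which again turns
  -- the pure spinor current into minus the Green-Schwarz one.
  have h₄ : k (P₃ (mS (y + (4 : ℂ) • r n))) (P₁ ((3 : ℂ) • P₁ e - (4 : ℂ) • p (P₁ e))) =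
      -k e (P₃ (m (y + (4 : ℂ) • r n))) := by
    rw [← map_neg, ← h₂, D.adj₃, D.p₁₁, D.symm]
    simp only [map_sub, map_smul, D.p₁₁, D.p₃₃, LinearMap.sub_apply, LinearMap.smul_apply,
      D.adj₁ e, h₃]
  rw [h₄, ← D.adj₀, hn]
  simp only [map_add, map_smul]
  rw [h₁]
  module

theorem current_sector (D : DeformedForm k P₀ P₁ P₂ P₃ r mS pS m p) (x y n n' : V)
    (hn : P₀ n = n) (hn' : P₀ n' = n') :
    k n' (mS y) + k n (pS x) = k (P₀ (p x)) n + k (P₀ (m y)) n'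
      + (4 / 3 : ℂ) • k (P₀ (mS (P₃ (m y)))) n' + (4 / 3 : ℂ) • k (P₀ (pS (P₁ (p x)))) n := by
  have e₁ : k n' (mS y) = k (P₀ (mS y)) n' := by rw [D.symm, D.adj₀, hn']
  have e₂ : k n (pS x) = k (P₀ (pS x)) n := by rw [D.symm, D.adj₀, hn]
  rw [e₁, e₂, D.P₀_mS, D.P₀_pS]
  simp only [map_add, map_smul, LinearMap.add_apply, LinearMap.smul_apply]
  abel

theorem aux_product' (D : DeformedForm k P₀ P₁ P₂ P₃ r mS pS m p) (x y n n' : V)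
    (hn : P₀ n = n) (hn' : P₀ n' = n') :
    k (P₃ (mS (y + (4 : ℂ) • r n))) (P₁ ((3 : ℂ) • P₁ (P₁ (pS (x - (4 : ℂ) • r n')))
      - (4 : ℂ) • p (P₁ (P₁ (pS (x - (4 : ℂ) • r n')))))) =
      -(k (P₃ (m y)) (P₁ (pS x)) + (4 / 3 : ℂ) • k (P₀ (mS (P₃ (m y)))) n'
        + (4 / 3 : ℂ) • k (P₀ (pS (P₁ (p x)))) n
        - (16 : ℂ) • k (P₃ (m (r n))) (P₁ (pS (r n')))) := by
  rw [D.p₁₁, D.P₁_p_P₁_pS, map_neg, D.aux_product x y n n' hn hn']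

theorem aux_left' (D : DeformedForm k P₀ P₁ P₂ P₃ r mS pS m p) (x n' e : V)
    (hn' : P₀ n' = n') :
    k e (P₁ (p x)) + k e (P₁ ((3 : ℂ) • P₁ (P₁ (pS (x - (4 : ℂ) • r n')))
      - (4 : ℂ) • p (P₁ (P₁ (pS (x - (4 : ℂ) • r n')))))) + k n' (-((4 : ℂ) • P₀ (m (P₃ e)))) =
      0 := by
  rw [D.p₁₁, map_neg, map_smul, ← sub_eq_add_neg]
  exact D.aux_left x n' e hn'

theorem aux_right' (D : DeformedForm k P₀ P₁ P₂ P₃ r mS pS m p) (y n e : V)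
    (hn : P₀ n = n) :
    k e (P₃ (m y)) + k (P₃ (mS (y + (4 : ℂ) • r n))) (P₁ ((3 : ℂ) • P₁ e - (4 : ℂ) • p (P₁ e)))
      + k n (-((4 : ℂ) • P₀ (p (P₁ e)))) = 0 := by
  rw [map_neg, map_smul, ← sub_eq_add_neg]
  exact D.aux_right y n e hn

/-! ### Metric and `B`-field -/

/-- From `(1 - d_GS r) d_GS = d_GS (1 - r d_GS)`, where `1 - d_GS r` is the transpose of `O_GS+`. -/
theorem gs_p (D : DeformedForm k P₀ P₁ P₂ P₃ r mS pS m p) (u v : V) :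
    k v (P₁ (m u) + (2 : ℂ) • P₂ (m u) - P₃ (m u)) =
      k (p v) (P₁ u + (2 : ℂ) • P₂ u - P₃ u) := by
  have h := D.m_left u
  rw [D.p_transpose]
  congr 1
  generalize m (r (P₁ u + (2 : ℂ) • P₂ u - P₃ u)) = w at h ⊢
  rw [sub_eq_iff_eq_add.1 h]
  simp only [map_add]
  module

/-- With `u = O_GS+ a` and `v = O_GS+ b`, the terms containing `r` are antisymmetric and drop out of
the symmetric part. So do grades one and three, where `d_GS` has opposite eigenvalues; only grade
two is left. -/
theorem metric_p (D : DeformedForm k P₀ P₁ P₂ P₃ r mS pS m p) (u v : V) :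
    (1 / 4 : ℂ) • k v (P₁ (m u) + (2 : ℂ) • P₂ (m u) - P₃ (m u))
      + (1 / 4 : ℂ) • k u (P₁ (m v) + (2 : ℂ) • P₂ (m v) - P₃ (m v)) =
      k (P₂ (p u)) (P₂ (p v)) := by
  rw [D.gs_p, D.gs_p]
  have hu := D.p_right u
  have hv := D.p_right v
  generalize p u = a at hu ⊢
  generalize p v = b at hv ⊢
  have h := D.anti (-P₁ a + (2 : ℂ) • P₂ a + P₃ a) (-P₁ b + (2 : ℂ) • P₂ b + P₃ b)
  rw [D.symm] at h
  have t : ∀ x y, k x (P₁ y + (2 : ℂ) • P₂ y - P₃ y) = k (-P₁ x + (2 : ℂ) • P₂ x + P₃ x) y := by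
    intro x y
    simp only [map_add, map_sub, map_neg, map_smul, LinearMap.add_apply, LinearMap.neg_apply,
      LinearMap.smul_apply, D.adj₁, D.adj₂, D.adj₃]
    module
  have ha : ∀ x y z, k x (y + z) = k x y + k x z := fun x => map_add (k x)
  have s₁ := D.symm a (P₁ b)
  have s₂ := D.symm b (P₁ a)
  have s₃ := D.symm a (P₂ b)
  rw [t, t, ← hu, ← hv, ha, ha, h, ← t b a, ← t a b, D.adj₂, D.p₂₂]
  simp only [map_add, map_sub, map_smul]
  rw [D.adj₁] at s₁ s₂
  rw [D.adj₂] at s₃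
  linear_combination (norm := module) (1 / 4 : ℂ) • s₁ + (1 / 4 : ℂ) • s₂ - (1 / 2 : ℂ) • s₃

theorem gs_m (D : DeformedForm k P₀ P₁ P₂ P₃ r mS pS m p) (u v : V) :
    k v (P₁ (m u) + (2 : ℂ) • P₂ (m u) - P₃ (m u)) =
      k (m v) (P₁ (m u) + (2 : ℂ) • P₂ (m u) - P₃ (m u))
        + k (P₁ (m v) + (2 : ℂ) • P₂ (m v) - P₃ (m v))
          (r (P₁ (m u) + (2 : ℂ) • P₂ (m u) - P₃ (m u))) := by
  conv_lhs => rw [← D.m_right v]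
  rw [LinearMap.map_sub₂, D.anti]
  module

theorem metric_m (D : DeformedForm k P₀ P₁ P₂ P₃ r mS pS m p) (u v : V) :
    (1 / 4 : ℂ) • k v (P₁ (m u) + (2 : ℂ) • P₂ (m u) - P₃ (m u))
      + (1 / 4 : ℂ) • k u (P₁ (m v) + (2 : ℂ) • P₂ (m v) - P₃ (m v)) =
      k (P₂ (m u)) (P₂ (m v)) := by
  rw [D.gs_m u v, D.gs_m v u]
  generalize m u = a
  generalize m v = b
  have h := D.anti (P₁ a + (2 : ℂ) • P₂ a - P₃ a) (P₁ b + (2 : ℂ) • P₂ b - P₃ b)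
  rw [D.symm] at h
  have s₁ := D.symm a (P₁ b)
  have s₂ := D.symm b (P₁ a)
  have s₃ := D.symm a (P₂ b)
  rw [h, D.adj₂, D.p₂₂]
  rw [D.adj₁] at s₁ s₂
  rw [D.adj₂] at s₃
  have ha : ∀ x y : V, k x (P₁ y + (2 : ℂ) • P₂ y - P₃ y) =
      k x (P₁ y) + (2 : ℂ) • k x (P₂ y) - k x (P₃ y) := fun x y => by
    rw [map_sub, map_add, map_smul]
  rw [ha b a, ha a b]
  linear_combination (norm := module) (1 / 4 : ℂ) • s₁ + (1 / 4 : ℂ) • s₂ - (1 / 2 : ℂ) • s₃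

/-- Complementary to `metric_m`: the symmetric grade two term cancels, and the antisymmetric terms
with `P₁ - P₃` and with `r` survive doubled. Moving `d_GS` across the form turns it into `d̂_GS`. -/
theorem bfield_m (D : DeformedForm k P₀ P₁ P₂ P₃ r mS pS m p) (u v : V) :
    (1 / 4 : ℂ) • k v (P₁ (m u) + (2 : ℂ) • P₂ (m u) - P₃ (m u))
      - (1 / 4 : ℂ) • k u (P₁ (m v) + (2 : ℂ) • P₂ (m v) - P₃ (m v)) =
      (1 / 2 : ℂ) • k (m v) (P₁ (m u) - P₃ (m u)
        + (-P₁ (r (P₁ (m u) + (2 : ℂ) • P₂ (m u) - P₃ (m u)))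
          + (2 : ℂ) • P₂ (r (P₁ (m u) + (2 : ℂ) • P₂ (m u) - P₃ (m u)))
          + P₃ (r (P₁ (m u) + (2 : ℂ) • P₂ (m u) - P₃ (m u))))) := by
  rw [D.gs_m u v, D.gs_m v u]
  generalize m u = a
  generalize m v = b
  have h := D.anti (P₁ a + (2 : ℂ) • P₂ a - P₃ a) (P₁ b + (2 : ℂ) • P₂ b - P₃ b)
  rw [D.symm] at h
  have s₁ := D.symm a (P₁ b)
  have s₂ := D.symm b (P₁ a)
  have s₃ := D.symm a (P₂ b)
  have t : ∀ y, k (P₁ b + (2 : ℂ) • P₂ b - P₃ b) y =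
      -k b (P₁ y) + (2 : ℂ) • k b (P₂ y) + k b (P₃ y) := fun y => by
    rw [LinearMap.map_sub₂, LinearMap.map_add₂, LinearMap.map_smul₂, D.adj₁, D.adj₂, D.adj₃]
    module
  rw [← neg_eq_iff_eq_neg] at h
  rw [← h, t]
  generalize r (P₁ a + (2 : ℂ) • P₂ a - P₃ a) = w
  rw [D.adj₁] at s₁ s₂
  rw [D.adj₂] at s₃
  simp only [map_add, map_sub, map_neg, map_smul]
  linear_combination (norm := module) -(1 / 4 : ℂ) • s₁ - (1 / 4 : ℂ) • s₂ - (1 / 2 : ℂ) • s₃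

end DeformedForm

/-! ## The order-four automorphism -/

/-- The permutation underlying the symplectic matrix. -/
def idxSwap : Equiv.Perm Idx :=
  Equiv.sumCongr (Equiv.swap 0 1 * Equiv.swap 2 3) (Equiv.swap 0 1 * Equiv.swap 2 3)

/-- The signs of the symplectic matrix. -/
def idxSign : Idx → ℂ := Sum.elim ![-1, 1, -1, 1] ![-1, 1, -1, 1]

/-- The signs of the supertranspose. -/
def stSign : Idx → Idx → ℂ
  | Sum.inl _, Sum.inr _ => -1
  | _, _ => 1

theorem idxSwap_idxSwap (a : Idx) : idxSwap (idxSwap a) = a := by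
  revert a; decide

theorem idxSign_idxSwap (a : Idx) : idxSign (idxSwap a) = -idxSign a := by
  rcases a with a | a <;> fin_cases a <;> simp [idxSwap, idxSign, Equiv.swap_apply_def]

theorem idxSign_mul_self (a : Idx) : idxSign a * idxSign a = 1 := by
  rcases a with a | a <;> fin_cases a <;> simp [idxSign]

theorem sgn_idxSwap (a : Idx) : sgn (idxSwap a) = sgn a := by
  rcases a with a | a <;> rfl

theorem stSign_idxSwap_left (a b : Idx) : stSign (idxSwap a) b = stSign a b := by
  rcases a with a | a <;> rcases b with b | b <;> rfl

theorem stSign_idxSwap_right (a b : Idx) : stSign a (idxSwap b) = stSign a b := by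
  rcases a with a | a <;> rcases b with b | b <;> rfl

theorem stSign_mul_stSign (a b : Idx) : stSign a b * stSign b a = sgn a * sgn b := by
  rcases a with a | a <;> rcases b with b | b <;> simp [stSign, sgn]

theorem superT_apply {N : ℕ} (X : SMat N) (a b : Idx) :
    superT X a b = stSign a b • X b a := by
  rcases a with a | a <;> rcases b with b | b <;>
    simp [superT, stSign, Matrix.toBlocks₁₁, Matrix.toBlocks₁₂, Matrix.toBlocks₂₁,
      Matrix.toBlocks₂₂]

theorem sf_neg_one_mul {N : ℕ} (x : SF N) : -1 * x = -x := by
  rw [show (-1 : SF N) = (-1 : ℂ) • 1 by module, smul_mul_assoc, one_mul]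
  module

theorem sf_mul_neg_one {N : ℕ} (x : SF N) : x * -1 = -x := by
  rw [show (-1 : SF N) = (-1 : ℂ) • 1 by module, mul_smul_comm, mul_one]
  module

theorem symplKK_mul_apply {N : ℕ} (Y : SMat N) (a b : Idx) :
    (symplKK N * Y) a b = idxSign a • Y (idxSwap a) b := by
  rcases a with a | a <;> fin_cases a <;>
    simp [symplKK, symplK, Matrix.mul_apply, Fin.sum_univ_four, idxSign, idxSwap,
      Equiv.swap_apply_def, -Algebra.TensorProduct.algebraMap_apply, sf_neg_one_mul]

theorem mul_symplKK_apply {N : ℕ} (Y : SMat N) (a b : Idx) :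
    (Y * symplKK N) a b = -idxSign b • Y a (idxSwap b) := by
  rcases b with b | b <;> fin_cases b <;>
    simp [symplKK, symplK, Matrix.mul_apply, Fin.sum_univ_four, idxSign, idxSwap,
      Equiv.swap_apply_def, -Algebra.TensorProduct.algebraMap_apply, sf_mul_neg_one]

/-- The automorphism is a signed permutation of the entries of the transposed matrix, so its
properties reduce to identities between signs. -/
theorem zfour_apply {N : ℕ} (X : SMat N) (a b : Idx) :
    zfour N X a b = -(idxSign a * idxSign b * stSign a b) • X (idxSwap b) (idxSwap a) := by
  change (symplKK N * superT X * symplKK N) a b = _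
  rw [mul_symplKK_apply, symplKK_mul_apply, superT_apply, stSign_idxSwap_left,
    stSign_idxSwap_right, smul_smul, smul_smul]
  congr 1
  ring

theorem zfour_zfour_apply {N : ℕ} (X : SMat N) (a b : Idx) :
    zfour N (zfour N X) a b = (sgn a * sgn b) • X a b := by
  rw [zfour_apply, zfour_apply, idxSwap_idxSwap, idxSwap_idxSwap, smul_smul, idxSign_idxSwap,
    idxSign_idxSwap, stSign_idxSwap_left, stSign_idxSwap_right, ← stSign_mul_stSign]
  congr 1
  linear_combination (idxSign b * idxSign b * stSign a b * stSign b a) * idxSign_mul_self a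
    + (stSign a b * stSign b a) * idxSign_mul_self b

theorem isEvenSMat_zfour {N : ℕ} {X : SMat N} (hX : IsEvenSMat X) : IsEvenSMat (zfour N X) := by
  intro a b
  rw [zfour_apply, map_smul, hX, sgn_idxSwap, sgn_idxSwap, smul_comm, mul_comm (sgn b)]

theorem zfour_apply_self {N : ℕ} (X : SMat N) (a : Idx) :
    zfour N X a a = -X (idxSwap a) (idxSwap a) := by
  rw [zfour_apply, idxSign_mul_self]
  rcases a with a | a <;> simp [stSign]

theorem trL_zfour {N : ℕ} (X : SMat N) : trL N (zfour N X) = -trL N X := by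
  simp only [trL, LinearMap.coe_sum, Finset.sum_apply, Matrix.entryLinearMap_apply,
    zfour_apply_self, Finset.sum_neg_distrib]
  congr 1
  exact Equiv.sum_comp (Equiv.swap 0 1 * Equiv.swap 2 3 : Equiv.Perm (Fin 4))
    fun i => X (Sum.inl i) (Sum.inl i)

theorem trR_zfour {N : ℕ} (X : SMat N) : trR N (zfour N X) = -trR N X := by
  simp only [trR, LinearMap.coe_sum, Finset.sum_apply, Matrix.entryLinearMap_apply,
    zfour_apply_self, Finset.sum_neg_distrib]
  congr 1
  exact Equiv.sum_comp (Equiv.swap 0 1 * Equiv.swap 2 3 : Equiv.Perm (Fin 4))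
    fun i => X (Sum.inr i) (Sum.inr i)

theorem str_zfour {N : ℕ} (X : SMat N) : str N (zfour N X) = -str N X := by
  rw [str_eq_sub, str_eq_sub, trL_zfour, trR_zfour]
  abel

/-- On even supermatrices the supertranspose reverses products without a sign; the sign comes from
`K² = -1` between the two factors. Consequently commutators are preserved. -/
theorem zfour_mul {N : ℕ} {X Y : SMat N} (hX : IsEvenSMat X) (hY : IsEvenSMat Y) :
    zfour N (X * Y) = -(zfour N Y * zfour N X) := by
  ext a b
  rw [Matrix.neg_apply, Matrix.mul_apply, zfour_apply, Matrix.mul_apply, Finset.smul_sum,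
    ← Equiv.sum_comp idxSwap (fun c => zfour N Y a c * zfour N X c b), ← Finset.sum_neg_distrib]
  refine Finset.sum_congr rfl fun c _ => ?_
  rw [zfour_apply, zfour_apply, idxSwap_idxSwap, smul_mul_smul_comm, hX.entry_comm hY, smul_smul,
    ← neg_smul, idxSign_idxSwap, stSign_idxSwap_left, stSign_idxSwap_right, sgn_idxSwap,
    sgn_idxSwap]
  congr 1
  have h : stSign a b * ((1 + sgn b * sgn c + sgn c * sgn a - sgn b * sgn c * (sgn c * sgn a)) / 2)
      = stSign a c * stSign c b := by
    rcases a with a | a <;> rcases b with b | b <;> rcases c with c | c <;>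
      norm_num [sgn, stSign]
  linear_combination (-(idxSign a * idxSign b)) * h
    + (idxSign a * idxSign b * stSign a c * stSign c b) * idxSign_mul_self c

/-- Off-diagonal supermatrices with even entries. -/
def IsOffDiagonal {N : ℕ} (X : SMat N) : Prop :=
  (∀ a b, parity N (X a b) = X a b) ∧ ∀ a b, sgn a * sgn b = 1 → X a b = 0

theorem IsOffDiagonal.parity_eq {N : ℕ} {X : SMat N} (hX : IsOffDiagonal X) (a b : Idx) :
    parity N (X a b) = X a b := hX.1 a b

theorem IsOffDiagonal.apply_eq_zero {N : ℕ} {X : SMat N} (hX : IsOffDiagonal X) (a b : Idx)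
    (h : sgn a * sgn b = 1) : X a b = 0 := hX.2 a b h

theorem IsOffDiagonal.mul_even {N : ℕ} {X Y : SMat N} (hX : IsOffDiagonal X)
    (hY : IsOffDiagonal Y) : IsEvenSMat (X * Y) := by
  intro a b
  rw [Matrix.mul_apply, map_sum, Finset.smul_sum]
  refine Finset.sum_congr rfl fun c _ => ?_
  rw [map_mul, hX.parity_eq, hY.parity_eq]
  by_cases h₁ : sgn a * sgn c = 1
  · rw [hX.apply_eq_zero _ _ h₁, zero_mul, smul_zero]
  by_cases h₂ : sgn c * sgn b = 1
  · rw [hY.apply_eq_zero _ _ h₂, mul_zero, smul_zero]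
  rcases a with a | a <;> rcases b with b | b <;> rcases c with c | c <;> simp [sgn] at h₁ h₂ ⊢

/-- Off-diagonal entries that commute cost the supertranspose one more sign than in the even case,
so here anticommutators are preserved. -/
theorem IsOffDiagonal.zfour_mul {N : ℕ} {X Y : SMat N} (hX : IsOffDiagonal X)
    (hY : IsOffDiagonal Y) : zfour N (X * Y) = zfour N Y * zfour N X := by
  ext a b
  rw [Matrix.mul_apply, zfour_apply, Matrix.mul_apply, Finset.smul_sum,
    ← Equiv.sum_comp idxSwap (fun c => zfour N Y a c * zfour N X c b)]
  refine Finset.sum_congr rfl fun c _ => ?_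
  rw [zfour_apply, zfour_apply, idxSwap_idxSwap, smul_mul_smul_comm,
    commute_of_even (hX.parity_eq _ _), idxSign_idxSwap, stSign_idxSwap_left, stSign_idxSwap_right]
  by_cases h₁ : sgn b * sgn c = 1
  · rw [hX.apply_eq_zero (idxSwap b) c (by rwa [sgn_idxSwap]), mul_zero, smul_zero, smul_zero]
  by_cases h₂ : sgn c * sgn a = 1
  · rw [hY.apply_eq_zero c (idxSwap a) (by rwa [sgn_idxSwap]), zero_mul, smul_zero, smul_zero]
  congr 1
  have h : -stSign a b = stSign a c * stSign c b := by
    rcases a with a | a <;> rcases b with b | b <;> rcases c with c | c <;>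
      simp [sgn, stSign] at h₁ h₂ ⊢
  linear_combination (idxSign a * idxSign b) * h
    - (idxSign a * idxSign b * stSign a c * stSign c b) * idxSign_mul_self c

/-- The square of `zfour` is `1` on the diagonal blocks but `(-1)ᵏ = -1` on odd grade. -/
theorem IsGhost.isOffDiagonal {N k : ℕ} (hk : Odd k) {X : SMat N} (hX : IsGhost k X) :
    IsOffDiagonal X := by
  refine ⟨hX.1, fun a b hab => ?_⟩
  have h := zfour_zfour_apply X a b
  rw [hX.2, map_smul, hX.2, smul_smul, hab, one_smul, ← pow_add, ← two_mul, pow_mul,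
    Complex.I_sq, hk.neg_one_pow] at h
  have h' : (2 : ℂ) • X a b = 0 := by
    have h'' : (-1 : ℂ) • X a b = X a b := h
    linear_combination (norm := module) -h''
  exact (smul_eq_zero.1 h').resolve_left two_ne_zero

/-- The order-four automorphism of `psl(4|4)`. -/
def zpsl (N : ℕ) : Op N :=
  LinearMap.restrict (zfour N) (p := psl N) (q := psl N) fun X hX =>
    ⟨isEvenSMat_zfour hX.1, by rw [trL_zfour, hX.2.1, neg_zero],
      by rw [trR_zfour, hX.2.2, neg_zero]⟩

theorem coe_zpsl {N : ℕ} (X : psl N) : (zpsl N X).1 = zfour N X.1 := rfl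

theorem zpsl_toPsl {N : ℕ} {X : SMat N} (hX : IsEvenSMat X) :
    zpsl N (toPsl N X) = toPsl N (zfour N X) := by
  apply Subtype.ext
  rw [coe_zpsl, coe_toPsl hX, coe_toPsl (isEvenSMat_zfour hX), trL_zfour, trR_zfour, map_sub]
  congr 1
  ext a b
  rw [zfour_apply]
  by_cases h : a = b
  · subst h
    rw [idxSign_mul_self]
    rcases a with a | a <;> simp [idxSwap, stSign]
  · have h' : idxSwap b ≠ idxSwap a := fun e => h (idxSwap.injective e).symm
    rw [Matrix.diagonal_apply_ne _ h, Matrix.diagonal_apply_ne _ h', smul_zero]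

theorem zpsl_pow_four {N : ℕ} (X : psl N) : zpsl N (zpsl N (zpsl N (zpsl N X))) = X := by
  apply Subtype.ext
  ext a b
  simp only [coe_zpsl]
  rw [zfour_zfour_apply, zfour_zfour_apply, smul_smul, sgn_mul_sgn, one_smul]

theorem zpsl_br {N : ℕ} (X Y : psl N) : zpsl N (br X Y) = br (zpsl N X) (zpsl N Y) := by
  rw [br, zpsl_toPsl (isSl_commutator X.2.1 Y.2.1).even, br, coe_zpsl, coe_zpsl, map_sub,
    zfour_mul X.2.1 Y.2.1, zfour_mul Y.2.1 X.2.1]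
  congr 1
  abel

theorem kf_zpsl {N : ℕ} (X Y : psl N) : kf N (zpsl N X) (zpsl N Y) = kf N X Y := by
  rw [kf_apply, kf_apply, coe_zpsl, coe_zpsl]
  have h := zfour_mul Y.2.1 X.2.1
  have h' : zfour N X.1 * zfour N Y.1 = -zfour N (Y.1 * X.1) := by rw [h, neg_neg]
  rw [h', map_neg, str_zfour, neg_neg, str_mul_comm Y.2.1 X.2.1]

/-! ## The grading -/

/-- The exponent `3jk` stands for `-jk` modulo four, so this is a discrete Fourier average. As
`zfour` preserves `psl`, the outer `toPsl` acts trivially. -/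
theorem pr_apply {N : ℕ} (k : ℕ) (X : psl N) :
    pr N k X = (1 / 4 : ℂ) • (X + (Complex.I ^ k) ^ 3 • zpsl N X
      + (Complex.I ^ k) ^ 2 • zpsl N (zpsl N X)
      + Complex.I ^ k • zpsl N (zpsl N (zpsl N X))) := by
  have e₁ : Complex.I ^ (3 * 1 * k) = (Complex.I ^ k) ^ 3 := by rw [mul_one, mul_comm, pow_mul]
  have e₂ : Complex.I ^ (3 * 2 * k) = (Complex.I ^ k) ^ 2 := by
    rw [show 3 * 2 * k = 4 * k + k * 2 by ring, pow_add, pow_mul, Complex.I_pow_four, one_pow,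
      one_mul, pow_mul]
  have e₃ : Complex.I ^ (3 * 3 * k) = Complex.I ^ k := by
    rw [show 3 * 3 * k = 4 * (2 * k) + k by ring, pow_add, pow_mul, Complex.I_pow_four, one_pow,
      one_mul]
  have h : pr N k X = toPsl N ((1 / 4 : ℂ) • (X + (Complex.I ^ k) ^ 3 • zpsl N X
      + (Complex.I ^ k) ^ 2 • zpsl N (zpsl N X)
      + Complex.I ^ k • zpsl N (zpsl N (zpsl N X))) : psl N).1 := by
    change toPsl N (((1 / 4 : ℂ) • ∑ j ∈ Finset.range 4,
      Complex.I ^ (3 * j * k) • (zfour N) ^ j) X.1) = _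
    simp only [Finset.sum_range_succ, Finset.range_zero, Finset.sum_empty, zero_add, e₁, e₂, e₃]
    simp [coe_zpsl, pow_succ]
  rw [h, toPsl_coe]

theorem sum_I_pow {k j : ℕ} (hk : k < 4) (hj : j < 4) :
    (1 / 4 : ℂ) * (1 + (Complex.I ^ k) ^ 3 * Complex.I ^ j
      + (Complex.I ^ k) ^ 2 * (Complex.I ^ j * Complex.I ^ j)
      + Complex.I ^ k * (Complex.I ^ j * (Complex.I ^ j * Complex.I ^ j))) =
      if k = j then 1 else 0 := by
  interval_cases k <;> interval_cases j <;> apply Complex.ext <;> norm_num [pow_succ]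

theorem pr_of_eigen {N k j : ℕ} (hk : k < 4) (hj : j < 4) {X : psl N}
    (hX : zpsl N X = Complex.I ^ j • X) : pr N k X = if k = j then X else 0 := by
  have h := congrArg (· • X) (sum_I_pow hk hj)
  simp only [ite_smul, one_smul, zero_smul] at h
  rw [← h, pr_apply]
  simp only [hX, map_smul, smul_smul]
  module

theorem zpsl_pr {N : ℕ} (k : ℕ) (X : psl N) :
    zpsl N (pr N k X) = Complex.I ^ k • pr N k X := by
  have h : (Complex.I ^ k) ^ 4 = 1 := by
    rw [← pow_mul, mul_comm, pow_mul, Complex.I_pow_four, one_pow]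
  have h' := congrArg (· • zpsl N X) h
  simp only [one_smul] at h'
  rw [pr_apply]
  simp only [map_smul, map_add, zpsl_pow_four]
  linear_combination (norm := module) -(1 / 4 : ℂ) • h'

theorem pr_pr {N k j : ℕ} (hk : k < 4) (hj : j < 4) (X : psl N) :
    pr N k (pr N j X) = if k = j then pr N j X else 0 :=
  pr_of_eigen hk hj (zpsl_pr j X)

theorem sum_I_pow_smul {V : Type*} [AddCommGroup V] [Module ℂ V] (f : ℕ → V) (x y z w : V)
    (hf : ∀ k, f k = (1 / 4 : ℂ) • (x + (Complex.I ^ k) ^ 3 • y + (Complex.I ^ k) ^ 2 • z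
      + Complex.I ^ k • w)) : f 0 + f 1 + f 2 + f 3 = x := by
  have e₂ : (Complex.I ^ 3) ^ 2 = -1 := by rw [Complex.I_pow_three, neg_sq, Complex.I_sq]
  have e₃ : (Complex.I ^ 3) ^ 3 = Complex.I := by
    rw [Complex.I_pow_three, Odd.neg_pow (by decide), Complex.I_pow_three, neg_neg]
  rw [hf, hf, hf, hf, e₂, e₃]
  simp only [pow_zero, pow_one, one_pow, Complex.I_sq, Complex.I_pow_three]
  module

theorem sum_pr {N : ℕ} (X : psl N) : pr N 0 X + pr N 1 X + pr N 2 X + pr N 3 X = X :=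
  sum_I_pow_smul (fun k => pr N k X) X _ _ _ fun k => pr_apply k X

theorem pr_br {N k i j : ℕ} (hk : k < 4) (X Y : psl N) :
    pr N k (br (pr N i X) (pr N j Y)) =
      if k = (i + j) % 4 then br (pr N i X) (pr N j Y) else 0 := by
  refine pr_of_eigen hk (Nat.mod_lt _ (by norm_num)) ?_
  rw [zpsl_br, zpsl_pr, zpsl_pr, br_smul_left, br_smul_right, smul_smul, ← pow_add,
    Complex.I_pow_eq_pow_mod (i + j)]

/-- Invariance of the form under the automorphism multiplies this pairing by `i^(i+j)`, which
differs from `1`. -/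
theorem kf_pr_pr_eq_zero {N i j : ℕ} (h : (i + j) % 4 ≠ 0) (X Y : psl N) :
    kf N (pr N i X) (pr N j Y) = 0 := by
  have e := kf_zpsl (pr N i X) (pr N j Y)
  rw [zpsl_pr, zpsl_pr, map_smul, LinearMap.map_smul₂, smul_smul, ← pow_add, add_comm j,
    Complex.I_pow_eq_pow_mod] at e
  have hne : Complex.I ^ ((i + j) % 4) - 1 ≠ 0 := by
    have hlt := Nat.mod_lt (i + j) (show 4 > 0 by norm_num)
    generalize (i + j) % 4 = n at h hlt
    interval_cases n
    · exact absurd rfl h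
    · intro h; have := congrArg Complex.re h; norm_num at this
    · norm_num
    · intro h; have := congrArg Complex.re h; norm_num [Complex.I_pow_three] at this
  have e' : (Complex.I ^ ((i + j) % 4) - 1) • kf N (pr N i X) (pr N j Y) = 0 := by
    linear_combination (norm := module) e
  exact (smul_eq_zero.1 e').resolve_left hne

theorem kf_pr_left {N i j : ℕ} (hi : i < 4) (hj : j < 4) (h : (i + j) % 4 = 0) (X Y : psl N) :
    kf N (pr N i X) Y = kf N X (pr N j Y) := by
  have e : kf N (pr N i X) Y = kf N (pr N i X) (pr N j Y) := by
    have z : ∀ l, l < 4 → l ≠ j → kf N (pr N i X) (pr N l Y) = 0 :=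
      fun l hl hlj => kf_pr_pr_eq_zero (by omega) _ _
    have s := congrArg (kf N (pr N i X)) (sum_pr Y)
    simp only [map_add] at s
    rw [← s]
    interval_cases j
    · linear_combination (norm := module) z 1 (by omega) (by omega) + z 2 (by omega) (by omega)
        + z 3 (by omega) (by omega)
    · linear_combination (norm := module) z 0 (by omega) (by omega) + z 2 (by omega) (by omega)
        + z 3 (by omega) (by omega)
    · linear_combination (norm := module) z 0 (by omega) (by omega) + z 1 (by omega) (by omega)
        + z 3 (by omega) (by omega)
    · linear_combination (norm := module) z 0 (by omega) (by omega) + z 1 (by omega) (by omega)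
        + z 2 (by omega) (by omega)
  have e' : kf N X (pr N j Y) = kf N (pr N i X) (pr N j Y) := by
    have z : ∀ l, l < 4 → l ≠ i → kf N (pr N l X) (pr N j Y) = 0 :=
      fun l hl hli => kf_pr_pr_eq_zero (by omega) _ _
    have s := congrArg (fun Z => kf N Z (pr N j Y)) (sum_pr X)
    simp only [LinearMap.map_add₂] at s
    rw [← s]
    interval_cases i
    · linear_combination (norm := module) z 1 (by omega) (by omega) + z 2 (by omega) (by omega)
        + z 3 (by omega) (by omega)
    · linear_combination (norm := module) z 0 (by omega) (by omega) + z 2 (by omega) (by omega)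
        + z 3 (by omega) (by omega)
    · linear_combination (norm := module) z 0 (by omega) (by omega) + z 1 (by omega) (by omega)
        + z 3 (by omega) (by omega)
    · linear_combination (norm := module) z 0 (by omega) (by omega) + z 1 (by omega) (by omega)
        + z 2 (by omega) (by omega)
  rw [e, e']

/-! ## Lorentz currents -/

/-- The automorphism exchanges `X Y` and `Y X`, as the eigenvalues of the two ghosts multiply to
one, and so fixes their anticommutator. -/
theorem pr_lorentz {N k j : ℕ} (hk : Odd k) (hj : Odd j) (hkj : (k + j) % 4 = 0) {X Y : SMat N}
    (hX : IsGhost k X) (hY : IsGhost j Y) :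
    pr N 0 (lorentz N (X ⊗ₜ Y)) = lorentz N (X ⊗ₜ Y) := by
  have hX' := hX.isOffDiagonal hk
  have hY' := hY.isOffDiagonal hj
  have e : lorentz N (X ⊗ₜ Y) = -toPsl N (X * Y + Y * X) := by
    simp [lorentz]
  have hI : Complex.I ^ k * Complex.I ^ j = 1 := by
    rw [← pow_add, Complex.I_pow_eq_pow_mod, hkj, pow_zero]
  have hXY : zfour N (X * Y) = Y * X := by
    rw [hX'.zfour_mul hY', hX.2, hY.2, Matrix.smul_mul, Matrix.mul_smul, smul_smul,
      mul_comm (Complex.I ^ j), hI, one_smul]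
  have hYX : zfour N (Y * X) = X * Y := by
    rw [hY'.zfour_mul hX', hX.2, hY.2, Matrix.smul_mul, Matrix.mul_smul, smul_smul, hI, one_smul]
  have h : zpsl N (lorentz N (X ⊗ₜ Y)) = Complex.I ^ 0 • lorentz N (X ⊗ₜ Y) := by
    have h' : zpsl N (lorentz N (X ⊗ₜ Y)) = lorentz N (X ⊗ₜ Y) := by
      rw [e, map_neg, zpsl_toPsl ((hX'.mul_even hY').add (hY'.mul_even hX')), map_add (zfour N),
        hXY, hYX, add_comm (Y * X)]
    rw [h', pow_zero]
    module
  exact (pr_of_eigen (by norm_num) (by norm_num) h).trans (if_pos rfl)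

theorem Ghosts.Valid.pr_Nm {N : ℕ} {G : Ghosts N} (hG : G.Valid) : pr N 0 G.Nm = G.Nm :=
  pr_lorentz (by decide) (by decide) (by norm_num) hG.l1 hG.w3

theorem Ghosts.Valid.pr_Np {N : ℕ} {G : Ghosts N} (hG : G.Valid) : pr N 0 G.Np = G.Np :=
  pr_lorentz (by decide) (by decide) (by norm_num) hG.l3 hG.w1

/-! ## The real form spans `psl(4|4)` -/

theorem hermH_diagonal (N : ℕ) : ∃ s : Idx → ℂ, (∀ a, s a * s a = 1) ∧ (∀ a, star (s a) = s a) ∧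
    hermH N = Matrix.diagonal fun a => algebraMap ℂ (SF N) (s a) := by
  refine ⟨Sum.elim ![1, 1, -1, -1] (fun _ => 1), fun a => ?_, fun a => ?_, rfl⟩ <;>
  · rcases a with a | a <;> fin_cases a <;> simp

theorem isPsu_iff {N : ℕ} {s : Idx → ℂ}
    (hs : hermH N = Matrix.diagonal fun a => algebraMap ℂ (SF N) (s a)) (X : psl N) :
    IsPsu X ↔ ∀ a b, s b • star (X.1 b a) + s a • X.1 a b = 0 := by
  rw [IsPsu, hs, ← Matrix.ext_iff]
  refine forall_congr' fun a => forall_congr' fun b => ?_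
  rw [Matrix.add_apply, Matrix.mul_diagonal, Matrix.diagonal_mul, Matrix.conjTranspose_apply,
    ← Algebra.commutes, Algebra.algebraMap_eq_smul_one, Algebra.algebraMap_eq_smul_one,
    smul_mul_assoc, one_mul, smul_mul_assoc, one_mul, Matrix.zero_apply]

theorem isPsu_zero (N : ℕ) : IsPsu (0 : psl N) := by
  simp [IsPsu]

theorem trL_apply {N : ℕ} (X : SMat N) : trL N X = ∑ i, X (Sum.inl i) (Sum.inl i) := by
  simp [trL]

theorem trR_apply {N : ℕ} (X : SMat N) : trR N X = ∑ i, X (Sum.inr i) (Sum.inr i) := by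
  simp [trR]

/-- The map `X ↦ -H X† H` is an antilinear involution whose fixed points form the real form; `U` and
`V` are the real and imaginary parts with respect to it. -/
theorem exists_isPsu_add_smul {N : ℕ} (X : psl N) :
    ∃ U V : psl N, IsPsu U ∧ IsPsu V ∧ X = U + Complex.I • V := by
  obtain ⟨s, hs₁, hs₂, hs⟩ := hermH_diagonal N
  let Y : SMat N := Matrix.of fun a b => -(s a * s b) • star (X.1 b a)
  have hY : Y ∈ psl N := by
    refine ⟨fun a b => ?_, ?_, ?_⟩
    · change parity N (-(s a * s b) • star (X.1 b a)) = _ • (-(s a * s b) • star (X.1 b a))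
      have h : star (sgn b * sgn a) = sgn a * sgn b := by
        rcases a with a | a <;> rcases b with b | b <;> simp [sgn]
      rw [map_smul, parity_star, X.2.1, star_smul, h, smul_comm]
    · have h := X.2.2.1
      rw [trL_apply] at h ⊢
      have h' : ∀ i : Fin 4, Y (Sum.inl i) (Sum.inl i) = -star (X.1 (Sum.inl i) (Sum.inl i)) := by
        intro i
        change -(s _ * s _) • star (X.1 _ _) = _
        rw [hs₁]
        module
      rw [Finset.sum_congr rfl fun i _ => h' i, Finset.sum_neg_distrib, ← star_sum, h, star_zero,
        neg_zero]
    · have h := X.2.2.2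
      rw [trR_apply] at h ⊢
      have h' : ∀ i : Fin 4, Y (Sum.inr i) (Sum.inr i) = -star (X.1 (Sum.inr i) (Sum.inr i)) := by
        intro i
        change -(s _ * s _) • star (X.1 _ _) = _
        rw [hs₁]
        module
      rw [Finset.sum_congr rfl fun i _ => h' i, Finset.sum_neg_distrib, ← star_sum, h, star_zero,
        neg_zero]
  have hstar : ∀ a b, star (Y a b) = -(s a * s b) • X.1 b a := by
    intro a b
    change star (-(s a * s b) • star (X.1 b a)) = _
    rw [star_smul, star_star, star_neg, star_mul, hs₂, hs₂, mul_comm]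
  have hYab : ∀ a b, Y a b = -(s a * s b) • star (X.1 b a) := fun a b => rfl
  refine ⟨(1 / 2 : ℂ) • (X + ⟨Y, hY⟩), (-Complex.I / 2) • (X - ⟨Y, hY⟩), ?_, ?_, ?_⟩
  · rw [isPsu_iff hs]
    intro a b
    change s b • star ((1 / 2 : ℂ) • (X.1 b a + Y b a))
      + s a • ((1 / 2 : ℂ) • (X.1 a b + Y a b)) = 0
    have e : star (1 / 2 : ℂ) = 1 / 2 := by norm_num
    have h₁ : (s b * s b * s a) • X.1 a b = (1 * s a) • X.1 a b := by rw [hs₁]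
    have h₂ : (s a * s a * s b) • star (X.1 b a) = (1 * s b) • star (X.1 b a) := by rw [hs₁]
    rw [star_smul, star_add, hstar, hYab, e]
    linear_combination (norm := module) -(1 / 2 : ℂ) • h₁ - (1 / 2 : ℂ) • h₂
  · rw [isPsu_iff hs]
    intro a b
    change s b • star ((-Complex.I / 2 : ℂ) • (X.1 b a - Y b a))
      + s a • ((-Complex.I / 2 : ℂ) • (X.1 a b - Y a b)) = 0
    have e : star (-Complex.I / 2 : ℂ) = Complex.I / 2 := by simp
    have h₁ : (s b * s b * s a) • X.1 a b = (1 * s a) • X.1 a b := by rw [hs₁]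
    have h₂ : (s a * s a * s b) • star (X.1 b a) = (1 * s b) • star (X.1 b a) := by rw [hs₁]
    rw [star_smul, star_sub, hstar, hYab, e]
    linear_combination (norm := module) (Complex.I / 2) • h₁ - (Complex.I / 2) • h₂
  · generalize (⟨Y, hY⟩ : psl N) = Z
    rw [smul_smul, show Complex.I * (-Complex.I / 2) = 1 / 2 by
      linear_combination (-1 / 2 : ℂ) * Complex.I_sq]
    module

/-- Linear maps that agree on the real form are equal. -/
theorem ext_isPsu {N : ℕ} {W : Type*} [AddCommMonoid W] [Module ℂ W] {S T : psl N →ₗ[ℂ] W}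
    (h : ∀ X, IsPsu X → S X = T X) (X : psl N) : S X = T X := by
  obtain ⟨U, V, hU, hV, rfl⟩ := exists_isPsu_add_smul X
  rw [map_add, map_add, map_smul, map_smul, h U hU, h V hV]

/-! ## The deformed models as deformed forms -/

namespace Model

variable {N : ℕ}

theorem pr_pr_self {k : ℕ} (hk : k < 4) (X : psl N) : pr N k (pr N k X) = pr N k X :=
  (pr_pr hk hk X).trans (if_pos rfl)

theorem pr_pr_of_ne {k j : ℕ} (hk : k < 4) (hj : j < 4) (h : k ≠ j) (X : psl N) :
    pr N k (pr N j X) = 0 :=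
  (pr_pr hk hj X).trans (if_neg h)

theorem apply_inverse_apply {V : Type*} [AddCommMonoid V] [Module ℂ V] {T : Module.End ℂ V}
    (hT : IsUnit T) (x : V) : T (Ring.inverse T x) = x :=
  LinearMap.congr_fun (Ring.mul_inverse_cancel T hT) x

theorem apply_apply_of_eq_inverse (T S : Op N) (hT : IsUnit T) (hS : S = Ring.inverse T)
    (x : psl N) : T (S x) = x := by
  subst hS
  exact apply_inverse_apply hT x

theorem etaRg_apply (M : Model N) (X : psl N) :
    M.etaRg X = (M.eta : ℂ) • Ad M.g (M.R (Ad M.g⁻¹ X)) := rfl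

theorem OPSm_apply (M : Model N) (X : psl N) : M.OPSm X =
    X - M.etaRg (pr N 1 X + (2 : ℂ) • pr N 2 X + (3 : ℂ) • pr N 3 X) := rfl

theorem OPSp_apply (M : Model N) (X : psl N) : M.OPSp X =
    X + M.etaRg ((3 : ℂ) • pr N 1 X + (2 : ℂ) • pr N 2 X + pr N 3 X) := rfl

theorem OGSm_apply (M : Model N) (X : psl N) : M.OGSm X =
    X - M.etaRg (pr N 1 X + (2 : ℂ) • pr N 2 X - pr N 3 X) := rfl

theorem OGSp_apply (M : Model N) (X : psl N) : M.OGSp X =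
    X + M.etaRg (-pr N 1 X + (2 : ℂ) • pr N 2 X + pr N 3 X) := rfl

section Operators

attribute [local irreducible] pr kf Ad

theorem Valid.kf_etaRg {M : Model N} (hM : M.Valid) (X Y : psl N) :
    kf N (M.etaRg X) Y = -kf N X (M.etaRg Y) := by
  have hg := hM.group.even
  have h := kf_Ad_left hg.inv X (M.R (Ad M.g⁻¹ Y))
  rw [inv_inv] at h
  rw [etaRg_apply, etaRg_apply, LinearMap.map_smul₂, map_smul, kf_Ad_left hg,
    hM.rmatrix.antisymm, h]
  module

theorem deformedForm_of_inverse (r mS pS m p : Op N)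
    (anti : ∀ x y, kf N (r x) y = -kf N x (r y))
    (hmS : ∀ x, mS x - mS (r (pr N 1 x + (2 : ℂ) • pr N 2 x + (3 : ℂ) • pr N 3 x)) = x)
    (hmS' : ∀ x, mS x - r (pr N 1 (mS x) + (2 : ℂ) • pr N 2 (mS x) + (3 : ℂ) • pr N 3 (mS x)) = x)
    (hpS : ∀ x, pS x + pS (r ((3 : ℂ) • pr N 1 x + (2 : ℂ) • pr N 2 x + pr N 3 x)) = x)
    (hpS' : ∀ x, pS x + r ((3 : ℂ) • pr N 1 (pS x) + (2 : ℂ) • pr N 2 (pS x) + pr N 3 (pS x)) = x)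
    (hm : ∀ x, m x - m (r (pr N 1 x + (2 : ℂ) • pr N 2 x - pr N 3 x)) = x)
    (hm' : ∀ x, m x - r (pr N 1 (m x) + (2 : ℂ) • pr N 2 (m x) - pr N 3 (m x)) = x)
    (hp : ∀ x, p x + p (r (-pr N 1 x + (2 : ℂ) • pr N 2 x + pr N 3 x)) = x)
    (hp' : ∀ x, p x + r (-pr N 1 (p x) + (2 : ℂ) • pr N 2 (p x) + pr N 3 (p x)) = x) :
    DeformedForm (kf N) (pr N 0) (pr N 1) (pr N 2) (pr N 3) r mS pS m p where
  symm := kf_symm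
  adj₀ := kf_pr_left (by norm_num) (by norm_num) (by norm_num)
  adj₁ := kf_pr_left (by norm_num) (by norm_num) (by norm_num)
  adj₂ := kf_pr_left (by norm_num) (by norm_num) (by norm_num)
  sum := sum_pr
  p₀₁ := pr_pr_of_ne (by norm_num) (by norm_num) (by norm_num)
  p₀₂ := pr_pr_of_ne (by norm_num) (by norm_num) (by norm_num)
  p₀₃ := pr_pr_of_ne (by norm_num) (by norm_num) (by norm_num)
  p₁₀ := pr_pr_of_ne (by norm_num) (by norm_num) (by norm_num)
  p₁₁ := pr_pr_self (by norm_num)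
  p₁₂ := pr_pr_of_ne (by norm_num) (by norm_num) (by norm_num)
  p₁₃ := pr_pr_of_ne (by norm_num) (by norm_num) (by norm_num)
  p₂₁ := pr_pr_of_ne (by norm_num) (by norm_num) (by norm_num)
  p₂₂ := pr_pr_self (by norm_num)
  p₂₃ := pr_pr_of_ne (by norm_num) (by norm_num) (by norm_num)
  p₃₀ := pr_pr_of_ne (by norm_num) (by norm_num) (by norm_num)
  p₃₁ := pr_pr_of_ne (by norm_num) (by norm_num) (by norm_num)
  p₃₂ := pr_pr_of_ne (by norm_num) (by norm_num) (by norm_num)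
  p₃₃ := pr_pr_self (by norm_num)
  anti := anti
  mS_left := hmS
  mS_right := hmS'
  pS_left := hpS
  pS_right := hpS'
  m_left := hm
  m_right := hm'
  p_left := hp
  p_right := hp'

theorem Valid.deformedForm {M : Model N} (hM : M.Valid) :
    DeformedForm (kf N) (pr N 0) (pr N 1) (pr N 2) (pr N 3) M.etaRg M.iPSm M.iPSp M.iGSm
      M.iGSp := by
  refine deformedForm_of_inverse M.etaRg M.iPSm M.iPSp M.iGSm M.iGSp hM.kf_etaRg ?_ ?_ ?_ ?_ ?_ ?_
    ?_ ?_ <;> intro x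
  · rw [← map_sub]
    exact LinearMap.congr_fun (Ring.inverse_mul_cancel _ hM.unitPSm) x
  · rw [← M.OPSm_apply]
    exact apply_apply_of_eq_inverse M.OPSm M.iPSm hM.unitPSm rfl x
  · rw [← map_add]
    exact LinearMap.congr_fun (Ring.inverse_mul_cancel _ hM.unitPSp) x
  · rw [← M.OPSp_apply]
    exact apply_apply_of_eq_inverse M.OPSp M.iPSp hM.unitPSp rfl x
  · rw [← map_sub]
    exact LinearMap.congr_fun (Ring.inverse_mul_cancel _ hM.unitGSm) x
  · rw [← M.OGSm_apply]
    exact apply_apply_of_eq_inverse M.OGSm M.iGSm hM.unitGSm rfl x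
  · rw [← map_add]
    exact LinearMap.congr_fun (Ring.inverse_mul_cancel _ hM.unitGSp) x
  · rw [← M.OGSp_apply]
    exact apply_apply_of_eq_inverse M.OGSp M.iGSp hM.unitGSp rfl x

/-! ### The operators `ϑ_±` -/

theorem Valid.thetaM_eq {M : Model N} (hM : M.Valid) :
    M.thetaM = 1 - (4 / 3 : ℂ) • pr N 3 + (4 / 3 : ℂ) • (M.iPSm * pr N 3) :=
  LinearMap.ext hM.deformedForm.thetaM_apply

theorem Valid.thetaP_eq {M : Model N} (hM : M.Valid) :
    M.thetaP = 1 - (4 / 3 : ℂ) • pr N 1 + (4 / 3 : ℂ) • (M.iPSp * pr N 1) :=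
  LinearMap.ext hM.deformedForm.thetaP_apply

theorem Valid.thetaP_apply {M : Model N} (hM : M.Valid) (X : psl N) :
    M.thetaP X = X - (4 / 3 : ℂ) • pr N 1 X + (4 / 3 : ℂ) • M.iPSp (pr N 1 X) :=
  hM.deformedForm.thetaP_apply X

theorem inverse_inverse_mul {A : Type*} [MonoidWithZero A] {a b : A} (ha : IsUnit a)
    (hb : IsUnit b) :
    Ring.inverse (Ring.inverse a * b) = Ring.inverse b * a := by
  obtain ⟨u, rfl⟩ := ha
  obtain ⟨v, rfl⟩ := hb
  rw [Ring.inverse_unit, ← Units.val_mul, Ring.inverse_unit, Ring.inverse_unit, ← Units.val_mul,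
    mul_inv_rev, inv_inv]

theorem Valid.inverse_thetaM_eq {M : Model N} (hM : M.Valid) :
    Ring.inverse M.thetaM = 1 - (4 : ℂ) • pr N 3 + (4 : ℂ) • (M.iGSm * pr N 3) :=
  (inverse_inverse_mul hM.unitPSm hM.unitGSm).trans
    (LinearMap.ext hM.deformedForm.thetaM_inv_apply)

theorem Valid.inverse_thetaP_eq {M : Model N} (hM : M.Valid) :
    Ring.inverse M.thetaP = 1 - (4 : ℂ) • pr N 1 + (4 : ℂ) • (M.iGSp * pr N 1) :=
  (inverse_inverse_mul hM.unitPSp hM.unitGSp).trans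
    (LinearMap.ext hM.deformedForm.thetaP_inv_apply)

theorem inverse_mul_mul_inverse {A : Type*} [MonoidWithZero A] {a b : A} (hb : IsUnit b) :
    Ring.inverse a = Ring.inverse a * b * Ring.inverse b := by
  rw [mul_assoc, Ring.mul_inverse_cancel _ hb, mul_one]

theorem Valid.iPSm_eq {M : Model N} (hM : M.Valid) : M.iPSm = M.thetaM * M.iGSm :=
  inverse_mul_mul_inverse hM.unitGSm

theorem Valid.iPSp_eq {M : Model N} (hM : M.Valid) : M.iPSp = M.thetaP * M.iGSp :=
  inverse_mul_mul_inverse hM.unitGSp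

end Operators

end Model

variable {N : ℕ}

/-! ## The Green-Schwarz background -/

section Components

variable (M : Model N) (h : (Op N)ˣ)

theorem dPS_apply (X : psl N) :
    dPS N X = pr N 1 X + (2 : ℂ) • pr N 2 X + (3 : ℂ) • pr N 3 X := rfl

theorem dGS_apply (X : psl N) : dGS N X = pr N 1 X + (2 : ℂ) • pr N 2 X - pr N 3 X := rfl

theorem dGSt_apply (X : psl N) : dGSt N X = -pr N 1 X + (2 : ℂ) • pr N 2 X + pr N 3 X := rfl

theorem gsLagrangian_apply (u v : psl N) :
    M.gsLagrangian u v = (1 / 4 : ℂ) • kf N v (dGS N (M.iGSm u)) := by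
  rw [Model.gsLagrangian, LinearMap.smul_apply, LinearMap.smul_apply, LinearMap.flip_apply]
  rfl

theorem gsBackground_G (u v : psl N) : (gsBackground M h).G u v =
    (1 / 4 : ℂ) • kf N v (pr N 1 (M.iGSm u) + (2 : ℂ) • pr N 2 (M.iGSm u) - pr N 3 (M.iGSm u))
      + (1 / 4 : ℂ) • kf N u
        (pr N 1 (M.iGSm v) + (2 : ℂ) • pr N 2 (M.iGSm v) - pr N 3 (M.iGSm v)) := by
  rw [← dGS_apply, ← dGS_apply, ← gsLagrangian_apply, ← gsLagrangian_apply]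
  rfl

theorem gsBackground_B (u v : psl N) : (gsBackground M h).B u v =
    (1 / 4 : ℂ) • kf N v (pr N 1 (M.iGSm u) + (2 : ℂ) • pr N 2 (M.iGSm u) - pr N 3 (M.iGSm u))
      - (1 / 4 : ℂ) • kf N u
        (pr N 1 (M.iGSm v) + (2 : ℂ) • pr N 2 (M.iGSm v) - pr N 3 (M.iGSm v)) := by
  rw [← dGS_apply, ← dGS_apply, ← gsLagrangian_apply, ← gsLagrangian_apply]
  rfl

theorem gsBackground_E1 (u : psl N) :
    (gsBackground M h).E1 u = (h : Op N) (pr N 1 (M.iGSp u)) := rfl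

theorem gsBackground_E3 (u : psl N) : (gsBackground M h).E3 u = pr N 3 (M.iGSm u) := rfl

theorem gsBackground_P (d e : psl N) :
    (gsBackground M h).P d e = kf N d ((h : Op N) (M.gsRR e)) := rfl

theorem gsBackground_Om (u : psl N) (G : Ghosts N) :
    (gsBackground M h).Om u G.lw = kf N (pr N 0 (M.iGSp u)) G.Nm := rfl

theorem gsBackground_OmHat (u : psl N) (G : Ghosts N) :
    (gsBackground M h).OmHat u G.lwHat = kf N (pr N 0 (M.iGSm u)) G.Np := rfl

theorem gsBackground_CHat (G : Ghosts N) (d : psl N) :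
    (gsBackground M h).CHat G.lwHat d =
      kf N G.Np (M.gsCHat (((h⁻¹ : (Op N)ˣ) : Op N) d)) := by
  have e : (gsBackground M h).CHat =
    (kf N).compl₁₂ (lorentz N) (M.gsCHat * ((h⁻¹ : (Op N)ˣ) : Op N)) := rfl
  rw [e, Ghosts.Np, LinearMap.compl₁₂_apply, Module.End.mul_apply]

theorem gsBackground_S (G : Ghosts N) :
    (gsBackground M h).S G.lw G.lwHat = kf N G.Np (M.gsS G.Nm) := by
  unfold gsBackground
  dsimp only
  generalize M.gsS = s
  rfl

theorem neg_four_smul_mul_mul_apply {V : Type*} [AddCommGroup V] [Module ℂ V]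
    (a b c : Module.End ℂ V) (x : V) :
    (-((4 : ℂ) • (a * b * c))) x = -((4 : ℂ) • a (b (c x))) := rfl

theorem neg_mul_one_sub_mul_apply {V : Type*} [AddCommGroup V] [Module ℂ V]
    (a b c : Module.End ℂ V) (x : V) :
    (-(a * (1 - (4 : ℂ) • (b * c)) * a)) x = -a (a x - (4 : ℂ) • b (c (a x))) := rfl

theorem mul_three_sub_mul_apply {V : Type*} [AddCommGroup V] [Module ℂ V]
    (a b : Module.End ℂ V) (x : V) :
    (a * ((3 : ℂ) • 1 - (4 : ℂ) • b) * a) x = a ((3 : ℂ) • a x - (4 : ℂ) • b (a x)) := rfl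

theorem gsRR_apply (X : psl N) : M.gsRR X =
    pr N 1 ((3 : ℂ) • pr N 1 X - (4 : ℂ) • M.iGSp (pr N 1 X)) :=
  mul_three_sub_mul_apply (pr N 1) M.iGSp X

theorem gsC_apply (X : psl N) : M.gsC X = -((4 : ℂ) • pr N 0 (M.iGSp (pr N 1 X))) := by
  rw [Model.gsC, neg_four_smul_mul_mul_apply]

theorem gsBackground_C (G : Ghosts N) (e : psl N) : (gsBackground M h).C G.lw e =
    kf N G.Nm (-((4 : ℂ) • pr N 0 (M.iGSp (pr N 1 e)))) := by
  rw [← gsC_apply, Ghosts.Nm, gsBackground, LinearMap.compl₁₂_apply]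

theorem gsCHat_apply (X : psl N) : M.gsCHat X = -((4 : ℂ) • pr N 0 (M.iGSm (pr N 3 X))) := by
  rw [Model.gsCHat, neg_four_smul_mul_mul_apply]

theorem gsS_apply (X : psl N) : M.gsS X =
    -pr N 0 (pr N 0 X - (4 : ℂ) • M.iGSm (M.etaRg (pr N 0 X))) := by
  rw [Model.gsS, neg_mul_one_sub_mul_apply]

theorem sub_add_mul_mul_apply {V : Type*} [AddCommGroup V] [Module ℂ V]
    (a b c d e : Module.End ℂ V) (x : V) :
    (a - b + c * d * e) x = a x - b x + c (d (e x)) := rfl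

theorem bfield_operator_apply (T : Op N) (X : psl N) :
    (pr N 1 - pr N 3 + dGSt N * T * dGS N) X = pr N 1 X - pr N 3 X
      + (-pr N 1 (T (pr N 1 X + (2 : ℂ) • pr N 2 X - pr N 3 X))
        + (2 : ℂ) • pr N 2 (T (pr N 1 X + (2 : ℂ) • pr N 2 X - pr N 3 X))
        + pr N 3 (T (pr N 1 X + (2 : ℂ) • pr N 2 X - pr N 3 X))) := by
  rw [sub_add_mul_mul_apply, dGSt_apply, dGS_apply]

theorem inv_apply_frame (X : psl N) : ((h⁻¹ : (Op N)ˣ) : Op N) ((h : Op N) X) = X :=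
  LinearMap.congr_fun h.inv_mul X

theorem frame_apply_inv (X : psl N) : (h : Op N) (((h⁻¹ : (Op N)ˣ) : Op N) X) = X :=
  LinearMap.congr_fun h.mul_inv X

end Components

namespace IsFrameRotation

theorem kf_left {h : (Op N)ˣ} (hh : IsFrameRotation h) (X Y : psl N) :
    kf N X ((h : Op N) Y) = kf N (((h⁻¹ : (Op N)ˣ) : Op N) X) Y := by
  rw [← hh.isometry (((h⁻¹ : (Op N)ˣ) : Op N) X), frame_apply_inv]

theorem pr_apply {h : (Op N)ˣ} (hh : IsFrameRotation h) (k : ℕ) (X : psl N) :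
    pr N k ((h : Op N) X) = (h : Op N) (pr N k X) :=
  (LinearMap.congr_fun (hh.grading k) X).symm

theorem gsBackground_P {h : (Op N)ˣ} (hh : IsFrameRotation h) (M : Model N) (d e : psl N) :
    (gsBackground M h).P ((h : Op N) d) e = kf N d
      (pr N 1 ((3 : ℂ) • pr N 1 e - (4 : ℂ) • M.iGSp (pr N 1 e))) :=
  (YB.gsBackground_P M h ((h : Op N) d) e).trans ((hh.isometry d (M.gsRR e)).trans
    (congrArg (kf N d) (gsRR_apply M e)))

end IsFrameRotation



/-! ### Sectors of the action and auxiliary fields in the Green-Schwarz background -/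

namespace Model.Valid

section Sectors

attribute [local irreducible] pr kf iPSm iPSp iGSm iGSp etaRg gsRR gsC gsCHat gsS dPS dGS thetaP

theorem eq_half_add_half_sub {W : Type*} [AddCommGroup W] [Module ℂ W] {q a t : W} (h : q = a + t)
    (b : W) : q = (1 / 2 : ℂ) • (a + b) + (1 / 2 : ℂ) • (a - b) + t := by
  rw [h]
  module

theorem kinetic_sector {M : Model N} (hM : M.Valid) (h : (Op N)ˣ) (Ap Am : psl N) :
    (1 / 4 : ℂ) • kf N Ap (dPS N (M.iPSm Am)) =
      (1 / 2 : ℂ) • (gsBackground M h).G Am Ap + (1 / 2 : ℂ) • (gsBackground M h).B Am Ap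
        + kf N (pr N 3 (M.iGSm Am)) (pr N 1 (M.iPSp Ap)) := by
  rw [gsBackground_G, gsBackground_B, dPS_apply]
  exact eq_half_add_half_sub (hM.deformedForm.kinetic_sector Ap Am) _

theorem thetaP_E1 {M : Model N} (hM : M.Valid) (h : (Op N)ˣ) (X : psl N) :
    (pr N 1 * M.thetaP * pr N 1 * ((h⁻¹ : (Op N)ˣ) : Op N)) ((gsBackground M h).E1 X) =
      pr N 1 (M.iPSp X) := by
  rw [gsBackground_E1, Module.End.mul_apply, Module.End.mul_apply, Module.End.mul_apply,
    inv_apply_frame, hM.deformedForm.p₁₁, hM.thetaP_apply, hM.deformedForm.P₁_thetaP_P₁_p]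

theorem current_sector {M : Model N} (hM : M.Valid) (h : (Op N)ˣ) (Ap Am : psl N)
    {G : Ghosts N} (hG : G.Valid) :
    kf N G.Np (M.iPSm Am) + kf N G.Nm (M.iPSp Ap) =
      (gsBackground M h).Om Ap G.lw + (gsBackground M h).OmHat Am G.lwHat
        + (4 / 3 : ℂ) • kf N (pr N 0 (M.iPSm (pr N 3 (M.iGSm Am)))) G.Np
        + (4 / 3 : ℂ) • kf N (pr N 0 (M.iPSp (pr N 1 (M.iGSp Ap)))) G.Nm := by
  rw [gsBackground_Om, gsBackground_OmHat]
  exact hM.deformedForm.current_sector Ap Am G.Nm G.Np hG.pr_Nm hG.pr_Np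

theorem curvature_sector {M : Model N} (hM : M.Valid) (h : (Op N)ˣ) {G : Ghosts N}
    (hG : G.Valid) :
    -kf N G.Np (G.Nm - (4 : ℂ) • M.iPSm (M.etaRg G.Nm)) =
      (gsBackground M h).S G.lw G.lwHat
        - (16 : ℂ) • kf N (pr N 3 (M.iGSm (M.etaRg G.Nm))) (pr N 1 (M.iPSp (M.etaRg G.Np))) := by
  rw [gsBackground_S, gsS_apply]
  exact hM.deformedForm.curvature_sector' G.Nm G.Np hG.pr_Nm hG.pr_Np

theorem auxEquations {M : Model N} (hM : M.Valid) {h : (Op N)ˣ} (hh : IsFrameRotation h)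
    (Ap Am : psl N) {G : Ghosts N} (hG : G.Valid) :
    (gsBackground M h).AuxEquations Ap Am ((h : Op N) (pr N 3 (M.brstM Am G)))
      (pr N 1 (M.brstP Ap G)) G := by
  have D := hM.deformedForm
  refine ⟨fun e _ => ?_, fun e _ => ?_⟩
  -- Being an isometry, the frame rotation can be moved onto the test element as `h⁻¹ e`, which
  -- reduces to the unrotated equation.
  · rw [gsBackground_E1, gsBackground_P, gsBackground_CHat, hh.kf_left, hh.kf_left, gsRR_apply,
      gsCHat_apply]
    exact D.aux_left' Ap G.Np _ hG.pr_Np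
  · rw [gsBackground_E3, hh.gsBackground_P, gsBackground_C]
    exact D.aux_right' Am G.Nm e hG.pr_Nm

/-- Adding the two auxiliary equations counts the bispinor term `P` twice, so all terms with
auxiliary fields sum to `-P`. By `h₆` this is the sum of the remainders of the three sectors. -/
theorem action_of_sectors {W : Type*} [AddCommGroup W]
    {q v v' w g b t om oh c₁ c₂ s x e₁ e₂ P ch c k : W}
    (h₁ : q = g + b + t) (h₂ : v + v' = om + oh + c₁ + c₂) (h₃ : -w = s - x)
    (h₄ : e₁ + P + ch = 0) (h₅ : e₂ + P + c = 0) (h₆ : P = -(t + c₁ + c₂ - x)) :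
    q + v + v' - w + k = g + b + e₁ + e₂ + P + om + oh + c + ch + s + k := by
  have a : q + v + v' - w + k = q + (v + v') + -w + k := by abel
  have a' : g + b + e₁ + e₂ + P + om + oh + c + ch + s + k =
      g + b + (e₁ + P + ch) + (e₂ + P + c) - P + om + oh + s + k := by abel
  rw [a, a', h₁, h₂, h₃, h₄, h₅, h₆]
  abel

theorem action {M : Model N} (hM : M.Valid) {h : (Op N)ˣ} (hh : IsFrameRotation h)
    (Ap Am : psl N) {G : Ghosts N} (hG : G.Valid) :
    M.psLagrangian Ap Am G = (gsBackground M h).lagrangian Ap Am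
      ((h : Op N) (pr N 3 (M.brstM Am G))) (pr N 1 (M.brstP Ap G)) G := by
  have D := hM.deformedForm
  have e := hM.auxEquations hh Ap Am hG
  -- The equations of motion are tested on the auxiliary fields themselves, which have the
  -- admissible grades.
  have e₁ := e.1 ((h : Op N) (pr N 3 (M.brstM Am G)))
    (by rw [hh.pr_apply, D.p₃₃])
  have e₂ := e.2 (pr N 1 (M.brstP Ap G)) (D.p₁₁ (M.brstP Ap G))
  have e₃ : (gsBackground M h).P ((h : Op N) (pr N 3 (M.brstM Am G))) (pr N 1 (M.brstP Ap G)) =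
      -(kf N (pr N 3 (M.iGSm Am)) (pr N 1 (M.iPSp Ap))
        + (4 / 3 : ℂ) • kf N (pr N 0 (M.iPSm (pr N 3 (M.iGSm Am)))) G.Np
        + (4 / 3 : ℂ) • kf N (pr N 0 (M.iPSp (pr N 1 (M.iGSp Ap)))) G.Nm
        - (16 : ℂ) • kf N (pr N 3 (M.iGSm (M.etaRg G.Nm))) (pr N 1 (M.iPSp (M.etaRg G.Np)))) := by
    rw [hh.gsBackground_P]
    exact D.aux_product' Ap Am G.Nm G.Np hG.pr_Nm hG.pr_Np
  have e₄ := hM.kinetic_sector h Ap Am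
  have e₅ := hM.current_sector h Ap Am hG
  have e₆ := hM.curvature_sector h hG
  rw [Model.psLagrangian, BHBackground.lagrangian]
  exact action_of_sectors e₄ e₅ e₆ e₁ e₂ e₃

theorem metric {M : Model N} (hM : M.Valid) (h : (Op N)ˣ) (u v : psl N) :
    (gsBackground M h).G u v = kf N (pr N 2 (M.iGSp u)) (pr N 2 (M.iGSp v)) ∧
      (gsBackground M h).G u v = kf N (pr N 2 (M.iGSm u)) (pr N 2 (M.iGSm v)) := by
  rw [gsBackground_G]
  exact ⟨hM.deformedForm.metric_p u v, hM.deformedForm.metric_m u v⟩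

theorem bfield {M : Model N} (hM : M.Valid) (h : (Op N)ˣ) (u v : psl N) :
    (gsBackground M h).B u v = (1 / 2 : ℂ) • kf N (M.iGSm v)
        ((pr N 1 - pr N 3 + dGSt N * M.etaRg * dGS N) (M.iGSm u)) := by
  rw [gsBackground_B, bfield_operator_apply]
  exact hM.deformedForm.bfield_m u v

theorem gsRR_mul_inverse {M : Model N} (hM : M.Valid) {h : (Op N)ˣ} (hh : IsFrameRotation h) :
    (h : Op N) * M.gsRR * -(pr N 1 * M.thetaP * pr N 1 * ((h⁻¹ : (Op N)ˣ) : Op N)) = pr N 1 := by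
  refine LinearMap.ext fun X => ?_
  have D := hM.deformedForm
  have e := D.P₁_p_P₁_thetaP (((h⁻¹ : (Op N)ˣ) : Op N) X)
  rw [Module.End.mul_apply, Module.End.mul_apply, LinearMap.neg_apply, Module.End.mul_apply,
    Module.End.mul_apply, Module.End.mul_apply, map_neg, map_neg, hM.thetaP_apply, gsRR_apply,
    D.p₁₁ (_ + _), e, map_neg, ← hh.pr_apply, frame_apply_inv, neg_neg]

theorem inverse_mul_gsRR {M : Model N} (hM : M.Valid) {h : (Op N)ˣ} :
    -(pr N 1 * M.thetaP * pr N 1 * ((h⁻¹ : (Op N)ˣ) : Op N)) * ((h : Op N) * M.gsRR) = pr N 1 := by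
  refine LinearMap.ext fun X => ?_
  have D := hM.deformedForm
  have e := D.P₁_thetaP_P₁_p_P₁ X
  rw [Module.End.mul_apply, Module.End.mul_apply, LinearMap.neg_apply, Module.End.mul_apply,
    Module.End.mul_apply, Module.End.mul_apply, inv_apply_frame, hM.thetaP_apply, gsRR_apply,
    D.p₁₁ (_ - _), e, neg_neg]

end Sectors

end Model.Valid

/-! ## Uniqueness of the background that is read off -/

/-- The vanishing ghost fields. -/
def Ghosts.trivial (N : ℕ) : Ghosts N := ⟨0, 0, 0, 0⟩

theorem Ghosts.trivial_valid (N : ℕ) : (Ghosts.trivial N).Valid := by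
  have h : ∀ k, IsGhost (N := N) k 0 := fun k =>
    ⟨fun a b => map_zero _, by rw [map_zero, smul_zero]⟩
  have h' : IsPure (N := N) 0 := by rw [IsPure, mul_zero, map_zero]
  exact ⟨h 1, h 3, h 1, h 3, h', h'⟩

theorem Ghosts.trivial_lw (N : ℕ) : (Ghosts.trivial N).lw = 0 := TensorProduct.zero_tmul _ _

theorem Ghosts.trivial_lwHat (N : ℕ) : (Ghosts.trivial N).lwHat = 0 := TensorProduct.zero_tmul _ _

theorem Ghosts.trivial_Np (N : ℕ) : (Ghosts.trivial N).Np = 0 := by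
  rw [Ghosts.Np, Ghosts.trivial_lwHat, map_zero]

theorem Model.brstP_trivial (M : Model N) (X : psl N) :
    M.brstP X (Ghosts.trivial N) = M.iPSp X := by
  rw [Model.brstP, Ghosts.trivial_Np, map_zero, smul_zero, sub_zero]

/-! ### Cancellation in the action -/

theorem cancel_common {W : Type*} [AddCommGroup W] {g b e₁ e₂ p o o' c c' s k g' b' u u' t : W}
    (h : g + b + e₁ + e₂ + p + o + o' + c + c' + s + k =
      g' + b' + e₁ + e₂ + p + u + u' + c + c' + t + k) :
    g + b + o + o' + s = g' + b' + u + u' + t := by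
  have a : ∀ g b o o' s : W, g + b + e₁ + e₂ + p + o + o' + c + c' + s + k =
      (g + b + o + o' + s) + (e₁ + e₂ + p + c + c' + k) := fun _ _ _ _ _ => by abel
  rw [a, a] at h
  exact add_right_cancel h

theorem action_congr {W : Type*} [AddCommGroup W] [Module ℂ W]
    {g b e₁ e₂ p o o' c c' s k G B P O O' C C' S : W}
    (hg : g = G) (hb : b = B) (hp : p = P) (ho : o = O) (ho' : o' = O') (hc : c = C) (hc' : c' = C')
    (hs : s = S) : (1 / 2 : ℂ) • g + (1 / 2 : ℂ) • b + e₁ + e₂ + p + o + o' + c + c' + s + k =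
      (1 / 2 : ℂ) • G + (1 / 2 : ℂ) • B + e₁ + e₂ + P + O + O' + C + C' + S + k := by
  rw [hg, hb, hp, ho, ho', hc, hc', hs]

theorem symm_part_eq {W : Type*} [AddCommGroup W] [Module ℂ W] {g b g' b' : W}
    (h : (1 / 2 : ℂ) • g + (1 / 2 : ℂ) • b = (1 / 2 : ℂ) • g' + (1 / 2 : ℂ) • b')
    (h' : (1 / 2 : ℂ) • g + (1 / 2 : ℂ) • -b = (1 / 2 : ℂ) • g' + (1 / 2 : ℂ) • -b') :
    g = g' := by
  linear_combination (norm := module) h + h'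

theorem antisymm_part_eq {W : Type*} [AddCommGroup W] [Module ℂ W] {g b g' b' : W}
    (h : (1 / 2 : ℂ) • g + (1 / 2 : ℂ) • b = (1 / 2 : ℂ) • g' + (1 / 2 : ℂ) • b')
    (h' : (1 / 2 : ℂ) • g + (1 / 2 : ℂ) • -b = (1 / 2 : ℂ) • g' + (1 / 2 : ℂ) • -b') :
    b = b' := by
  linear_combination (norm := module) h - h'

theorem Model.Valid.iPSp_OPSp {M : Model N} (hM : M.Valid) (X : psl N) : M.iPSp (M.OPSp X) = X :=
  LinearMap.congr_fun (Ring.inverse_mul_cancel _ hM.unitPSp) X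

theorem SameFields.lagrangian_eq {X Y : BHBackground N} (hXY : SameFields X Y)
    (hE1 : X.E1 = Y.E1) (hE3 : X.E3 = Y.E3) {Ap Am d e : psl N} (hp : IsPsu Ap) (hm : IsPsu Am)
    {G : Ghosts N} (hG : G.Valid) (hd : pr N 3 d = d) (he : pr N 1 e = e) :
    X.lagrangian Ap Am d e G = Y.lagrangian Ap Am d e G := by
  rw [BHBackground.lagrangian, BHBackground.lagrangian, hE1, hE3]
  exact action_congr (hXY.G Am Ap hm hp) (hXY.B Am Ap hm hp) (hXY.P d e hd he) (hXY.Om Ap hp G hG)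
    (hXY.OmHat Am hm G hG) (hXY.C G hG e he) (hXY.CHat G hG d hd) (hXY.S G hG)

/-! ### Backgrounds with equal fermionic frames that are read off from the same action -/

namespace IsReadOff

section

attribute [local irreducible] pr kf Model.iPSm Model.iPSp Model.iGSm Model.iGSp Model.etaRg
  gsBackground

theorem pr_three_frame {h : (Op N)ˣ} (hh : IsFrameRotation h) (X : psl N) :
    pr N 3 ((h : Op N) (pr N 3 X)) = (h : Op N) (pr N 3 X) := by
  rw [hh.pr_apply, Model.pr_pr_self (by norm_num)]

-- Without ghosts the equation of `d` fixes the bispinor on `P₁ pS A` for real `A`, hence for all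
-- `A` by complex linearity. A grade one `e` is of this form with `A = O_PS+ e`.
set_option maxHeartbeats 1000000 in
theorem P_eq {M : Model N} (hM : M.Valid) {h : (Op N)ˣ} {X Y : BHBackground N}
    (hX : IsReadOff M h X) (hY : IsReadOff M h Y) (hE : X.E1 = Y.E1) {d e : psl N}
    (hd : pr N 3 d = d) (he : pr N 1 e = e) : X.P d e = Y.P d e := by
  have t : ∀ A : psl N, IsPsu A → (X.P d ∘ₗ pr N 1 ∘ₗ M.iPSp) A =
      (Y.P d ∘ₗ pr N 1 ∘ₗ M.iPSp) A := by
    intro A hA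
    have hx := (hX.aux A 0 hA (isPsu_zero N) _ (Ghosts.trivial_valid N)).1 d hd
    have hy := (hY.aux A 0 hA (isPsu_zero N) _ (Ghosts.trivial_valid N)).1 d hd
    rw [Ghosts.trivial_lwHat, map_zero, LinearMap.zero_apply, add_zero, M.brstP_trivial] at hx hy
    rw [hE] at hx
    exact add_left_cancel (hx.trans hy.symm)
  have e' := ext_isPsu t (M.OPSp e)
  have e'' : pr N 1 (M.iPSp (M.OPSp e)) = e := by
    rw [hM.iPSp_OPSp, he]
  rw [← e'']
  exact e'

-- Once the bispinor is known, the auxiliary equations at zero current give `C` and `C̃`, and all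
-- terms with auxiliary fields cancel between the two actions. Zero ghosts then isolate `G + B`,
-- separated by exchanging arguments; zero currents isolate `S`; one nonzero current isolates each
-- spin connection.
set_option maxHeartbeats 1000000 in
theorem sameFields {M : Model N} (hM : M.Valid) {h : (Op N)ˣ} (hh : IsFrameRotation h)
    {X Y : BHBackground N} (hX : IsReadOff M h X) (hY : IsReadOff M h Y) (hE1 : X.E1 = Y.E1)
    (hE3 : X.E3 = Y.E3) : SameFields X Y := by
  have h0 := isPsu_zero N
  have hP : ∀ d e : psl N, pr N 3 d = d → pr N 1 e = e → X.P d e = Y.P d e :=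
    fun d e hd he => P_eq hM hX hY hE1 hd he
  have hP' : ∀ A B : psl N, X.P ((h : Op N) (pr N 3 A)) (pr N 1 B) =
      Y.P ((h : Op N) (pr N 3 A)) (pr N 1 B) := fun A B =>
    hP _ _ (pr_three_frame hh A) (Model.pr_pr_self (by norm_num) B)
  have hC : ∀ G : Ghosts N, G.Valid → ∀ e, pr N 1 e = e → X.C G.lw e = Y.C G.lw e := by
    intro G hG e he
    have hx := (hX.aux 0 0 h0 h0 G hG).2 e he
    have hy := (hY.aux 0 0 h0 h0 G hG).2 e he
    rw [hE3, hP _ _ (pr_three_frame hh _) he] at hx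
    exact add_left_cancel (hx.trans hy.symm)
  have hCHat : ∀ G : Ghosts N, G.Valid → ∀ d, pr N 3 d = d →
      X.CHat G.lwHat d = Y.CHat G.lwHat d := by
    intro G hG d hd
    have hx := (hX.aux 0 0 h0 h0 G hG).1 d hd
    have hy := (hY.aux 0 0 h0 h0 G hG).1 d hd
    rw [hE1, hP _ _ hd (Model.pr_pr_self (by norm_num) _)] at hx
    exact add_left_cancel (hx.trans hy.symm)
  have key : ∀ Ap Am : psl N, IsPsu Ap → IsPsu Am → ∀ G : Ghosts N, G.Valid →
      (1 / 2 : ℂ) • X.G Am Ap + (1 / 2 : ℂ) • X.B Am Ap + X.Om Ap G.lw + X.OmHat Am G.lwHat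
        + X.S G.lw G.lwHat = (1 / 2 : ℂ) • Y.G Am Ap + (1 / 2 : ℂ) • Y.B Am Ap + Y.Om Ap G.lw
        + Y.OmHat Am G.lwHat + Y.S G.lw G.lwHat := by
    intro Ap Am hp hm G hG
    have e := (hX.action Ap Am hp hm G hG).symm.trans (hY.action Ap Am hp hm G hG)
    rw [BHBackground.lagrangian, BHBackground.lagrangian, hE1, hE3, hP',
      hC G hG _ (Model.pr_pr_self (by norm_num) _), hCHat G hG _ (pr_three_frame hh _)] at e
    exact cancel_common e
  have hGB : ∀ u v : psl N, IsPsu u → IsPsu v →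
      (1 / 2 : ℂ) • X.G u v + (1 / 2 : ℂ) • X.B u v =
        (1 / 2 : ℂ) • Y.G u v + (1 / 2 : ℂ) • Y.B u v := by
    intro u v hu hv
    have e := key v u hv hu _ (Ghosts.trivial_valid N)
    simpa only [Ghosts.trivial_lw, Ghosts.trivial_lwHat, map_zero, LinearMap.zero_apply,
      add_zero] using e
  have hS : ∀ G : Ghosts N, G.Valid → X.S G.lw G.lwHat = Y.S G.lw G.lwHat := by
    intro G hG
    simpa only [map_zero, LinearMap.zero_apply, smul_zero, zero_add] using key 0 0 h0 h0 G hG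
  refine ⟨?_, ?_, hP, ?_, ?_, hC, hCHat, hS⟩
  · intro u v hu hv
    have e := hGB v u hv hu
    rw [hX.symm v u hv hu, hY.symm v u hv hu, hX.antisymm v u hv hu, hY.antisymm v u hv hu] at e
    exact symm_part_eq (hGB u v hu hv) e
  · intro u v hu hv
    have e := hGB v u hv hu
    rw [hX.symm v u hv hu, hY.symm v u hv hu, hX.antisymm v u hv hu, hY.antisymm v u hv hu] at e
    exact antisymm_part_eq (hGB u v hu hv) e
  · intro u hu G hG
    have e := key u 0 hu h0 G hG
    rw [hS G hG] at e
    simpa only [map_zero, LinearMap.zero_apply, smul_zero, add_zero, zero_add,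
      add_left_inj] using e
  · intro u hu G hG
    have e := key 0 u h0 hu G hG
    rw [hS G hG] at e
    simpa only [map_zero, LinearMap.zero_apply, smul_zero, add_zero, zero_add,
      add_left_inj] using e

theorem of_sameFields {M : Model N} {h : (Op N)ˣ} (hh : IsFrameRotation h)
    {X Y : BHBackground N} (hXY : SameFields X Y) (hE1 : X.E1 = Y.E1) (hE3 : X.E3 = Y.E3)
    (hY : IsReadOff M h Y) : IsReadOff M h X where
  symm u v hu hv := by rw [hXY.G u v hu hv, hXY.G v u hv hu, hY.symm u v hu hv]
  antisymm u v hu hv := by rw [hXY.B u v hu hv, hXY.B v u hv hu, hY.antisymm u v hu hv]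
  aux Ap Am hp hm G hG := by
    obtain ⟨h₁, h₂⟩ := hY.aux Ap Am hp hm G hG
    refine ⟨fun e he => ?_, fun e he => ?_⟩
    · rw [hE1, hXY.P e _ he (Model.pr_pr_self (by norm_num) _), hXY.CHat G hG e he]
      exact h₁ e he
    · rw [hE3, hXY.P _ e (pr_three_frame hh _) he, hXY.C G hG e he]
      exact h₂ e he
  action Ap Am hp hm G hG := by
    exact (hY.action Ap Am hp hm G hG).trans (hXY.lagrangian_eq hE1 hE3 hp hm hG
      (pr_three_frame hh (M.brstM Am G)) (Model.pr_pr_self (by norm_num) (M.brstP Ap G))).symm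

end

end IsReadOff

theorem Model.Valid.isReadOff_gsBackground {M : Model N} (hM : M.Valid) {h : (Op N)ˣ}
    (hh : IsFrameRotation h) : IsReadOff M h (gsBackground M h) where
  symm u v _ _ := by
    rw [gsBackground_G, gsBackground_G, add_comm]
  antisymm u v _ _ := by
    rw [gsBackground_B, gsBackground_B, neg_sub]
  aux Ap Am _ _ _ hG := hM.auxEquations hh Ap Am hG
  action Ap Am _ _ _ hG := hM.action hh Ap Am hG

theorem Model.Valid.isReadOff_iff {M : Model N} (hM : M.Valid) {h : (Op N)ˣ}
    (hh : IsFrameRotation h) (X : BHBackground N) (hE1 : X.E1 = (gsBackground M h).E1)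
    (hE3 : X.E3 = (gsBackground M h).E3) : IsReadOff M h X ↔ SameFields X (gsBackground M h) :=
  ⟨fun hX => hX.sameFields hM hh (hM.isReadOff_gsBackground hh) hE1 hE3,
    fun hX => IsReadOff.of_sameFields hh hX hE1 hE3 (hM.isReadOff_gsBackground hh)⟩

/-! ## Maurer-Cartan equations of the deformed currents -/

section Abstract

variable {V W : Type*} [AddCommGroup V] [Module ℂ V] [AddCommGroup W] [Module ℂ W]

/-- The Maurer-Cartan equation of a current `J` with `A = (1 + r D) J` and `A` flat. -/
theorem deformed_maurer_cartan (b : V →ₗ[ℂ] V →ₗ[ℂ] V) (r D dm dp : V →ₗ[ℂ] V) {u v Am Ap : V}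
    (swap : ∀ x y, b x y = -b y x)
    (cybe : ∀ x y, b (r x) (r y) = r (b (r x) y + b x (r y)))
    (hm : ∀ y, dm (r y) + b Am (r y) = r (dm y + b Am y))
    (hp : ∀ y, dp (r y) + b Ap (r y) = r (dp y + b Ap y))
    (hDm : ∀ y, dm (D y) = D (dm y)) (hDp : ∀ y, dp (D y) = D (dp y))
    (flat : dm Ap - dp Am + b Am Ap = 0) (hAm : Am = u + r (D u)) (hAp : Ap = v + r (D v)) :
    (dm v - dp u + b u v) + r (D (dm v - dp u + b u v)) =
      r (D (b u v) - b u (D v) - b (D u) v) := by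
  -- After `A = J + r D J` is inserted into flatness, covariance rewrites the derivatives of `r D
  -- J`. The leftover bracket of `r D u` with `r D v` cancels, by Yang-Baxter, the nested `r` terms
  -- that covariance produced.
  have e₁ := hm (D v)
  have e₂ := hp (D u)
  have e₃ := cybe (D u) (D v)
  have s₁ := swap (r (D v)) (D u)
  have s₂ := swap v (D u)
  have s₃ := congrArg r s₁
  have s₄ := congrArg r s₂
  have s₅ := swap v (r (D u))
  have s₆ := swap (r (D v)) (r (D u))
  rw [hDm] at e₁
  rw [hDp] at e₂
  subst hAm hAp
  simp only [map_add, map_sub, map_neg, LinearMap.add_apply] at flat e₁ e₂ e₃ s₃ s₄ ⊢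
  linear_combination (norm := module) flat - e₁ + e₂ + e₃ + s₃ + s₄ - s₅ - s₆

theorem bracket_defect (b : V →ₗ[ℂ] V →ₗ[ℂ] V) (P : ℕ → V →ₗ[ℂ] V) (D : V →ₗ[ℂ] V) (δ : ℕ → ℂ)
    (hs : ∀ x, ∑ i ∈ Finset.range 4, P i x = x)
    (hD : ∀ i ∈ Finset.range 4, ∀ x, D (P i x) = δ i • P i x)
    (hb : ∀ i ∈ Finset.range 4, ∀ j ∈ Finset.range 4, ∀ x y,
      D (b (P i x) (P j y)) = δ ((i + j) % 4) • b (P i x) (P j y)) (u v : V) :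
    D (b u v) - b u (D v) - b (D u) v = ∑ i ∈ Finset.range 4, ∑ j ∈ Finset.range 4,
      (δ ((i + j) % 4) - δ i - δ j) • b (P i u) (P j v) := by
  have e : ∀ x y, b x y = ∑ i ∈ Finset.range 4, ∑ j ∈ Finset.range 4, b (P i x) (P j y) := by
    intro x y
    conv_lhs => rw [← hs x, ← hs y, LinearMap.map_sum₂]
    exact Finset.sum_congr rfl fun i _ => map_sum _ _ _
  have eD : ∀ x, D x = ∑ i ∈ Finset.range 4, δ i • P i x := by
    intro x
    conv_lhs => rw [← hs x, map_sum]
    exact Finset.sum_congr rfl fun i hi => hD i hi x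
  have e₁ : D (b u v) = ∑ i ∈ Finset.range 4, ∑ j ∈ Finset.range 4,
      δ ((i + j) % 4) • b (P i u) (P j v) := by
    rw [e, map_sum]
    refine Finset.sum_congr rfl fun i hi => ?_
    rw [map_sum]
    exact Finset.sum_congr rfl fun j hj => hb i hi j hj u v
  have e₂ : b u (D v) = ∑ i ∈ Finset.range 4, ∑ j ∈ Finset.range 4,
      δ j • b (P i u) (P j v) := by
    conv_lhs => rw [← hs u, eD v, LinearMap.map_sum₂]
    refine Finset.sum_congr rfl fun i _ => ?_
    rw [map_sum]
    exact Finset.sum_congr rfl fun j _ => map_smul _ _ _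
  have e₃ : b (D u) v = ∑ i ∈ Finset.range 4, ∑ j ∈ Finset.range 4,
      δ i • b (P i u) (P j v) := by
    conv_lhs => rw [eD u, ← hs v, LinearMap.map_sum₂]
    refine Finset.sum_congr rfl fun i _ => ?_
    rw [map_sum]
    exact Finset.sum_congr rfl fun j _ => LinearMap.map_smul₂ _ _ _ _
  rw [e₁, e₂, e₃, ← Finset.sum_sub_distrib, ← Finset.sum_sub_distrib]
  refine Finset.sum_congr rfl fun i _ => ?_
  rw [← Finset.sum_sub_distrib, ← Finset.sum_sub_distrib]
  refine Finset.sum_congr rfl fun j _ => ?_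
  module

/-- A bracket compatible with a `ℤ/4`-grading. -/
structure GradedBracket (b : V →ₗ[ℂ] V →ₗ[ℂ] V) (P : ℕ → V →ₗ[ℂ] V) : Prop where
  sum : ∀ x, ∑ i ∈ Finset.range 4, P i x = x
  proj : ∀ k i, k < 4 → i < 4 → ∀ x, P k (P i x) = if k = i then P i x else 0
  bracket : ∀ k i j, k < 4 → ∀ x y,
    P k (b (P i x) (P j y)) = if k = (i + j) % 4 then b (P i x) (P j y) else 0

namespace GradedBracket

variable {b : V →ₗ[ℂ] V →ₗ[ℂ] V} {P : ℕ → V →ₗ[ℂ] V}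

theorem same (h : GradedBracket b P) (k i j : ℕ) (hk : k < 4) (e : k = (i + j) % 4) (x y : V) :
    P k (b (P i x) (P j y)) = b (P i x) (P j y) :=
  (h.bracket k i j hk x y).trans (if_pos e)

theorem other (h : GradedBracket b P) (k i j : ℕ) (hk : k < 4) (e : k ≠ (i + j) % 4) (x y : V) :
    P k (b (P i x) (P j y)) = 0 :=
  (h.bracket k i j hk x y).trans (if_neg e)

theorem proj_eq (h : GradedBracket b P) {k : ℕ} (hk : k < 4) (x y : V) :
    P k (b x y) = ∑ i ∈ Finset.range 4, ∑ j ∈ Finset.range 4,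
      if k = (i + j) % 4 then b (P i x) (P j y) else 0 := by
  conv_lhs => rw [← h.sum x, ← h.sum y, LinearMap.map_sum₂, map_sum]
  refine Finset.sum_congr rfl fun i _ => ?_
  rw [map_sum, map_sum]
  exact Finset.sum_congr rfl fun j _ => h.bracket k i j hk x y

theorem proj_zero (h : GradedBracket b P) (x y : V) :
    P 0 (b x y) = b (P 0 x) (P 0 y) + (b (P 1 x) (P 3 y) + b (P 3 x) (P 1 y))
      + b (P 2 x) (P 2 y) := by
  rw [h.proj_eq (by norm_num)]
  simp [Finset.sum_range_succ]
  abel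

theorem proj_one (h : GradedBracket b P) (x y : V) :
    P 1 (b x y) = (b (P 0 x) (P 1 y) + b (P 1 x) (P 0 y))
      + (b (P 2 x) (P 3 y) + b (P 3 x) (P 2 y)) := by
  rw [h.proj_eq (by norm_num)]
  simp [Finset.sum_range_succ]
  abel

/-- The failure of a combination of projectors to be a derivation of the bracket. -/
theorem defect (h : GradedBracket b P) (a c : ℂ) (u v : V) :
    (a • P 1 (b u v) + (2 : ℂ) • P 2 (b u v) + c • P 3 (b u v))
      - b u (a • P 1 v + (2 : ℂ) • P 2 v + c • P 3 v)
      - b (a • P 1 u + (2 : ℂ) • P 2 u + c • P 3 u) v =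
    (2 - 2 * a) • b (P 1 u) (P 1 v) - (4 : ℂ) • b (P 2 u) (P 2 v)
      + (2 - 2 * c) • b (P 3 u) (P 3 v)
      + (c - a - 2) • (b (P 1 u) (P 2 v) + b (P 2 u) (P 1 v))
      - (a + c) • (b (P 1 u) (P 3 v) + b (P 3 u) (P 1 v))
      + (a - c - 2) • (b (P 2 u) (P 3 v) + b (P 3 u) (P 2 v)) := by
  -- Eigenvalue on each grade. The coefficients of the defect are `δ (i + j) - δ i - δ j` with
  -- indices modulo four; for instance `[2, 2]` gets `0 - 2 - 2 = -4`.
  let δ : ℕ → ℂ := fun i => if i = 1 then a else if i = 2 then 2 else if i = 3 then c else 0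
  have key := bracket_defect b P (a • P 1 + (2 : ℂ) • P 2 + c • P 3) δ h.sum ?_ ?_ u v
  · simp only [LinearMap.add_apply, LinearMap.smul_apply] at key
    rw [key]
    simp [Finset.sum_range_succ, δ]
    module
  · intro i hi x
    rw [Finset.mem_range] at hi
    simp only [LinearMap.add_apply, LinearMap.smul_apply, h.proj _ _ (show 1 < 4 by norm_num) hi,
      h.proj _ _ (show 2 < 4 by norm_num) hi, h.proj _ _ (show 3 < 4 by norm_num) hi, δ]
    interval_cases i <;> simp
  · intro i _ j _ x y
    have hl : (i + j) % 4 < 4 := Nat.mod_lt _ (by norm_num)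
    simp only [LinearMap.add_apply, LinearMap.smul_apply,
      h.bracket _ _ _ (show 1 < 4 by norm_num), h.bracket _ _ _ (show 2 < 4 by norm_num),
      h.bracket _ _ _ (show 3 < 4 by norm_num), δ]
    generalize (i + j) % 4 = l at hl
    interval_cases l <;> simp

end GradedBracket

/-! ### Graded components of the deformed Maurer-Cartan equation -/

namespace DeformedForm

variable {k : V →ₗ[ℂ] V →ₗ[ℂ] W} {b : V →ₗ[ℂ] V →ₗ[ℂ] V} {P : ℕ → V →ₗ[ℂ] V}
  {r mS pS m p : V →ₗ[ℂ] V}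

/-- The covariant exterior derivative `F + [u, v]` of the current of `O_{GS+}`. -/
theorem covariant_p (D : DeformedForm k (P 0) (P 1) (P 2) (P 3) r mS pS m p)
    (h : GradedBracket b P) {u v F : V}
    (e : (F + b u v) + r (-P 1 (F + b u v) + (2 : ℂ) • P 2 (F + b u v) + P 3 (F + b u v)) =
      r ((-P 1 (b u v) + (2 : ℂ) • P 2 (b u v) + P 3 (b u v))
        - b u (-P 1 v + (2 : ℂ) • P 2 v + P 3 v) - b (-P 1 u + (2 : ℂ) • P 2 u + P 3 u) v)) :
    F + b u v = -(4 : ℂ) • p (r (b (P 2 u) (P 2 v)))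
      + (2 : ℂ) • (b (P 1 u) (P 1 v) - p (b (P 1 u) (P 1 v)))
      + (4 : ℂ) • ((b (P 2 u) (P 3 v) + b (P 3 u) (P 2 v))
        - p (b (P 2 u) (P 3 v) + b (P 3 u) (P 2 v))) := by
  -- For the eigenvalues of `d̂_GS` only `[1, 1]`, `[2, 2]` and `[2, 3]` survive, with coefficients
  -- `4`, `-4` and `-4`.
  have d := h.defect (-1) 1 u v
  simp only [neg_one_smul, one_smul] at d
  rw [d] at e
  have e' := congrArg p e
  rw [map_add, D.p_left] at e'
  -- On `[1, 1]` of grade two and `[2, 3]` of grade one, `d̂_GS` is `2` and `-1`, so `p r` reduces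
  -- to `p` and the identity. It vanishes on `[2, 2]` of grade zero, where `p r` has to stay.
  have h₁ := D.p_left (b (P 1 u) (P 1 v))
  have h₂ := D.p_left (b (P 2 u) (P 3 v) + b (P 3 u) (P 2 v))
  simp only [map_add, map_sub, map_smul, map_neg, h.bracket 1 _ _ (by norm_num),
    h.bracket 2 _ _ (by norm_num), h.bracket 3 _ _ (by norm_num)] at e' h₁ h₂ ⊢
  norm_num at e' h₁ h₂ ⊢
  rw [e']
  linear_combination (norm := module) (2 : ℂ) • h₁ + (4 : ℂ) • h₂

/-- The covariant exterior derivative `F + [u, v]` of the current of `O_{GS-}`. -/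
theorem covariant_m (D : DeformedForm k (P 0) (P 1) (P 2) (P 3) r mS pS m p)
    (h : GradedBracket b P) {u v F : V}
    (e : (F + b u v) - r (P 1 (F + b u v) + (2 : ℂ) • P 2 (F + b u v) - P 3 (F + b u v)) =
      -r ((P 1 (b u v) + (2 : ℂ) • P 2 (b u v) - P 3 (b u v))
        - b u (P 1 v + (2 : ℂ) • P 2 v - P 3 v) - b (P 1 u + (2 : ℂ) • P 2 u - P 3 u) v)) :
    F + b u v = (4 : ℂ) • m (r (b (P 2 u) (P 2 v)))
      + (2 : ℂ) • (b (P 3 u) (P 3 v) - m (b (P 3 u) (P 3 v)))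
      + (4 : ℂ) • ((b (P 1 u) (P 2 v) + b (P 2 u) (P 1 v))
        - m (b (P 1 u) (P 2 v) + b (P 2 u) (P 1 v))) := by
  -- For `d_GS` the roles of grades one and three are exchanged: `[3, 3]`, `[2, 2]` and `[1, 2]`
  -- survive.
  have d := h.defect 1 (-1) u v
  simp only [neg_one_smul, one_smul, ← sub_eq_add_neg] at d
  rw [d] at e
  have e' := congrArg m e
  rw [map_sub, D.m_left] at e'
  have h₁ := D.m_left (b (P 3 u) (P 3 v))
  have h₂ := D.m_left (b (P 1 u) (P 2 v) + b (P 2 u) (P 1 v))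
  simp only [map_add, map_sub, map_smul, map_neg, h.bracket 1 _ _ (by norm_num),
    h.bracket 2 _ _ (by norm_num), h.bracket 3 _ _ (by norm_num)] at e' h₁ h₂ ⊢
  norm_num at e' h₁ h₂ ⊢
  rw [e']
  linear_combination (norm := module) (2 : ℂ) • h₁ + (4 : ℂ) • h₂

/-- The bispinor appears because `[2, 3]` has grade one: the coefficient `4` of its undressed term
is lowered to `3` by the `[2, 3]` part of the bracket on the left of `covariant_p`. -/
theorem torsion_p (D : DeformedForm k (P 0) (P 1) (P 2) (P 3) r mS pS m p)
    (h : GradedBracket b P) {u v F : V}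
    (e : (F + b u v) + r (-P 1 (F + b u v) + (2 : ℂ) • P 2 (F + b u v) + P 3 (F + b u v)) =
      r ((-P 1 (b u v) + (2 : ℂ) • P 2 (b u v) + P 3 (b u v))
        - b u (-P 1 v + (2 : ℂ) • P 2 v + P 3 v) - b (-P 1 u + (2 : ℂ) • P 2 u + P 3 u) v)) :
    P 1 F + (b (P 0 u) (P 1 v) + b (P 1 u) (P 0 v)) =
      P 1 ((3 : ℂ) • P 1 (b (P 2 u) (P 3 v) + b (P 3 u) (P 2 v))
        - (4 : ℂ) • p (P 1 (b (P 2 u) (P 3 v) + b (P 3 u) (P 2 v))))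
      + (2 : ℂ) • P 1 (b (P 1 u) (P 1 v) - p (b (P 1 u) (P 1 v)))
      - (4 : ℂ) • P 1 (p (r (b (P 2 u) (P 2 v)))) := by
  have c := congrArg (P 1) (D.covariant_p h e)
  rw [map_add, h.proj_one] at c
  simp only [map_add, map_sub, map_smul, h.same 1 2 3 (by norm_num) (by norm_num),
    h.same 1 3 2 (by norm_num) (by norm_num),
    h.other 1 1 1 (by norm_num) (by norm_num)] at c ⊢
  linear_combination (norm := module) c

/-- The grade zero parts `[1, 3]` and `[2, 2]` of the bracket move to the right, and the undressed
`[1, 1]` and `[2, 3]` vanish under `P 0`. -/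
theorem curvature_p (D : DeformedForm k (P 0) (P 1) (P 2) (P 3) r mS pS m p)
    (h : GradedBracket b P) {u v F : V}
    (e : (F + b u v) + r (-P 1 (F + b u v) + (2 : ℂ) • P 2 (F + b u v) + P 3 (F + b u v)) =
      r ((-P 1 (b u v) + (2 : ℂ) • P 2 (b u v) + P 3 (b u v))
        - b u (-P 1 v + (2 : ℂ) • P 2 v + P 3 v) - b (-P 1 u + (2 : ℂ) • P 2 u + P 3 u) v)) :
    P 0 F + b (P 0 u) (P 0 v) = -(b (P 1 u) (P 3 v) + b (P 3 u) (P 1 v))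
      + -((4 : ℂ) • P 0 (p (P 1 (b (P 2 u) (P 3 v) + b (P 3 u) (P 2 v)))))
      - P 0 (b (P 2 u) (P 2 v) + (4 : ℂ) • p (r (b (P 2 u) (P 2 v))))
      - (2 : ℂ) • P 0 (p (b (P 1 u) (P 1 v))) := by
  have c := congrArg (P 0) (D.covariant_p h e)
  rw [map_add, h.proj_zero] at c
  simp only [map_add, map_sub, map_smul, h.same 1 2 3 (by norm_num) (by norm_num),
    h.same 1 3 2 (by norm_num) (by norm_num),
    h.other 0 2 3 (by norm_num) (by norm_num),
    h.other 0 3 2 (by norm_num) (by norm_num),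
    h.other 0 1 1 (by norm_num) (by norm_num),
    h.same 0 2 2 (by norm_num) (by norm_num)] at c ⊢
  linear_combination (norm := module) c

theorem curvature_m (D : DeformedForm k (P 0) (P 1) (P 2) (P 3) r mS pS m p)
    (h : GradedBracket b P) {u v F : V}
    (e : (F + b u v) - r (P 1 (F + b u v) + (2 : ℂ) • P 2 (F + b u v) - P 3 (F + b u v)) =
      -r ((P 1 (b u v) + (2 : ℂ) • P 2 (b u v) - P 3 (b u v))
        - b u (P 1 v + (2 : ℂ) • P 2 v - P 3 v) - b (P 1 u + (2 : ℂ) • P 2 u - P 3 u) v)) :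
    P 0 F + b (P 0 u) (P 0 v) = -(b (P 1 u) (P 3 v) + b (P 3 u) (P 1 v))
      + -((4 : ℂ) • P 0 (m (P 3 (b (P 1 u) (P 2 v) + b (P 2 u) (P 1 v)))))
      + -P 0 (P 0 (b (P 2 u) (P 2 v)) - (4 : ℂ) • m (r (P 0 (b (P 2 u) (P 2 v)))))
      - (2 : ℂ) • P 0 (m (b (P 3 u) (P 3 v))) := by
  have c := congrArg (P 0) (D.covariant_m h e)
  rw [map_add, h.proj_zero] at c
  simp only [map_add, map_sub, map_smul, h.same 3 1 2 (by norm_num) (by norm_num),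
    h.same 3 2 1 (by norm_num) (by norm_num),
    h.other 0 1 2 (by norm_num) (by norm_num),
    h.other 0 2 1 (by norm_num) (by norm_num),
    h.other 0 3 3 (by norm_num) (by norm_num),
    h.same 0 2 2 (by norm_num) (by norm_num)] at c ⊢
  linear_combination (norm := module) c

end DeformedForm

end Abstract

/-! ## Derivatives of fields -/

section Derivation

variable {A : Type*} [Ring A]

theorem derivation_inv {d : A → A} (mul : ∀ x y, d (x * y) = d x * y + x * d y)
    (one : d 1 = 0) (g : Aˣ) :
    d ((g⁻¹ : Aˣ) : A) = -(((g⁻¹ : Aˣ) : A) * (d g * ((g⁻¹ : Aˣ) : A))) := by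
  have h := mul g ((g⁻¹ : Aˣ) : A)
  rw [Units.mul_inv, one] at h
  have h' := congrArg (((g⁻¹ : Aˣ) : A) * ·) h
  simp only [mul_zero, mul_add, Units.inv_mul_cancel_left] at h'
  exact eq_neg_of_add_eq_zero_right h'.symm

theorem derivation_conj {d : A → A} (mul : ∀ x y, d (x * y) = d x * y + x * d y)
    (one : d 1 = 0) (g : Aˣ) (x : A) :
    d (g * (x * ((g⁻¹ : Aˣ) : A))) = g * (d x * ((g⁻¹ : Aˣ) : A))
      - (-(d g * ((g⁻¹ : Aˣ) : A)) * (g * (x * ((g⁻¹ : Aˣ) : A)))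
        - g * (x * ((g⁻¹ : Aˣ) : A)) * -(d g * ((g⁻¹ : Aˣ) : A))) := by
  rw [mul, mul, derivation_inv mul one]
  simp only [mul_add, mul_neg, neg_mul, mul_assoc, Units.inv_mul_cancel_left]
  abel

theorem derivation_maurer_cartan {d e : A → A} (mul : ∀ x y, d (x * y) = d x * y + x * d y)
    (one : d 1 = 0) (neg : ∀ x, d (-x) = -d x) (mul' : ∀ x y, e (x * y) = e x * y + x * e y)
    (one' : e 1 = 0) (neg' : ∀ x, e (-x) = -e x) (g : Aˣ) (comm : d (e g) = e (d g)) :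
    d (-(e g * ((g⁻¹ : Aˣ) : A))) - e (-(d g * ((g⁻¹ : Aˣ) : A)))
      + (-(d g * ((g⁻¹ : Aˣ) : A)) * -(e g * ((g⁻¹ : Aˣ) : A))
        - -(e g * ((g⁻¹ : Aˣ) : A)) * -(d g * ((g⁻¹ : Aˣ) : A))) = 0 := by
  rw [neg, neg', mul, mul', derivation_inv mul one, derivation_inv mul' one', comm]
  simp only [mul_neg, neg_mul, neg_neg, mul_assoc]
  abel

end Derivation

theorem pdMat_apply (v : ℝ × ℝ) (X : SMat N) (a b : Idx) :
    pdMat N v X a b = pd N v (X a b) := rfl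

theorem pdMat_mul (v : ℝ × ℝ) (X Y : SMat N) :
    pdMat N v (X * Y) = pdMat N v X * Y + X * pdMat N v Y := by
  ext a b
  simp only [pdMat_apply, Matrix.add_apply, Matrix.mul_apply, map_sum, pd_mul,
    Finset.sum_add_distrib]

theorem pdMat_one (v : ℝ × ℝ) : pdMat N v 1 = 0 := by
  ext a b
  rw [pdMat_apply, Matrix.one_apply]
  split_ifs
  · exact pd_one N v
  · exact map_zero _

theorem pdMat_comm (v w : ℝ × ℝ) (X : SMat N) :
    pdMat N v (pdMat N w X) = pdMat N w (pdMat N v X) := by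
  ext a b
  exact pd_comm N v w (X a b)

theorem IsEvenSMat.pdMat {X : SMat N} (hX : IsEvenSMat X) (v : ℝ × ℝ) :
    IsEvenSMat (pdMat N v X) := by
  intro a b
  rw [pdMat_apply, parity_pd, hX, map_smul]

theorem trL_pdMat (v : ℝ × ℝ) (X : SMat N) : trL N (pdMat N v X) = pd N v (trL N X) := by
  simp only [trL_apply, pdMat_apply, map_sum]

theorem trR_pdMat (v : ℝ × ℝ) (X : SMat N) : trR N (pdMat N v X) = pd N v (trR N X) := by
  simp only [trR_apply, pdMat_apply, map_sum]

theorem coe_pdPsl (v : ℝ × ℝ) (X : psl N) : (pdPsl N v X).1 = pdMat N v X.1 := by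
  have h : pdMat N v X.1 ∈ psl N :=
    ⟨IsEvenSMat.pdMat X.2.1 v, by rw [trL_pdMat, X.2.2.1, map_zero],
      by rw [trR_pdMat, X.2.2.2, map_zero]⟩
  exact congrArg Subtype.val (toPsl_coe ⟨pdMat N v X.1, h⟩)

theorem pdPsl_toPsl (v : ℝ × ℝ) {X : SMat N} (hX : IsEvenSMat X) :
    pdPsl N v (toPsl N X) = toPsl N (pdMat N v X) := by
  apply Subtype.ext
  rw [coe_pdPsl, coe_toPsl hX, coe_toPsl (hX.pdMat v), map_sub, trL_pdMat, trR_pdMat]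
  congr 1
  ext a b
  rw [pdMat_apply]
  by_cases h : a = b
  · subst h
    rw [Matrix.diagonal_apply_eq, Matrix.diagonal_apply_eq]
    rcases a with a | a <;> exact map_smul _ _ _
  · rw [Matrix.diagonal_apply_ne _ h, Matrix.diagonal_apply_ne _ h, map_zero]

theorem pdPsl_zpsl (v : ℝ × ℝ) (X : psl N) :
    pdPsl N v (zpsl N X) = zpsl N (pdPsl N v X) := by
  apply Subtype.ext
  rw [coe_pdPsl, coe_zpsl, coe_zpsl, coe_pdPsl]
  ext a b
  rw [pdMat_apply, zfour_apply, zfour_apply, pdMat_apply, map_smul]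

theorem pdPsl_pr (v : ℝ × ℝ) (k : ℕ) (X : psl N) :
    pdPsl N v (pr N k X) = pr N k (pdPsl N v X) := by
  rw [pr_apply, pr_apply]
  simp only [map_add, map_smul, pdPsl_zpsl]

/-! ### The Maurer-Cartan current -/

namespace IsGroupField

theorem isSl_current {g : (SMat N)ˣ} (hg : IsGroupField g) (v : ℝ × ℝ) :
    IsSl (-(pdMat N v (g : SMat N) * ((g⁻¹ : (SMat N)ˣ) : SMat N))) :=
  IsSl.neg ⟨(hg.even.pdMat v).mul hg.even.inv, hg.sdet v⟩

theorem pdPsl_Ad {g : (SMat N)ˣ} (hg : IsGroupField g) (v : ℝ × ℝ) (X : psl N) :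
    pdPsl N v (Ad g X) + br (mc g v) (Ad g X) = Ad g (pdPsl N v X) := by
  have hX := (isSl_coe X).conj hg.even
  have e := derivation_conj (A := SMat N) (pdMat_mul v) (pdMat_one v) g X.1
  rw [Ad_apply, pdPsl_toPsl v hX.even, mc, br_toPsl (hg.isSl_current v) hX, ← map_add, Ad_apply,
    coe_pdPsl, e]
  congr 1
  abel

theorem maurer_cartan {g : (SMat N)ˣ} (hg : IsGroupField g) (v w : ℝ × ℝ) :
    pdPsl N v (mc g w) - pdPsl N w (mc g v) + br (mc g v) (mc g w) = 0 := by
  have e := derivation_maurer_cartan (A := SMat N) (pdMat_mul v) (pdMat_one v) (map_neg _)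
    (pdMat_mul w) (pdMat_one w) (map_neg _) g (pdMat_comm v w (g : SMat N))
  rw [mc, mc, pdPsl_toPsl v (hg.isSl_current w).even, pdPsl_toPsl w (hg.isSl_current v).even,
    br_toPsl (hg.isSl_current v) (hg.isSl_current w), ← map_sub, ← map_add, e, map_zero]

end IsGroupField

/-! ### Covariant constancy and Yang-Baxter equation of the dressed operator `R_g` -/

namespace Model.Valid

theorem Ad_Ad_inv {M : Model N} (hM : M.Valid) (X : psl N) : Ad M.g (Ad M.g⁻¹ X) = X :=
  LinearMap.congr_fun (Ad_mul_Ad_inv hM.group.even) X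

theorem Ad_inv_Ad {M : Model N} (hM : M.Valid) (X : psl N) : Ad M.g⁻¹ (Ad M.g X) = X :=
  LinearMap.congr_fun (Ad_inv_mul_Ad hM.group.even) X

/-- `Ad_g` intertwines the derivative with the covariant derivative built from `A`, and `R` is
constant. -/
theorem covariant_etaRg {M : Model N} (hM : M.Valid) (v : ℝ × ℝ) (X : psl N) :
    pdPsl N v (M.etaRg X) + br (mc M.g v) (M.etaRg X) =
      M.etaRg (pdPsl N v X + br (mc M.g v) X) := by
  have e := hM.group.pdPsl_Ad v (Ad M.g⁻¹ X)
  have e' := hM.group.pdPsl_Ad v (M.R (Ad M.g⁻¹ X))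
  rw [hM.Ad_Ad_inv] at e
  rw [e, etaRg_apply, etaRg_apply, hM.Ad_inv_Ad, map_smul, br_smul_right, ← smul_add, e',
    hM.rmatrix.const]

/-- The homogeneous equation is stable under conjugation by the automorphism `Ad_g`, and under
rescaling because both sides are quadratic in `η`. -/
theorem cybe_etaRg {M : Model N} (hM : M.Valid) (X Y : psl N) :
    br (M.etaRg X) (M.etaRg Y) = M.etaRg (br (M.etaRg X) Y + br X (M.etaRg Y)) := by
  have e : ∀ X Y : psl N, br (Ad M.g X) Y = Ad M.g (br X (Ad M.g⁻¹ Y)) := fun X Y => by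
    rw [← br_Ad hM.group.even, hM.Ad_Ad_inv]
  have e' : ∀ X Y : psl N, br X (Ad M.g Y) = Ad M.g (br (Ad M.g⁻¹ X) Y) := fun X Y => by
    rw [← br_Ad hM.group.even, hM.Ad_Ad_inv]
  simp only [etaRg_apply, br_smul_left, br_smul_right, map_smul, map_add, e, e', hM.Ad_inv_Ad,
    hM.rmatrix.cybe]
  module

end Model.Valid

/-- The Lie bracket as a bilinear map. -/
def brL (N : ℕ) : psl N →ₗ[ℂ] psl N →ₗ[ℂ] psl N :=
  LinearMap.mk₂ ℂ br br_add_left br_smul_left br_add_right br_smul_right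

theorem gradedBracket (N : ℕ) : GradedBracket (brL N) (pr N) where
  sum X := by
    rw [Finset.sum_range_succ, Finset.sum_range_succ, Finset.sum_range_succ, Finset.sum_range_one]
    exact sum_pr X
  proj _ _ hk hj X := by
    rw [pr_pr hk hj]
  bracket _ _ _ hk X Y := pr_br hk X Y

/-! ## Torsion and curvature of the deformed Green-Schwarz currents -/

theorem wedge_apply (i j : ℕ) (X Y : psl N) :
    wedge i j X Y = br (pr N i X) (pr N j Y) + br (pr N j X) (pr N i Y) := rfl

theorem add_mul_apply {V : Type*} [AddCommGroup V] [Module ℂ V] (a b c : Module.End ℂ V) (x : V) :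
    (a * (1 + (4 : ℂ) • (b * c))) x = a (x + (4 : ℂ) • b (c x)) := rfl

theorem mul_one_sub_apply {V : Type*} [AddCommGroup V] [Module ℂ V] (a b : Module.End ℂ V) (x : V) :
    (a * (1 - b)) x = a (x - b x) := rfl

theorem pdPsl_dGS (v : ℝ × ℝ) (X : psl N) : pdPsl N v (dGS N X) = dGS N (pdPsl N v X) := by
  rw [dGS_apply, dGS_apply]
  simp only [map_add, map_sub, map_smul, pdPsl_pr]

theorem pdPsl_dGSt (v : ℝ × ℝ) (X : psl N) : pdPsl N v (dGSt N X) = dGSt N (pdPsl N v X) := by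
  rw [dGSt_apply, dGSt_apply]
  simp only [map_add, map_neg, map_smul, pdPsl_pr]

namespace Model.Valid

section Torsion

attribute [local irreducible] pr kf br pdPsl mc iPSm iPSp iGSm iGSp etaRg gsRR gsC gsCHat gsS

theorem maurer_cartan_GSp {M : Model N} (hM : M.Valid) {u v : psl N}
    (hu : u = M.iGSp (mc M.g vm)) (hv : v = M.iGSp (mc M.g vp)) :
    (extD u v + br u v) + M.etaRg (dGSt N (extD u v + br u v)) =
      M.etaRg (dGSt N (br u v) - br u (dGSt N v) - br (dGSt N u) v) := by
  have D := hM.deformedForm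
  refine deformed_maurer_cartan (brL N) M.etaRg (dGSt N) (pdPsl N vm) (pdPsl N vp)
    br_swap hM.cybe_etaRg (hM.covariant_etaRg vm) (hM.covariant_etaRg vp) (pdPsl_dGSt vm)
    (pdPsl_dGSt vp) (hM.group.maurer_cartan vm vp) ?_ ?_
  · rw [hu]
    exact (D.p_right (mc M.g vm)).symm
  · rw [hv]
    exact (D.p_right (mc M.g vp)).symm

/-- Covariance and the homogeneous Yang-Baxter equation are insensitive to the sign of `r`, so the
plus argument applies to `O_GS- = 1 + (-r) d_GS`. -/
theorem maurer_cartan_GSm {M : Model N} (hM : M.Valid) {u v : psl N}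
    (hu : u = M.iGSm (mc M.g vm)) (hv : v = M.iGSm (mc M.g vp)) :
    (extD u v + br u v) + (-M.etaRg) (dGS N (extD u v + br u v)) =
      (-M.etaRg) (dGS N (br u v) - br u (dGS N v) - br (dGS N u) v) := by
  have D := hM.deformedForm
  have cov : ∀ (w : ℝ × ℝ) (X : psl N), pdPsl N w ((-M.etaRg) X) + br (mc M.g w) ((-M.etaRg) X) =
      (-M.etaRg) (pdPsl N w X + br (mc M.g w) X) := by
    intro w X
    rw [LinearMap.neg_apply, LinearMap.neg_apply, map_neg, br_neg_right, ← hM.covariant_etaRg]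
    abel
  have cybe : ∀ X Y : psl N, br ((-M.etaRg) X) ((-M.etaRg) Y) =
      (-M.etaRg) (br ((-M.etaRg) X) Y + br X ((-M.etaRg) Y)) := by
    intro X Y
    rw [LinearMap.neg_apply, LinearMap.neg_apply, LinearMap.neg_apply, br_neg_left, br_neg_right,
      br_neg_left, br_neg_right, neg_neg, ← neg_add, map_neg, neg_neg, hM.cybe_etaRg]
  have hA : ∀ X : psl N, X = M.iGSm X + (-M.etaRg) (dGS N (M.iGSm X)) := by
    intro X
    rw [LinearMap.neg_apply, ← sub_eq_add_neg]
    exact (D.m_right X).symm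
  refine deformed_maurer_cartan (brL N) (-M.etaRg) (dGS N) (pdPsl N vm) (pdPsl N vp)
    br_swap cybe (cov vm) (cov vp) (pdPsl_dGS vm)
    (pdPsl_dGS vp) (hM.group.maurer_cartan vm vp) ?_ ?_
  · rw [hu]
    exact hA (mc M.g vm)
  · rw [hv]
    exact hA (mc M.g vp)

theorem torsion_GSp {M : Model N} (hM : M.Valid) {u v : psl N}
    (hu : u = M.iGSp (mc M.g vm)) (hv : v = M.iGSp (mc M.g vp)) :
    pr N 1 (extD u v) + wedge 0 1 u v = M.gsRR (wedge 2 3 u v)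
      + (2 : ℂ) • (pr N 1 * (1 - M.iGSp)) (br (pr N 1 u) (pr N 1 v))
      - (4 : ℂ) • (pr N 1 * M.iGSp * M.etaRg) (br (pr N 2 u) (pr N 2 v)) := by
  have e := hM.maurer_cartan_GSp hu hv
  rw [gsRR_apply, mul_one_sub_apply, wedge_apply, wedge_apply]
  exact hM.deformedForm.torsion_p (gradedBracket N) e

theorem curvature_GSp {M : Model N} (hM : M.Valid) {u v : psl N}
    (hu : u = M.iGSp (mc M.g vm)) (hv : v = M.iGSp (mc M.g vp)) :
    pr N 0 (extD u v) + br (pr N 0 u) (pr N 0 v) =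
      -wedge 1 3 u v + M.gsC (wedge 2 3 u v)
        - (pr N 0 * (1 + (4 : ℂ) • (M.iGSp * M.etaRg))) (br (pr N 2 u) (pr N 2 v))
        - (2 : ℂ) • (pr N 0 * M.iGSp) (br (pr N 1 u) (pr N 1 v)) := by
  have e := hM.maurer_cartan_GSp hu hv
  rw [gsC_apply, add_mul_apply, wedge_apply, wedge_apply]
  exact hM.deformedForm.curvature_p (gradedBracket N) e

theorem curvature_GSm {M : Model N} (hM : M.Valid) {u v : psl N}
    (hu : u = M.iGSm (mc M.g vm)) (hv : v = M.iGSm (mc M.g vp)) :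
    pr N 0 (extD u v) + br (pr N 0 u) (pr N 0 v) =
      -wedge 1 3 u v + M.gsCHat (wedge 1 2 u v) + M.gsS (br (pr N 2 u) (pr N 2 v))
        - (2 : ℂ) • (pr N 0 * M.iGSm) (br (pr N 3 u) (pr N 3 v)) := by
  have e := hM.maurer_cartan_GSm hu hv
  rw [LinearMap.neg_apply, LinearMap.neg_apply, ← sub_eq_add_neg] at e
  rw [gsCHat_apply, gsS_apply, wedge_apply, wedge_apply]
  exact hM.deformedForm.curvature_m (gradedBracket N) e

end Torsion

end Model.Valid

/-! ### Sector remainders in terms of the fermionic supervielbeins -/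

namespace Model

section Mixing

attribute [local irreducible] pr kf iPSm iPSp iGSm iGSp etaRg thetaP

theorem mixing_E3 (M : Model N) (h : (Op N)ˣ) (T : Op N) (X : psl N) :
    (pr N 0 * T * pr N 3) ((gsBackground M h).E3 X) = pr N 0 (T (pr N 3 (M.iGSm X))) :=
  by rw [gsBackground_E3, Module.End.mul_apply, Module.End.mul_apply, pr_pr_self (by norm_num)]

theorem mixing_E1 (M : Model N) (h : (Op N)ˣ) (T : Op N) (X : psl N) :
    (pr N 0 * T * pr N 1 * ((h⁻¹ : (Op N)ˣ) : Op N)) ((gsBackground M h).E1 X) =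
      pr N 0 (T (pr N 1 (M.iGSp X))) := by
  rw [gsBackground_E1, Module.End.mul_apply, Module.End.mul_apply, Module.End.mul_apply,
    inv_apply_frame, pr_pr_self (by norm_num)]

theorem eq_add_smul_congr {W : Type*} [AddCommGroup W] [Module ℂ W] {q a b x y x' y' : W} {c : ℂ}
    (h : q = a + b + c • x + c • y) (hx : x' = x) (hy : y' = y) :
    q = a + b + c • x' + c • y' := by
  rw [h, hx, hy]

theorem Valid.current_sector_E {M : Model N} (hM : M.Valid) (h : (Op N)ˣ) (Ap Am : psl N)
    {G : Ghosts N} (hG : G.Valid) :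
    kf N G.Np (M.iPSm Am) + kf N G.Nm (M.iPSp Ap) =
      (gsBackground M h).Om Ap G.lw + (gsBackground M h).OmHat Am G.lwHat
        + (4 / 3 : ℂ) • kf N ((pr N 0 * M.iPSm * pr N 3) ((gsBackground M h).E3 Am)) G.Np
        + (4 / 3 : ℂ) • kf N ((pr N 0 * M.iPSp * pr N 1 * ((h⁻¹ : (Op N)ˣ) : Op N))
            ((gsBackground M h).E1 Ap)) G.Nm :=
  eq_add_smul_congr (hM.current_sector h Ap Am hG)
    (congrArg (fun Z => kf N Z G.Np) (M.mixing_E3 h M.iPSm Am))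
    (congrArg (fun Z => kf N Z G.Nm) (M.mixing_E1 h M.iPSp Ap))

theorem Valid.kinetic_sector_E {M : Model N} (hM : M.Valid) (h : (Op N)ˣ) (Ap Am : psl N) :
    (1 / 4 : ℂ) • kf N Ap (dPS N (M.iPSm Am)) =
      (1 / 2 : ℂ) • (gsBackground M h).G Am Ap + (1 / 2 : ℂ) • (gsBackground M h).B Am Ap
        + kf N ((gsBackground M h).E3 Am)
            ((pr N 1 * M.thetaP * pr N 1 * ((h⁻¹ : (Op N)ˣ) : Op N))
              ((gsBackground M h).E1 Ap)) := by
  rw [hM.thetaP_E1 h Ap]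
  exact hM.kinetic_sector h Ap Am

theorem Valid.thetaP_iGSp {M : Model N} (hM : M.Valid) (X : psl N) :
    (pr N 1 * M.thetaP * pr N 1 * M.iGSp * M.etaRg) X = pr N 1 (M.iPSp (M.etaRg X)) := by
  rw [Module.End.mul_apply, Module.End.mul_apply, Module.End.mul_apply, Module.End.mul_apply,
    hM.thetaP_apply, hM.deformedForm.P₁_thetaP_P₁_p]

theorem Valid.curvature_sector_E {M : Model N} (hM : M.Valid) (h : (Op N)ˣ) {G : Ghosts N}
    (hG : G.Valid) :
    -kf N G.Np (G.Nm - (4 : ℂ) • M.iPSm (M.etaRg G.Nm)) =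
      (gsBackground M h).S G.lw G.lwHat
        - (16 : ℂ) • kf N ((pr N 3 * M.iGSm * M.etaRg) G.Nm)
            ((pr N 1 * M.thetaP * pr N 1 * M.iGSp * M.etaRg) G.Np) := by
  rw [hM.thetaP_iGSp]
  exact hM.curvature_sector h hG

end Mixing

end Model

end YB

end

theorem mainTheorem4 (N : ℕ) (M : Model N) (hM : M.Valid)
    (h : (Op N)ˣ) (hh : IsFrameRotation h) :
    -- the operators relating the pure spinor and the Green-Schwarz currents
    (M.iPSm = M.thetaM * M.iGSm ∧ M.iPSp = M.thetaP * M.iGSp ∧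
      M.thetaM = 1 - (4 / 3 : ℂ) • pr N 3 + (4 / 3 : ℂ) • (M.iPSm * pr N 3) ∧
      Ring.inverse M.thetaM = 1 - (4 : ℂ) • pr N 3 + (4 : ℂ) • (M.iGSm * pr N 3) ∧
      M.thetaP = 1 - (4 / 3 : ℂ) • pr N 1 + (4 / 3 : ℂ) • (M.iPSp * pr N 1) ∧
      Ring.inverse M.thetaP = 1 - (4 : ℂ) • pr N 1 + (4 : ℂ) • (M.iGSp * pr N 1)) ∧
    -- the deformed pure spinor Lagrangian in Green-Schwarz variables, sector by sector
    (∀ Ap Am : psl N,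
      (1 / 4 : ℂ) • kf N Ap (dPS N (M.iPSm Am)) =
        (1 / 2 : ℂ) • (gsBackground M h).G Am Ap + (1 / 2 : ℂ) • (gsBackground M h).B Am Ap
          + kf N ((gsBackground M h).E3 Am)
              ((pr N 1 * M.thetaP * pr N 1 * ((h⁻¹ : (Op N)ˣ) : Op N))
                ((gsBackground M h).E1 Ap))) ∧
    (∀ (Ap Am : psl N) (G : Ghosts N), G.Valid →
      kf N G.Np (M.iPSm Am) + kf N G.Nm (M.iPSp Ap) =
        (gsBackground M h).Om Ap G.lw + (gsBackground M h).OmHat Am G.lwHat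
          + (4 / 3 : ℂ) • kf N ((pr N 0 * M.iPSm * pr N 3) ((gsBackground M h).E3 Am)) G.Np
          + (4 / 3 : ℂ) • kf N ((pr N 0 * M.iPSp * pr N 1 * ((h⁻¹ : (Op N)ˣ) : Op N))
              ((gsBackground M h).E1 Ap)) G.Nm) ∧
    (∀ G : Ghosts N, G.Valid →
      -kf N G.Np (G.Nm - (4 : ℂ) • M.iPSm (M.etaRg G.Nm)) =
        (gsBackground M h).S G.lw G.lwHat
          - (16 : ℂ) • kf N ((pr N 3 * M.iGSm * M.etaRg) G.Nm)
              ((pr N 1 * M.thetaP * pr N 1 * M.iGSp * M.etaRg) G.Np)) ∧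
    -- the background read off from the pure spinor action is that of the Green-Schwarz superstring
    (∀ X : BHBackground N, X.E1 = (gsBackground M h).E1 → X.E3 = (gsBackground M h).E3 →
      (IsReadOff M h X ↔ SameFields X (gsBackground M h))) ∧
    -- in particular the two Lagrangians agree on worldsheet fields
    (∀ G : Ghosts N, G.Valid →
      (gsBackground M h).AuxEquations (mc M.g vp) (mc M.g vm)
        ((h : Op N) (pr N 3 (M.brstM (mc M.g vm) G))) (pr N 1 (M.brstP (mc M.g vp) G)) G ∧
      M.psLagrangian (mc M.g vp) (mc M.g vm) G =
        (gsBackground M h).lagrangian (mc M.g vp) (mc M.g vm)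
          ((h : Op N) (pr N 3 (M.brstM (mc M.g vm) G))) (pr N 1 (M.brstP (mc M.g vp) G)) G) ∧
    -- the metric and the `B`-field in terms of the Green-Schwarz currents
    (∀ u v : psl N,
      (gsBackground M h).G u v = kf N (pr N 2 (M.iGSp u)) (pr N 2 (M.iGSp v)) ∧
      (gsBackground M h).G u v = kf N (pr N 2 (M.iGSm u)) (pr N 2 (M.iGSm v)) ∧
      (gsBackground M h).B u v = (1 / 2 : ℂ) • kf N (M.iGSm v)
        ((pr N 1 - pr N 3 + dGSt N * M.etaRg * dGS N) (M.iGSm u))) ∧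
    -- the Ramond-Ramond bispinor and its inverse
    ((h : Op N) * M.gsRR * -(pr N 1 * M.thetaP * pr N 1 * ((h⁻¹ : (Op N)ˣ) : Op N)) = pr N 1 ∧
      -(pr N 1 * M.thetaP * pr N 1 * ((h⁻¹ : (Op N)ˣ) : Op N)) * ((h : Op N) * M.gsRR) = pr N 1) ∧
    -- the bispinor and the `C`, `S` superfields are torsion and curvature components of the
    -- Green-Schwarz supergeometry
    (∀ Jm Jp : psl N, Jm = M.iGSp (mc M.g vm) → Jp = M.iGSp (mc M.g vp) →
      pr N 1 (extD Jm Jp) + wedge 0 1 Jm Jp =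
        M.gsRR (wedge 2 3 Jm Jp)
          + (2 : ℂ) • (pr N 1 * (1 - M.iGSp)) (br (pr N 1 Jm) (pr N 1 Jp))
          - (4 : ℂ) • (pr N 1 * M.iGSp * M.etaRg) (br (pr N 2 Jm) (pr N 2 Jp)) ∧
      pr N 0 (extD Jm Jp) + br (pr N 0 Jm) (pr N 0 Jp) =
        -wedge 1 3 Jm Jp + M.gsC (wedge 2 3 Jm Jp)
          - (pr N 0 * (1 + (4 : ℂ) • (M.iGSp * M.etaRg))) (br (pr N 2 Jm) (pr N 2 Jp))
          - (2 : ℂ) • (pr N 0 * M.iGSp) (br (pr N 1 Jm) (pr N 1 Jp))) ∧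
    (∀ Jm Jp : psl N, Jm = M.iGSm (mc M.g vm) → Jp = M.iGSm (mc M.g vp) →
      pr N 0 (extD Jm Jp) + br (pr N 0 Jm) (pr N 0 Jp) =
        -wedge 1 3 Jm Jp + M.gsCHat (wedge 1 2 Jm Jp)
          + M.gsS (br (pr N 2 Jm) (pr N 2 Jp))
          - (2 : ℂ) • (pr N 0 * M.iGSm) (br (pr N 3 Jm) (pr N 3 Jp))) := by
  refine ⟨⟨hM.iPSm_eq, hM.iPSp_eq, hM.thetaM_eq, hM.inverse_thetaM_eq, hM.thetaP_eq,
    hM.inverse_thetaP_eq⟩, hM.kinetic_sector_E h,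
    fun Ap Am G hG => hM.current_sector_E h Ap Am hG, fun G hG => hM.curvature_sector_E h hG,
    hM.isReadOff_iff hh, fun G hG => ⟨hM.auxEquations hh _ _ hG, hM.action hh _ _ hG⟩,
    fun u v => ⟨(hM.metric h u v).1, (hM.metric h u v).2, hM.bfield h u v⟩,
    ⟨hM.gsRR_mul_inverse hh, hM.inverse_mul_gsRR⟩,
    fun Jm Jp hm hp => ⟨hM.torsion_GSp hm hp, hM.curvature_GSp hm hp⟩,
    fun Jm Jp hm hp => hM.curvature_GSm hm hp⟩
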